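/- Let $q\in\mathbb C^\ast$ with $|q|=1$, $q$ not a root of unity. Write $(a;q)_n=\prod_{k=0}^{n-1}(1-q^ka)$ and assume that the power series $\sum_{n\ge 0}\frac{x^n}{(q;q)_n}$ converges (i.e. has positive radius of convergence). Let $K=\mathbb C(\{x\})$ be the field of germs at $0$ of meromorphic functions and $\widehat K=\mathbb C((x))$, both with the automorphism $\sigma_q\colon f(x)\mapsto f(qx)$. A $q$-difference module over $K$ (resp. $\widehat K$) is a finite-dimensional vector space $M$ over that field with a bijective additive map $\Sigma_q\colon M\to M$ such that $\Sigma_q(fm)=\sigma_q(f)\Sigma_q(m)$; morphisms are linear maps over that field commuting with the operators $\Sigma_q$. Let $\mathcal B_q$ be the category of $q$-difference modules over $K$. Let $\mathcal B_q^{iso}$ be the full subcategory of $\mathcal B_q$ of those $M$ such that every $N$ in $\mathcal B_q$ for which $N\otimes_K\widehat K$ and $M\otimes_K\widehat K$ are isomorphic as $q$-difference modules over $\widehat K$ is already isomorphic to $M$ in $\mathcal B_q$. The Newton polygon of an operator $\mathcal L=\sum_{i=0}^\nu a_i(x)\sigma_q^i$ with $a_i\in\mathbb C\{x\}$, $a_\nu\ne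 0$, is the convex hull of $\{(i,k): a_i\neq 0,\ k\ge \mathrm{ord}_x a_i\}\subset\mathbb R^2$, and its slopes are those of the non-vertical sides of its boundary. A module $M$ in $\mathcal B_q$ is pure of slope zero if there is an operator $\mathcal L$ of order $\nu=\dim_K M$ whose Newton polygon has no slope other than $0$ and for which $M\cong K[\sigma_q,\sigma_q^{-1}]/K[\sigma_q,\sigma_q^{-1}]\mathcal L$, i.e. there is $m\in M$ such that $m,\Sigma_qm,\dots,\Sigma_q^{\nu-1}m$ is a $K$-basis of $M$ and $\sum_i a_i\Sigma_q^i m=0$ (the zero module is included). Let $\mathcal B_q^{iso,f}$ be the full subcategory of $\mathcal B_q^{iso}$ of the modules that are pure of slope zero. Then $\mathcal B_q^{iso,f}$ is equivalent to the following category. Its objects are the finite-dimensional $\mathbb C^\ast/q^{\mathbb Z}$-graded complex vector spaces $V$ endowed with a nilpotent linear operator preserving the grading, that have the property $(\mathcal D)$ for every set $\lambda_1,\dots,\lambda_n\in\mathbb C^\ast$ of representatives (one for each class) of the classes of $\mathbb C^\ast/q^{\mathbb Z}$ corresponding to the nonzero homogeneous components of $V$, the power series $$\phi_{(q;\underline\Lambda)}(x)=\sum_{m\ge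 0}\frac{x^m}{\prod_{\lambda\in\underline\Lambda}(\lambda;q)_m},\qquad \underline\Lambda=\{\lambda_i\lambda_j^{-1} : i,j=1,\dots,n;\ \lambda_i\lambda_j^{-1}\notin q^{\mathbb Z_{\le 0}}\},$$ has a positive radius of convergence. Its morphisms are the $\mathbb C$-linear maps that preserve the grading and commute with the nilpotent operators. -/

import Mathlib

universe u

open CategoryTheory
open scoped TensorProduct

noncomputable section

namespace QDifference

/-! ## Convergent series, germs of meromorphic functions, the operator `σ_q` -/

/-- The power series `∑ c n * x ^ n` has a positive radius of convergence. -/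
def Converges (c : ℕ → ℂ) : Prop :=
  ∃ r : ℝ, 0 < r ∧ Summable fun n => ‖c n‖ * r ^ n

theorem converges_iff_bound {c : ℕ → ℂ} :
    Converges c ↔ ∃ A B : ℝ, 0 ≤ A ∧ 0 < B ∧ ∀ n, ‖c n‖ ≤ A * B ^ n := by
  constructor
  · rintro ⟨r, hr, hs⟩
    refine ⟨∑' n, ‖c n‖ * r ^ n, r⁻¹, tsum_nonneg fun n => by positivity, by positivity,
      fun n => ?_⟩
    have h := hs.le_tsum n (fun j _ => by positivity)
    rw [inv_pow, ← div_eq_mul_inv, le_div_iff₀ (by positivity)]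
    exact h
  · rintro ⟨A, B, hA, hB, h⟩
    refine ⟨(2 * B)⁻¹, by positivity, ?_⟩
    refine Summable.of_nonneg_of_le (fun n => by positivity) (fun n => ?_)
      (summable_geometric_two.mul_left A)
    calc ‖c n‖ * (2 * B)⁻¹ ^ n ≤ (A * B ^ n) * (2 * B)⁻¹ ^ n := by
          gcongr; exact h n
      _ = A * (1 / 2) ^ n := by
          rw [mul_assoc, ← mul_pow]; congr 2; field_simp

theorem converges_succ {c : ℕ → ℂ} : Converges (fun n => c (n + 1)) ↔ Converges c := by
  have key : ∀ r : ℝ, 0 < r →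
      ((Summable fun n => ‖c (n + 1)‖ * r ^ n) ↔ Summable fun n => ‖c n‖ * r ^ n) := by
    intro r hr
    rw [← summable_nat_add_iff (f := fun n => ‖c n‖ * r ^ n) 1,
      ← summable_mul_right_iff (f := fun n => ‖c (n + 1)‖ * r ^ n) hr.ne']
    simp only [pow_succ, mul_assoc]
  exact exists_congr fun r => and_congr_right fun hr => key r hr

theorem converges_shift (c : ℤ → ℂ) (k : ℤ) :
    Converges (fun n : ℕ => c (n + k)) ↔ Converges (fun n : ℕ => c n) := by
  have step : ∀ k : ℤ,
      (Converges (fun n : ℕ => c (n + (k + 1))) ↔ Converges (fun n : ℕ => c (n + k))) := by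
    intro k
    rw [← converges_succ (c := fun n : ℕ => c (n + k))]
    have : (fun n : ℕ => c (n + (k + 1))) = fun n : ℕ => c (((n + 1 : ℕ) : ℤ) + k) := by
      funext n; congr 1; push_cast; ring
    rw [this]
  induction k using Int.induction_on with
  | zero => simp
  | succ i ih => exact (step i).trans ih
  | pred i ih =>
    have h := step (-i - 1)
    rw [sub_add_cancel] at h
    exact h.symm.trans ih

theorem Converges.add {c d : ℕ → ℂ} (hc : Converges c) (hd : Converges d) :
    Converges fun n => c n + d n := by
  rw [converges_iff_bound] at *
  obtain ⟨A, B, hA, hB, h⟩ := hc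
  obtain ⟨A', B', hA', hB', h'⟩ := hd
  refine ⟨A + A', max B B', by positivity, by positivity, fun n => ?_⟩
  calc ‖c n + d n‖ ≤ A * B ^ n + A' * B' ^ n := (norm_add_le _ _).trans (add_le_add (h n) (h' n))
    _ ≤ A * (max B B') ^ n + A' * (max B B') ^ n := by
        gcongr
        · exact le_max_left _ _
        · exact le_max_right _ _
    _ = (A + A') * (max B B') ^ n := by ring

theorem Converges.mul {f g : PowerSeries ℂ} (hf : Converges fun n => PowerSeries.coeff n f)
    (hg : Converges fun n => PowerSeries.coeff n g) :
    Converges fun n => PowerSeries.coeff n (f * g) := by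
  rw [converges_iff_bound] at *
  obtain ⟨A, B, hA, hB, h⟩ := hf
  obtain ⟨A', B', hA', hB', h'⟩ := hg
  refine ⟨A * A', 2 * max B B', by positivity, by positivity, fun n => ?_⟩
  rw [PowerSeries.coeff_mul]
  calc ‖∑ p ∈ Finset.HasAntidiagonal.antidiagonal n, PowerSeries.coeff p.1 f * PowerSeries.coeff p.2 g‖
      ≤ ∑ p ∈ Finset.HasAntidiagonal.antidiagonal n, A * A' * (max B B') ^ n := by
        refine (norm_sum_le _ _).trans (Finset.sum_le_sum fun p hp => ?_)
        rw [norm_mul]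
        calc _ ≤ (A * B ^ p.1) * (A' * B' ^ p.2) := by
              gcongr
              · exact h _
              · exact h' _
          _ ≤ (A * (max B B') ^ p.1) * (A' * (max B B') ^ p.2) := by
              gcongr
              · exact le_max_left _ _
              · exact le_max_right _ _
          _ = A * A' * (max B B') ^ n := by
              rw [← Finset.HasAntidiagonal.mem_antidiagonal.mp hp, pow_add]; ring
    _ = (n + 1) * (A * A' * (max B B') ^ n) := by simp
    _ ≤ 2 ^ n * (A * A' * (max B B') ^ n) := by
        gcongr
        exact_mod_cast Nat.lt_two_pow_self (n := n)
    _ = A * A' * (2 * max B B') ^ n := by rw [mul_pow]; ring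

theorem Converges.inv {f : PowerSeries ℂ} (hf : Converges fun n => PowerSeries.coeff n f) :
    Converges fun n => PowerSeries.coeff n f⁻¹ := by
  rw [converges_iff_bound] at *
  obtain ⟨A, B, hA, hB, h⟩ := hf
  set a : ℝ := ‖(PowerSeries.constantCoeff f)⁻¹‖ with ha
  have ha0 : 0 ≤ a := norm_nonneg _
  refine ⟨a, B * (1 + a * A), ha0, by positivity, fun n => ?_⟩
  induction n using Nat.strong_induction_on with
  | _ n ih =>
    rw [PowerSeries.coeff_inv]
    split_ifs with hn
    · subst hn; simp [ha]
    · rw [norm_mul, norm_neg]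
      refine mul_le_mul_of_nonneg_left ?_ ha0
      have hsum : ∀ m : ℕ, ∑ k ∈ Finset.range m, (a * A) * (1 + a * A) ^ k = (1 + a * A) ^ m - 1 := by
        intro m
        rw [← Finset.mul_sum, mul_comm]
        simpa using geom_sum_mul (1 + a * A) m
      calc _ ≤ ∑ p ∈ Finset.HasAntidiagonal.antidiagonal n,
              (if p.2 < n then B ^ n * ((a * A) * (1 + a * A) ^ p.2) else 0) := by
            refine (norm_sum_le _ _).trans (Finset.sum_le_sum fun p hp => ?_)
            split_ifs with hlt
            · rw [norm_mul]
              calc _ ≤ (A * B ^ p.1) * (a * (B * (1 + a * A)) ^ p.2) := by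
                    gcongr
                    · exact h _
                    · exact ih _ hlt
                _ = _ := by
                    rw [← Finset.HasAntidiagonal.mem_antidiagonal.mp hp, pow_add, mul_pow]; ring
            · simp
        _ = ∑ k ∈ Finset.range n, B ^ n * ((a * A) * (1 + a * A) ^ k) := by
            rw [Finset.Nat.sum_antidiagonal_eq_sum_range_succ_mk, Finset.sum_range_succ',
              ← Finset.sum_range_reflect (fun k => B ^ n * ((a * A) * (1 + a * A) ^ k))]
            simp only [Nat.sub_zero, lt_irrefl, if_false, add_zero]
            refine Finset.sum_congr rfl fun k hk => ?_
            have := Finset.mem_range.mp hk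
            rw [if_pos (by omega), show n - (k + 1) = n - 1 - k by omega]
        _ = B ^ n * ((1 + a * A) ^ n - 1) := by rw [← Finset.mul_sum, hsum]
        _ ≤ (B * (1 + a * A)) ^ n := by
            rw [mul_pow]
            have : 0 ≤ B ^ n := by positivity
            nlinarith

theorem coeff_single_one_mul (k n : ℤ) (f : LaurentSeries ℂ) :
    (HahnSeries.single k (1 : ℂ) * f).coeff n = f.coeff (n - k) := by
  have := HahnSeries.coeff_single_mul_add (r := (1 : ℂ)) (x := f) (a := n - k) (b := k)
  rwa [sub_add_cancel, one_mul] at this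

theorem converges_single_mul (k : ℤ) (f : LaurentSeries ℂ) :
    Converges (fun n : ℕ => (HahnSeries.single k (1 : ℂ) * f).coeff n) ↔
      Converges (fun n : ℕ => f.coeff n) := by
  simp only [coeff_single_one_mul, sub_eq_add_neg]
  exact converges_shift f.coeff (-k)

theorem converges_powerSeriesPart (f : LaurentSeries ℂ) :
    Converges (fun n => PowerSeries.coeff n f.powerSeriesPart) ↔
      Converges (fun n : ℕ => f.coeff n) := by
  simp only [LaurentSeries.powerSeriesPart_coeff, add_comm f.order]
  exact converges_shift f.coeff _

/-- `K = ℂ({x})`, the field of germs at `0` of meromorphic functions, as a subfield of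
`ℂ((x))`: the Laurent series with finite polar part that converge in a punctured
neighbourhood of `0`. -/
def meroGerms : Subfield (LaurentSeries ℂ) where
  carrier := {f | Converges fun n : ℕ => f.coeff n}
  mul_mem' {f g} hf hg := by
    have e : f * g = HahnSeries.single (f.order + g.order) (1 : ℂ) *
        ((f.powerSeriesPart * g.powerSeriesPart : PowerSeries ℂ) : LaurentSeries ℂ) := by
      conv_lhs => rw [← f.single_order_mul_powerSeriesPart, ← g.single_order_mul_powerSeriesPart]
      rw [map_mul, mul_mul_mul_comm, HahnSeries.single_mul_single, one_mul]
    change Converges _ at hf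
    change Converges _ at hg
    change Converges _
    rw [e, converges_single_mul]
    simp only [LaurentSeries.coeff_coe_powerSeries]
    exact Converges.mul ((converges_powerSeriesPart f).2 hf) ((converges_powerSeriesPart g).2 hg)
  one_mem' := by
    refine ⟨1, one_pos, summable_of_ne_finset_zero (s := {0}) fun n hn => ?_⟩
    have hn' : n ≠ 0 := by simpa using hn
    simp [HahnSeries.coeff_one, hn']
  add_mem' {f g} hf hg := Converges.add hf hg
  zero_mem' := ⟨1, one_pos, by simp⟩
  neg_mem' {f} hf := by
    change Converges _
    simpa [Converges] using hf
  inv_mem' f hf := by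
    rcases eq_or_ne f 0 with rfl | h0
    · simpa using hf
    have hc : PowerSeries.constantCoeff f.powerSeriesPart ≠ 0 := by
      rw [← PowerSeries.coeff_zero_eq_constantCoeff_apply, LaurentSeries.powerSeriesPart_coeff]
      simpa using (HahnSeries.coeff_order_eq_zero (x := f)).not.2 h0
    have e : f⁻¹ = HahnSeries.single (-f.order) (1 : ℂ) *
        ((f.powerSeriesPart⁻¹ : PowerSeries ℂ) : LaurentSeries ℂ) := by
      refine inv_eq_of_mul_eq_one_right ?_
      have e' := f.single_order_mul_powerSeriesPart
      calc _ = (HahnSeries.single f.order (1 : ℂ) * (f.powerSeriesPart : LaurentSeries ℂ)) *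
            (HahnSeries.single (-f.order) (1 : ℂ) *
              ((f.powerSeriesPart⁻¹ : PowerSeries ℂ) : LaurentSeries ℂ)) := by rw [e']
        _ = 1 := ?_
      rw [mul_mul_mul_comm, HahnSeries.single_mul_single, ← map_mul,
        PowerSeries.mul_inv_cancel _ hc]
      simp
    change Converges _ at hf
    change Converges _
    rw [e, converges_single_mul]
    simp only [LaurentSeries.coeff_coe_powerSeries]
    exact Converges.inv ((converges_powerSeriesPart f).2 hf)

/-- `f(x) ↦ f(qx)` on Laurent series. -/
def dilate (q : ℂˣ) (f : LaurentSeries ℂ) : LaurentSeries ℂ where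
  coeff n := (q : ℂ) ^ n * f.coeff n
  isPWO_support' := f.isPWO_support.mono fun n hn => by
    simp only [Function.mem_support] at hn
    exact right_ne_zero_of_mul hn

theorem dilate_dilate (q p : ℂˣ) (h : q * p = 1) (f : LaurentSeries ℂ) :
    dilate q (dilate p f) = f := by
  ext n
  have : (q : ℂ) ^ n * (p : ℂ) ^ n = 1 := by
    rw [← mul_zpow, ← Units.val_mul, h]; simp
  simp [dilate, ← mul_assoc, this]

theorem support_dilate (q : ℂˣ) (f : LaurentSeries ℂ) : (dilate q f).support = f.support := by
  ext n
  simp [dilate, zpow_ne_zero n q.ne_zero]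

theorem dilate_mul (q : ℂˣ) (f g : LaurentSeries ℂ) :
    dilate q (f * g) = dilate q f * dilate q g := by
  ext n
  rw [HahnSeries.coeff_mul_left' f.isPWO_support (support_dilate q f).le]
  change (q : ℂ) ^ n * (f * g).coeff n = _
  rw [HahnSeries.coeff_mul_right' (x := f) (y := g) (s := (dilate q g).support)
    (dilate q g).isPWO_support (support_dilate q g).ge, Finset.mul_sum]
  refine Finset.sum_congr rfl fun p hp => ?_
  have hp' : p.1 + p.2 = n := (Finset.mem_antidiagonal.mp hp).2.2
  simp only [dilate, ← hp', zpow_add₀ q.ne_zero]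
  ring

/-- The automorphism `σ_q : f(x) ↦ f(qx)` of `ℂ((x))`. -/
def sigmaHat (q : ℂˣ) : LaurentSeries ℂ ≃+* LaurentSeries ℂ where
  toFun := dilate q
  invFun := dilate q⁻¹
  left_inv := dilate_dilate _ _ (by simp)
  right_inv := dilate_dilate _ _ (by simp)
  map_mul' := dilate_mul q
  map_add' f g := by ext n; simp [dilate, mul_add]

theorem dilate_mem (q : ℂˣ) {f : LaurentSeries ℂ} (hf : f ∈ meroGerms) :
    dilate q f ∈ meroGerms := by
  obtain ⟨r, hr, hs⟩ := hf
  have hq : 0 < ‖(q : ℂ)‖ := norm_pos_iff.2 q.ne_zero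
  refine ⟨r / ‖(q : ℂ)‖, by positivity, hs.congr fun n => ?_⟩
  simp only [dilate, zpow_natCast, norm_mul, norm_pow, div_pow]
  field_simp

/-- The automorphism `σ_q : f(x) ↦ f(qx)` of `K = ℂ({x})`. -/
def sigma (q : ℂˣ) : meroGerms ≃+* meroGerms where
  toFun f := ⟨dilate q f.1, dilate_mem q f.2⟩
  invFun f := ⟨dilate q⁻¹ f.1, dilate_mem q⁻¹ f.2⟩
  left_inv f := Subtype.ext (dilate_dilate _ _ (by simp) f.1)
  right_inv f := Subtype.ext (dilate_dilate _ _ (by simp) f.1)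
  map_mul' f g := Subtype.ext (dilate_mul q f.1 g.1)
  map_add' f g := Subtype.ext ((sigmaHat q).map_add f.1 g.1)

/-! ## `q`-difference modules -/

/-- A difference module over a field `F` with automorphism `σ`: a finite-dimensional
`F`-vector space with a `σ`-linear bijective endomorphism. -/
structure DiffModule (F : Type) [Field F] (σ : F ≃+* F) where
  carrier : Type u
  [addCommGroup : AddCommGroup carrier]
  [module : Module F carrier]
  [finite : FiniteDimensional F carrier]
  Sig : carrier ≃+ carrier
  Sig_smul : ∀ (f : F) (m : carrier), Sig (f • m) = σ f • Sig m

attribute [instance] DiffModule.addCommGroup DiffModule.module DiffModule.finite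

namespace DiffModule

variable {F : Type} [Field F] {σ : F ≃+* F}

/-- Morphisms: `F`-linear maps commuting with the semilinear operators. -/
@[ext]
structure Hom (M N : DiffModule.{u} F σ) where
  toLin : M.carrier →ₗ[F] N.carrier
  comm : ∀ m, toLin (M.Sig m) = N.Sig (toLin m)

instance : Category (DiffModule.{u} F σ) where
  Hom := Hom
  id M := ⟨LinearMap.id, fun _ => rfl⟩
  comp f g := ⟨g.toLin.comp f.toLin, fun m => by simp [f.comm, g.comm]⟩

variable {G : Type} [Field G] [Algebra F G] {τ : G ≃+* G}

/-- The additive map `τ ⊗ S` on `G ⊗ M`. -/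
def tensorAux {V : Type u} [AddCommGroup V] [Module F V] (σ : F ≃+* F) (τ : G ≃+* G)
    (h : ∀ f, τ (algebraMap F G f) = algebraMap F G (σ f)) (S : V ≃+ V)
    (hS : ∀ (f : F) (v : V), S (f • v) = σ f • S v) : G ⊗[F] V →+ G ⊗[F] V :=
  TensorProduct.liftAddHom
    { toFun := fun g =>
        { toFun := fun v => τ g ⊗ₜ[F] S v
          map_zero' := by simp
          map_add' := fun v w => by simp [TensorProduct.tmul_add] }
      map_zero' := by ext v; simp
      map_add' := fun g g' => by ext v; simp [TensorProduct.add_tmul] }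
    (fun f g v => by
      simp only [AddMonoidHom.coe_mk, ZeroHom.coe_mk, hS, TensorProduct.tmul_smul,
        Algebra.smul_def, map_mul, h]
      rw [← Algebra.smul_def, TensorProduct.smul_tmul'])

theorem tensorAux_tensorAux {V : Type u} [AddCommGroup V] [Module F V] {σ σ' : F ≃+* F}
    {τ τ' : G ≃+* G} (h : ∀ f, τ (algebraMap F G f) = algebraMap F G (σ f))
    (h' : ∀ f, τ' (algebraMap F G f) = algebraMap F G (σ' f)) {S S' : V ≃+ V}
    (hS : ∀ (f : F) (v : V), S (f • v) = σ f • S v)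
    (hS' : ∀ (f : F) (v : V), S' (f • v) = σ' f • S' v)
    (hτ : ∀ g, τ (τ' g) = g) (hSS : ∀ v, S (S' v) = v) (t : G ⊗[F] V) :
    tensorAux σ τ h S hS (tensorAux σ' τ' h' S' hS' t) = t := by
  induction t using TensorProduct.induction_on with
  | zero => simp
  | tmul g v =>
    change τ (τ' g) ⊗ₜ[F] S (S' v) = _
    rw [hτ, hSS]
  | add x y hx hy => rw [map_add, map_add, hx, hy]

theorem symm_compat (h : ∀ f, τ (algebraMap F G f) = algebraMap F G (σ f)) (f : F) :
    τ.symm (algebraMap F G f) = algebraMap F G (σ.symm f) := by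
  rw [RingEquiv.symm_apply_eq, h, RingEquiv.apply_symm_apply]

theorem symm_smul (M : DiffModule.{u} F σ) (f : F) (m : M.carrier) :
    M.Sig.symm (f • m) = σ.symm f • M.Sig.symm m := by
  rw [AddEquiv.symm_apply_eq, M.Sig_smul]; simp

/-- Extension of scalars `(G ⊗ M, τ ⊗ Σ)` along an extension `G/F` of difference fields. -/
def baseChange (h : ∀ f, τ (algebraMap F G f) = algebraMap F G (σ f))
    (M : DiffModule.{u} F σ) : DiffModule.{u} G τ where
  carrier := G ⊗[F] M.carrier
  Sig :=
    { tensorAux σ τ h M.Sig M.Sig_smul with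
      invFun := tensorAux σ.symm τ.symm (symm_compat h) M.Sig.symm M.symm_smul
      left_inv := tensorAux_tensorAux (symm_compat h) h M.symm_smul M.Sig_smul
        (by simp) (by simp)
      right_inv := tensorAux_tensorAux h (symm_compat h) M.Sig_smul M.symm_smul
        (by simp) (by simp) }
  Sig_smul g t := by
    change tensorAux σ τ h M.Sig M.Sig_smul (g • t) = τ g • tensorAux σ τ h M.Sig M.Sig_smul t
    induction t using TensorProduct.induction_on with
    | zero => simp
    | tmul g' v =>
      change τ (g * g') ⊗ₜ[F] M.Sig v = τ g • (τ g' ⊗ₜ[F] M.Sig v)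
      rw [map_mul, TensorProduct.smul_tmul', smul_eq_mul]
    | add x y hx hy => rw [smul_add, map_add, map_add, hx, hy, smul_add]

end DiffModule

/-- The category `B_q` of `q`-difference modules over `K = ℂ({x})`. -/
abbrev Bq (q : ℂˣ) := DiffModule.{u} meroGerms (sigma q)

/-- The category of `q`-difference modules over `ℂ((x))`. -/
abbrev BqHat (q : ℂˣ) := DiffModule.{u} (LaurentSeries ℂ) (sigmaHat q)

/-- The extension of scalars of an object from `ℂ({x})` to `ℂ((x))`. -/
def formalization {q : ℂˣ} (M : Bq.{u} q) : BqHat.{u} q :=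
  M.baseChange (τ := sigmaHat q) fun _ => rfl

/-- The objects of `B_q^iso`: every `N` in `B_q` that is formally isomorphic to `M` is
analytically isomorphic to `M`. -/
def InIso (q : ℂˣ) : ObjectProperty (Bq.{u} q) := fun M =>
  ∀ N : Bq.{u} q, Nonempty (formalization N ≅ formalization M) → Nonempty (N ≅ M)

/-! ## Newton polygons and slopes -/

/-- A `q`-difference operator `∑ i ≤ ν, a_i(x) σ_q ^ i` with coefficients germs of
holomorphic functions at `0` and `a_ν ≠ 0`. -/
structure DiffOperator where
  ν : ℕ
  coeff : Fin (ν + 1) → meroGerms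
  holomorphic : ∀ i, ∀ n : ℤ, n < 0 → (coeff i : LaurentSeries ℂ).coeff n = 0
  lead_ne_zero : coeff (Fin.last ν) ≠ 0

namespace DiffOperator

/-- The Newton polygon: the convex hull of `{(i, k) : a_i ≠ 0, k ≥ ord_x a_i}`. -/
def newtonPolygon (L : DiffOperator) : Set (ℝ × ℝ) :=
  convexHull ℝ {p | ∃ i : Fin (L.ν + 1), L.coeff i ≠ 0 ∧ p.1 = (i : ℕ) ∧
    (((L.coeff i : LaurentSeries ℂ).order : ℤ) : ℝ) ≤ p.2}

/-- `μ` is a finite slope of the Newton polygon: some supporting line of slope `μ` from below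
meets the polygon in a segment that is not a point. -/
def IsSlope (L : DiffOperator) (μ : ℝ) : Prop :=
  ∃ c : ℝ, (∀ p ∈ L.newtonPolygon, μ * p.1 + c ≤ p.2) ∧
    ∃ p ∈ L.newtonPolygon, ∃ p' ∈ L.newtonPolygon, p ≠ p' ∧
      p.2 = μ * p.1 + c ∧ p'.2 = μ * p'.1 + c

/-- The operator has no finite slope other than `μ`. (An operator of positive order with
`a_0 ≠ 0` has at least one finite slope; an operator of order `0` has none.) -/
def IsPure (L : DiffOperator) (μ : ℝ) : Prop := ∀ μ', L.IsSlope μ' → μ' = μ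

/-- `M` is the `q`-difference module associated with `L`, that is
`M ≅ K[σ_q, σ_q⁻¹] / K[σ_q, σ_q⁻¹] L` with `ν = dim M`: there is a cyclic vector `m`
(`m, Σ m, …, Σ^(ν-1) m` is a basis of `M`) killed by `L`. -/
def IsAssociated {q : ℂˣ} (L : DiffOperator) (M : Bq.{u} q) : Prop :=
  ∃ m : M.carrier,
    LinearIndependent meroGerms (fun i : Fin L.ν => M.Sig^[i] m) ∧
    Submodule.span meroGerms (Set.range fun i : Fin L.ν => M.Sig^[i] m) = ⊤ ∧
    ∑ i : Fin (L.ν + 1), L.coeff i • M.Sig^[i] m = 0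

end DiffOperator

/-- A `q`-difference module that is pure of slope `μ` (the zero module included). -/
def IsPureOfSlope (q : ℂˣ) (μ : ℝ) : ObjectProperty (Bq.{u} q) := fun M =>
  ∃ L : DiffOperator, L.IsAssociated M ∧ L.IsPure μ

/-- The category `B_q^{iso,f}`: the full subcategory of `B_q` of the objects of `B_q^iso`
that are pure of slope zero. -/
abbrev BqIsoF (q : ℂˣ) :=
  ObjectProperty.FullSubcategory fun M : Bq.{u} q => InIso q M ∧ IsPureOfSlope q 0 M

/-! ## Graded vector spaces with a nilpotent operator -/

/-- The group `ℂ* / q^ℤ`. -/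
abbrev CModQ (q : ℂˣ) := ℂˣ ⧸ Subgroup.zpowers q

open Classical in
/-- A finite-dimensional `ℂ* / q^ℤ`-graded complex vector space with a nilpotent operator that
preserves the grading. -/
structure GrNil (q : ℂˣ) where
  carrier : Type u
  [addCommGroup : AddCommGroup carrier]
  [module : Module ℂ carrier]
  [finite : FiniteDimensional ℂ carrier]
  comp : CModQ q → Submodule ℂ carrier
  isInternal : DirectSum.IsInternal comp
  nil : carrier →ₗ[ℂ] carrier
  isNilpotent : IsNilpotent nil
  nil_mem : ∀ c, ∀ v ∈ comp c, nil v ∈ comp c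

attribute [instance] GrNil.addCommGroup GrNil.module GrNil.finite

namespace GrNil

variable {q : ℂˣ}

/-- Morphisms: linear maps preserving the grading and commuting with the operators. -/
@[ext]
structure Hom (V W : GrNil.{u} q) where
  toLin : V.carrier →ₗ[ℂ] W.carrier
  map_comp : ∀ c, ∀ v ∈ V.comp c, toLin v ∈ W.comp c
  comm : ∀ v, toLin (V.nil v) = W.nil (toLin v)

instance : Category (GrNil.{u} q) where
  Hom := Hom
  id V := ⟨LinearMap.id, fun _ _ h => h, fun _ => rfl⟩
  comp f g := ⟨g.toLin.comp f.toLin, fun c v h => g.map_comp c _ (f.map_comp c v h),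
    fun v => by simp [f.comm, g.comm]⟩

end GrNil

/-- The `q`-Pochhammer symbol `(a;q)_n = (1 - a)(1 - q a) ⋯ (1 - q^(n-1) a)`. -/
def qPoch (a q : ℂ) (n : ℕ) : ℂ := ∏ k ∈ Finset.range n, (1 - q ^ k * a)

/-- The coefficients of `φ_{(q;Λ)}(x) = ∑ x^n / ∏_{l ∈ Λ} (l;q)_n`. -/
def phiCoeff (q : ℂˣ) (Λ : Finset ℂˣ) (n : ℕ) : ℂ := (∏ l ∈ Λ, qPoch l q n)⁻¹

open Classical in
/-- The set of the ratios `λ_i / λ_j` of elements of `S` that are not in `q^{ℤ_{≤ 0}}`. -/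
def ratios (q : ℂˣ) (S : Finset ℂˣ) : Finset ℂˣ :=
  ((S ×ˢ S).image fun p => p.1 * p.2⁻¹).filter fun l => ∀ k : ℤ, k ≤ 0 → l ≠ q ^ k

/-- Condition `(D)`: for every set of representatives of the classes of the nonzero homogeneous
components of `V`, the series `φ_{(q;Λ)}` converges. -/
def ConditionD (q : ℂˣ) : ObjectProperty (GrNil.{u} q) := fun V =>
  ∀ S : Finset ℂˣ, Set.BijOn (fun l : ℂˣ => (l : CModQ q)) S {c | V.comp c ≠ ⊥} →
    Converges (phiCoeff q (ratios q S))

/-- The category of finite-dimensional `ℂ* / q^ℤ`-graded complex vector spaces with a nilpotent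
operator preserving the grading that satisfy `(D)`. -/
abbrev GrNilD (q : ℂˣ) := ObjectProperty.FullSubcategory (ConditionD.{u} q)

end QDifference

end

noncomputable section

namespace QDifference

/-! ## Representatives of `ℂ* / q^ℤ` -/

/-! The equivalence is induced by V ↦ K ⊗ V with operator σ_q ⊗ `twist`, where `twist` acts on the
component of class c as rep(c)(1 + nil). The components are then the generalized eigenspaces of
`twist`. Because each class has a single representative and q is not a root of unity, q^n λ = λ' is
impossible for n ≠ 0 and eigenvalues λ, λ' of such operators (`zpow_mul_rep_ne_rep`). This
nonresonance drives every algebraic step.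

Full faithfulness: the x^n-coefficient T of a morphism satisfies T A = q^n A' T, so it vanishes for
n ≠ 0. The constant coefficient commutes with the twists, hence respects gradings and nilpotent
operators (`exists_eq_one_tmul`). The argument is purely formal.

Slope zero: K ⊗ V has a cyclic vector killed by a polynomial in σ_q with constant coefficients and
nonzero constant term (`exists_cyclic_vector`). Conversely, in a module pure of slope zero the
extreme coefficients of the operator have minimal order, so the matrix of Σ_q in the cyclic basis is
invertible over power series (`exists_integral_basis`). Such a system is formally equivalent to a
constant one whose eigenvalues are representatives (`exists_gaugeEquiv_constant`). For M in B_q^iso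
this formal isomorphism with some K ⊗ W can be replaced by an analytic one.

It remains to show that K ⊗ V lies in B_q^iso exactly when (D) holds. If (D) holds, a formal
isomorphism to K ⊗ V is a meromorphic matrix times a power series matrix H with H(0) = 1. The
coefficients of H obey a recursion whose denominators are the small divisors α - q^k z for
eigenvalues z, α, and (D), together with the convergence of Σ x^n/(q;q)_n for z = α, bounds their
products geometrically (`converges_of_recursion`, `mem_meroGerms_of_formal_equivalence`).

If K ⊗ V lies in B_q^iso, the system is perturbed by a rank-one term joining two eigenvalues z ≠ w.
The formal gauge undoing the perturbation has coefficients z q^n/(z q^n - w) and, by rigidity, must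
converge (`converges_inv_of_inIso`). This controls single divisors. An auxiliary functional equation
solved with Σ x^n/(q;q)_n upgrades the bound to the products occurring in (D)
(`converges_inv_qPoch_of_converges_inv`). -/

/-- A section of `ℂ* → ℂ* / q^ℤ`. -/
def rep (q : ℂˣ) (c : CModQ q) : ℂˣ := Quotient.out c

theorem coe_rep (q : ℂˣ) (c : CModQ q) : ((rep q c : ℂˣ) : CModQ q) = c :=
  QuotientGroup.out_eq' c

theorem coe_eq_coe_iff {q l m : ℂˣ} : (l : CModQ q) = m ↔ ∃ n : ℤ, m = q ^ n * l := by
  rw [QuotientGroup.eq, Subgroup.mem_zpowers_iff]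
  refine exists_congr fun n => ?_
  rw [eq_comm, inv_mul_eq_iff_eq_mul, mul_comm]

theorem rep_val_injective (q : ℂˣ) : Function.Injective fun c => (rep q c : ℂ) := fun c d h => by
  rw [← coe_rep q c, ← coe_rep q d, Units.ext h]

theorem exists_rep_eq_zpow_mul (q l : ℂˣ) : ∃ n : ℤ, rep q l = q ^ n * l :=
  coe_eq_coe_iff.1 (coe_rep q l).symm

section

variable {q : ℂˣ} (hroot : ∀ n : ℕ, 0 < n → q ^ n ≠ 1)

theorem zpow_ne_one_of_pow_ne_one {G : Type*} [Group G] {g : G}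
    (h : ∀ n : ℕ, 0 < n → g ^ n ≠ 1) {n : ℤ} (hn : n ≠ 0) : g ^ n ≠ 1 := by
  rcases Int.natAbs_eq n with e | e <;> rw [e]
  · rw [zpow_natCast]; exact h _ (by omega)
  · rw [zpow_neg, zpow_natCast, ne_eq, inv_eq_one]; exact h _ (by omega)

-- Nonresonance: the two sides lie in the same class, so equality would force c = d and then q^n =
-- 1.
include hroot in
theorem zpow_mul_rep_ne_rep {n : ℤ} (hn : n ≠ 0) (c d : CModQ q) :
    (q : ℂ) ^ n * rep q c ≠ rep q d := by
  intro h
  have h' : q ^ n * rep q c = rep q d := Units.ext (by simpa using h)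
  have hcd : c = d := by
    rw [← coe_rep q c, ← coe_rep q d]
    exact coe_eq_coe_iff.2 ⟨n, h'.symm⟩
  subst hcd
  exact zpow_ne_one_of_pow_ne_one hroot hn (mul_eq_right.1 h')

end

/-! ## Linear algebra of graded spaces -/

section LinearAlgebra

variable {ι V W : Type*} [AddCommGroup V] [Module ℂ V] [AddCommGroup W] [Module ℂ W]

theorem linearMap_ext_of_iSup_eq_top {s : ι → Submodule ℂ V} (hs : iSup s = ⊤) {f g : V →ₗ[ℂ] W}
    (h : ∀ i, ∀ v ∈ s i, f v = g v) : f = g := by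
  ext v
  have hv : v ∈ iSup s := hs ▸ Submodule.mem_top
  induction hv using Submodule.iSup_induction' with
  | mem i x hx => exact h i x hx
  | zero => simp
  | add x y _ _ hx hy => simp [hx, hy]

/-- Splitting v ∈ t i along the spanning family leaves a remainder both in t i and in the sum of the
other t j, hence zero. One inclusion thus suffices to identify a grading with generalized
eigenspaces. -/
theorem eq_of_le_of_iSupIndep {s t : ι → Submodule ℂ V} (hs : iSup s = ⊤) (ht : iSupIndep t)
    (h : ∀ i, s i ≤ t i) (i : ι) : s i = t i := by
  refine le_antisymm (h i) fun v hv => ?_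
  have hv' : v ∈ s i ⊔ ⨆ j ≠ i, s j := by
    have : iSup s ≤ s i ⊔ ⨆ j ≠ i, s j := iSup_le fun j => by
      rcases eq_or_ne j i with rfl | hj
      · exact le_sup_left
      · exact (le_iSup₂ (f := fun j (_ : j ≠ i) => s j) j hj).trans le_sup_right
    exact this (hs ▸ Submodule.mem_top)
  obtain ⟨a, ha, b, hb, rfl⟩ := Submodule.mem_sup.1 hv'
  have hb' : b ∈ t i := by simpa using (t i).sub_mem hv (h i ha)
  have hb'' : b ∈ ⨆ j ≠ i, t j := iSup₂_mono (fun j _ => h j) hb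
  have : b = 0 := by simpa using (Submodule.disjoint_def.1 (ht i)) b hb' hb''
  simpa [this] using ha

variable [DecidableEq ι] {s : ι → Submodule ℂ V}

/-- The operator that acts on the component `s i` as the scalar `f i`. -/
def scaleBy (h : DirectSum.IsInternal s) (f : ι → ℂ) : V →ₗ[ℂ] V :=
  DirectSum.coeLinearMap s ∘ₗ (DirectSum.lmap fun i => f i • LinearMap.id) ∘ₗ
    (LinearEquiv.ofBijective (DirectSum.coeLinearMap s) h).symm.toLinearMap

theorem scaleBy_apply (h : DirectSum.IsInternal s) (f : ι → ℂ) {i : ι} {v : V} (hv : v ∈ s i) :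
    scaleBy h f v = f i • v := by
  have e : (LinearEquiv.ofBijective (DirectSum.coeLinearMap s) h).symm v =
      DirectSum.lof ℂ ι (fun i => s i) i ⟨v, hv⟩ := by
    rw [LinearEquiv.symm_apply_eq]
    exact (DirectSum.coeLinearMap_lof s i ⟨v, hv⟩).symm
  simp only [scaleBy, LinearMap.comp_apply, LinearEquiv.coe_coe, e, DirectSum.lmap_lof]
  simp

theorem scaleBy_comp (h : DirectSum.IsInternal s) (f g : ι → ℂ) :
    scaleBy h f * scaleBy h g = scaleBy h (f * g) := by
  refine linearMap_ext_of_iSup_eq_top h.submodule_iSup_eq_top fun i v hv => ?_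
  rw [Module.End.mul_apply, scaleBy_apply h g hv, map_smul, scaleBy_apply h f hv,
    scaleBy_apply h _ hv, smul_smul, Pi.mul_apply, mul_comm]

theorem scaleBy_one (h : DirectSum.IsInternal s) : scaleBy h 1 = 1 :=
  linearMap_ext_of_iSup_eq_top h.submodule_iSup_eq_top fun i v hv => by
    simp [scaleBy_apply h _ hv]

theorem isUnit_scaleBy (h : DirectSum.IsInternal s) {f : ι → ℂ} (hf : ∀ i, f i ≠ 0) :
    IsUnit (scaleBy h f) := by
  have e : f * f⁻¹ = 1 := funext fun i => mul_inv_cancel₀ (hf i)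
  exact ⟨⟨scaleBy h f, scaleBy h f⁻¹, by rw [scaleBy_comp, e, scaleBy_one],
    by rw [scaleBy_comp, mul_comm, e, scaleBy_one]⟩, rfl⟩

end LinearAlgebra

/-! ### The operator `twist` and its generalized eigenspaces -/

namespace GrNil

variable {q : ℂˣ} (V : GrNil.{u} q)

open Classical in
/-- The invertible operator that acts on the component of the class `c` as
`rep q c • (1 + nil)`. -/
def twist : Module.End ℂ V.carrier :=
  scaleBy V.isInternal (fun c => (rep q c : ℂ)) * (1 + V.nil)

open Classical in
theorem iSup_comp : iSup V.comp = ⊤ := V.isInternal.submodule_iSup_eq_top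

theorem twist_apply {c : CModQ q} {v : V.carrier} (hv : v ∈ V.comp c) :
    V.twist v = (rep q c : ℂ) • (v + V.nil v) :=
  scaleBy_apply V.isInternal _ ((V.comp c).add_mem hv (V.nil_mem c v hv))

theorem isUnit_twist : IsUnit V.twist :=
  (isUnit_scaleBy _ fun c => (rep q c).ne_zero).mul V.isNilpotent.isUnit_one_add

theorem nil_apply {c : CModQ q} {v : V.carrier} (hv : v ∈ V.comp c) :
    V.nil v = (rep q c : ℂ)⁻¹ • V.twist v - v := by
  rw [V.twist_apply hv, inv_smul_smul₀ (rep q c).ne_zero, add_sub_cancel_left]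

/-- On the component of c, `twist` minus rep(c) is rep(c) times the nilpotent operator, which gives
one inclusion. Equality follows since the components span and generalized eigenspaces for distinct
representatives are independent. The grading is therefore determined by `twist`. -/
theorem comp_eq_maxGenEigenspace (c : CModQ q) :
    V.comp c = Module.End.maxGenEigenspace V.twist (rep q c : ℂ) := by
  refine eq_of_le_of_iSupIndep V.iSup_comp
    (V.twist.independent_maxGenEigenspace.comp (rep_val_injective q)) (fun c v hv => ?_) c
  obtain ⟨k, hk⟩ := V.isNilpotent
  have key : ∀ n : ℕ, ((V.twist - (rep q c : ℂ) • (1 : Module.End ℂ V.carrier)) ^ n) v =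
      (rep q c : ℂ) ^ n • (V.nil ^ n) v ∧ (V.nil ^ n) v ∈ V.comp c := by
    intro n
    induction n with
    | zero => simpa using hv
    | succ n ih =>
      refine ⟨?_, by rw [pow_succ', Module.End.mul_apply]; exact V.nil_mem c _ ih.2⟩
      rw [pow_succ', Module.End.mul_apply, ih.1, map_smul, LinearMap.sub_apply,
        V.twist_apply ih.2, pow_succ', pow_succ', Module.End.mul_apply, LinearMap.smul_apply,
        Module.End.one_apply, smul_add, add_sub_cancel_left, smul_smul, mul_comm]
  refine Module.End.mem_maxGenEigenspace _ _ _ |>.2 ⟨k, ?_⟩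
  rw [(key k).1, hk]
  simp

/-- Otherwise the generalized eigenspaces at points other than z already span, and independence
leaves nothing at z. -/
theorem exists_rep_eq_of_hasEigenvalue {z : ℂ} (h : V.twist.HasEigenvalue z) :
    ∃ c, V.comp c ≠ ⊥ ∧ z = rep q c := by
  by_contra! hz
  have hd := V.twist.independent_maxGenEigenspace z
  have htop : (⨆ j ≠ z, V.twist.maxGenEigenspace j) = ⊤ := by
    rw [eq_top_iff, ← V.iSup_comp]
    refine iSup_le fun c => ?_
    rcases eq_or_ne (V.comp c) ⊥ with hc | hc
    · simp [hc]
    · rw [V.comp_eq_maxGenEigenspace c]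
      exact le_iSup₂_of_le (f := fun j (_ : j ≠ z) => V.twist.maxGenEigenspace j)
        (rep q c : ℂ) (hz c hc).symm le_rfl
  rw [htop, disjoint_top] at hd
  exact h (eq_bot_iff.2 (hd ▸ (Module.End.genEigenspace V.twist z).mono le_top))

theorem finite_comp_ne_bot : {c | V.comp c ≠ ⊥}.Finite := by
  classical
  exact WellFoundedGT.finite_ne_bot_of_iSupIndep V.isInternal.submodule_iSupIndep

end GrNil

theorem injective_sub_of_not_hasEigenvalue {V : Type*} [AddCommGroup V] [Module ℂ V]
    {A : Module.End ℂ V} {z : ℂ} (h : ¬ A.HasEigenvalue z) :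
    Function.Injective (A - z • (1 : Module.End ℂ V)) := by
  rw [Module.End.hasEigenvalue_iff, not_not, Module.End.eigenspace_def, LinearMap.ker_eq_bot] at h
  exact h

theorem eq_zero_of_pow_sub_apply_eq_zero {V : Type*} [AddCommGroup V] [Module ℂ V]
    {A : Module.End ℂ V} {z : ℂ} (h : ¬ A.HasEigenvalue z) {k : ℕ} {v : V}
    (hv : ((A - z • (1 : Module.End ℂ V)) ^ k) v = 0) : v = 0 := by
  have hinj : Function.Injective ((A - z • (1 : Module.End ℂ V)) ^ k : Module.End ℂ V) := by
    rw [Module.End.coe_pow]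
    exact (injective_sub_of_not_hasEigenvalue h).iterate k
  exact hinj (by simpa using hv)

/-- The graded space with nilpotent operator attached to an operator whose eigenvalues are
chosen representatives of classes of `ℂ* / q^ℤ`. -/
theorem exists_grNil_twist_eq (q : ℂˣ) {V : Type u} [AddCommGroup V] [Module ℂ V]
    [FiniteDimensional ℂ V] (A : Module.End ℂ V)
    (hA : ∀ z, A.HasEigenvalue z → ∃ c, z = rep q c) :
    ∃ (W : GrNil.{u} q) (e : V ≃ₗ[ℂ] W.carrier), ∀ v, e (A v) = W.twist (e v) := by
  classical
  set s : CModQ q → Submodule ℂ V := fun c => A.maxGenEigenspace (rep q c : ℂ) with hs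
  have hind : iSupIndep s := A.independent_maxGenEigenspace.comp (rep_val_injective q)
  have htop : iSup s = ⊤ := by
    rw [eq_top_iff, ← A.iSup_maxGenEigenspace_eq_top]
    refine iSup_le fun z => ?_
    by_cases hz : A.HasEigenvalue z
    · obtain ⟨c, rfl⟩ := hA z hz
      exact le_iSup s c
    · intro v hv
      obtain ⟨k, hk⟩ := (Module.End.mem_maxGenEigenspace _ _ _).1 hv
      rw [eq_zero_of_pow_sub_apply_eq_zero hz hk]
      exact zero_mem _
  have hint : DirectSum.IsInternal s :=
    (DirectSum.isInternal_submodule_iff_iSupIndep_and_iSup_eq_top s).2 ⟨hind, htop⟩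
  have hmem : ∀ c, ∀ v ∈ s c, A v ∈ s c := fun c v hv =>
    Module.End.mapsTo_maxGenEigenspace_of_comm (Commute.refl A) _ hv
  -- This solves A = rep(c)(1 + N) for N on each generalized eigenspace, inverting the formula for
  -- `twist`.
  set N : Module.End ℂ V := scaleBy hint (fun c => (rep q c : ℂ)⁻¹) * A - 1 with hN
  have hNv : ∀ c, ∀ v ∈ s c, N v = (rep q c : ℂ)⁻¹ • A v - v := fun c v hv => by
    rw [hN, LinearMap.sub_apply, Module.End.mul_apply, scaleBy_apply hint _ (hmem c v hv)]
    rfl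
  have hNmem : ∀ c, ∀ v ∈ s c, N v ∈ s c := fun c v hv => by
    rw [hNv c v hv]
    exact (s c).sub_mem ((s c).smul_mem _ (hmem c v hv)) hv
  have hnil : IsNilpotent N := by
    refine ⟨Module.finrank ℂ V, linearMap_ext_of_iSup_eq_top htop fun c v hv => ?_⟩
    have key : ∀ n : ℕ, (N ^ n) v = (rep q c : ℂ)⁻¹ ^ n •
        ((A - (rep q c : ℂ) • (1 : Module.End ℂ V)) ^ n) v ∧ (N ^ n) v ∈ s c := by
      intro n
      induction n with
      | zero => simpa using hv
      | succ n ih =>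
        refine ⟨?_, by rw [pow_succ', Module.End.mul_apply]; exact hNmem c _ ih.2⟩
        rw [pow_succ', Module.End.mul_apply, hNv c _ ih.2, ih.1, map_smul, pow_succ', pow_succ',
          Module.End.mul_apply, LinearMap.sub_apply, LinearMap.smul_apply, Module.End.one_apply,
          smul_sub, smul_smul, smul_smul, mul_right_comm, inv_mul_cancel₀ (rep q c).ne_zero,
          one_mul]
    have hv' : v ∈ A.maxGenEigenspace (rep q c : ℂ) := hv
    rw [Module.End.maxGenEigenspace_eq_genEigenspace_finrank, Module.End.mem_genEigenspace_nat,
      LinearMap.mem_ker] at hv'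
    rw [(key _).1, hv', smul_zero, LinearMap.zero_apply]
  let W : GrNil.{u} q :=
    { carrier := V, comp := s, isInternal := by convert hint, nil := N, isNilpotent := hnil,
      nil_mem := hNmem }
  have hW : A = W.twist := linearMap_ext_of_iSup_eq_top (V := V) (W := V) htop fun c v hv => by
    rw [W.twist_apply (c := c) hv]
    change _ = (rep q c : ℂ) • (v + N v)
    rw [hNv c v hv, add_sub_cancel, smul_inv_smul₀ (rep q c).ne_zero]
  exact ⟨W, LinearEquiv.refl ℂ V, fun v => congrArg (fun f : V →ₗ[ℂ] V => f v) hW⟩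

/-! ## Constants, and modules with constant coefficients -/

instance : Algebra ℂ (LaurentSeries ℂ) := HahnSeries.instAlgebra

instance : Module ℂ (LaurentSeries ℂ) := Algebra.toModule

instance : SMul ℂ (LaurentSeries ℂ) := Algebra.toSMul

theorem coeff_algebraMap (c : ℂ) (n : ℤ) :
    (algebraMap ℂ (LaurentSeries ℂ) c).coeff n = if n = 0 then c else 0 := by
  rw [HahnSeries.algebraMap_apply]
  simp [HahnSeries.coeff_single]

theorem algebraMap_mem_meroGerms (c : ℂ) : algebraMap ℂ (LaurentSeries ℂ) c ∈ meroGerms := by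
  refine ⟨1, one_pos, summable_of_ne_finset_zero (s := {0}) fun n hn => ?_⟩
  have hn' : n ≠ 0 := by simpa using hn
  simp [coeff_algebraMap, hn']

instance : Algebra ℂ meroGerms :=
  ((algebraMap ℂ (LaurentSeries ℂ)).codRestrict meroGerms algebraMap_mem_meroGerms).toAlgebra

instance : IsScalarTower ℂ meroGerms (LaurentSeries ℂ) :=
  IsScalarTower.of_algebraMap_eq (R := ℂ) (S := meroGerms) (A := LaurentSeries ℂ) fun _ => rfl

theorem sigmaHat_coeff (q : ℂˣ) (f : LaurentSeries ℂ) (n : ℤ) :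
    (sigmaHat q f).coeff n = (q : ℂ) ^ n * f.coeff n := rfl

theorem sigmaHat_algebraMap (q : ℂˣ) (c : ℂ) :
    sigmaHat q (algebraMap ℂ (LaurentSeries ℂ) c) = algebraMap ℂ (LaurentSeries ℂ) c := by
  ext n
  rw [sigmaHat_coeff, coeff_algebraMap]
  split_ifs with h <;> simp [h]

theorem sigma_algebraMap (q : ℂˣ) (c : ℂ) :
    sigma q (algebraMap ℂ meroGerms c) = algebraMap ℂ meroGerms c :=
  Subtype.ext (sigmaHat_algebraMap q c)

namespace DiffModule

variable {F : Type} [Field F] {σ : F ≃+* F}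

theorem hom_ext {M N : DiffModule.{u} F σ} {f g : M ⟶ N} (h : f.toLin = g.toLin) : f = g :=
  Hom.ext h

/-- An isomorphism of difference modules from a linear equivalence. -/
def isoOfLinearEquiv {M N : DiffModule.{u} F σ} (e : M.carrier ≃ₗ[F] N.carrier)
    (h : ∀ m, e (M.Sig m) = N.Sig (e m)) : M ≅ N where
  hom := ⟨e.toLinearMap, h⟩
  inv := ⟨e.symm.toLinearMap, fun m => by
    rw [LinearEquiv.coe_coe, LinearEquiv.symm_apply_eq, h, LinearEquiv.apply_symm_apply]⟩
  hom_inv_id := hom_ext (LinearMap.ext fun m => e.symm_apply_apply m)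
  inv_hom_id := hom_ext (LinearMap.ext fun m => e.apply_symm_apply m)

/-- The linear equivalence underlying an isomorphism of difference modules. -/
def linearEquivOfIso {M N : DiffModule.{u} F σ} (e : M ≅ N) : M.carrier ≃ₗ[F] N.carrier :=
  LinearEquiv.ofLinearMap e.hom.toLin e.inv.toLin
    (congrArg Hom.toLin e.inv_hom_id) (congrArg Hom.toLin e.hom_inv_id)

theorem linearEquivOfIso_comm {M N : DiffModule.{u} F σ} (e : M ≅ N) (m : M.carrier) :
    linearEquivOfIso e (M.Sig m) = N.Sig (linearEquivOfIso e m) :=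
  e.hom.comm m

/-- A complex vector space with an automorphism, as a difference module over `ℂ`. -/
abbrev ofAut (V : Type u) [AddCommGroup V] [Module ℂ V] [FiniteDimensional ℂ V]
    (A : V ≃ₗ[ℂ] V) : DiffModule.{u} ℂ (RingEquiv.refl ℂ) where
  carrier := V
  Sig := A.toAddEquiv
  Sig_smul f m := A.map_smul f m

end DiffModule

/-! ### Constant systems over germs and over Laurent series, and coefficient extraction -/

section

variable (q : ℂˣ) {V : Type u} [AddCommGroup V] [Module ℂ V] [FiniteDimensional ℂ V]
  (A : V ≃ₗ[ℂ] V)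

/-- The `q`-difference module `K ⊗ V` with operator `σ_q ⊗ A`. -/
abbrev analyticModule : Bq.{u} q :=
  (DiffModule.ofAut V A).baseChange (τ := sigma q) (sigma_algebraMap q)

/-- The `q`-difference module `ℂ((x)) ⊗ V` with operator `σ_q ⊗ A`. -/
abbrev formalModule : BqHat.{u} q :=
  (DiffModule.ofAut V A).baseChange (τ := sigmaHat q) (sigmaHat_algebraMap q)

/-- The operator `σ_q ⊗ A` on `K ⊗ V`. -/
def analyticSig : meroGerms ⊗[ℂ] V ≃+ meroGerms ⊗[ℂ] V := (analyticModule q A).Sig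

/-- The operator `σ_q ⊗ A` on `ℂ((x)) ⊗ V`. -/
def formalSig : LaurentSeries ℂ ⊗[ℂ] V ≃+ LaurentSeries ℂ ⊗[ℂ] V := (formalModule q A).Sig

theorem analyticSig_tmul (f : meroGerms) (v : V) :
    analyticSig q A (f ⊗ₜ v) = sigma q f ⊗ₜ[ℂ] A v := rfl

theorem formalSig_tmul (f : LaurentSeries ℂ) (v : V) :
    formalSig q A (f ⊗ₜ v) = sigmaHat q f ⊗ₜ[ℂ] A v := rfl

theorem analyticSig_smul (f : meroGerms) (t : meroGerms ⊗[ℂ] V) :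
    analyticSig q A (f • t) = sigma q f • analyticSig q A t :=
  (analyticModule q A).Sig_smul f t

omit [FiniteDimensional ℂ V]

/-- The inclusion `K ⊗ V → ℂ((x)) ⊗ V`. -/
def germToFormal (V : Type u) [AddCommGroup V] [Module ℂ V] :
    meroGerms ⊗[ℂ] V →ₗ[ℂ] LaurentSeries ℂ ⊗[ℂ] V :=
  (IsScalarTower.toAlgHom ℂ meroGerms (LaurentSeries ℂ)).toLinearMap.rTensor V

theorem germToFormal_tmul (f : meroGerms) (v : V) :
    germToFormal V (f ⊗ₜ v) = (f : LaurentSeries ℂ) ⊗ₜ v := rfl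

theorem germToFormal_injective : Function.Injective (germToFormal V) :=
  Module.Flat.rTensor_preserves_injective_linearMap _ Subtype.val_injective

/-- The `n`-th coefficient of an element of `ℂ((x)) ⊗ V`. -/
def coeffTensor (V : Type u) [AddCommGroup V] [Module ℂ V] (n : ℤ) :
    LaurentSeries ℂ ⊗[ℂ] V →ₗ[ℂ] V :=
  TensorProduct.lift (LinearMap.mk₂ ℂ (fun f v => f.coeff n • v)
    (fun f g v => by rw [HahnSeries.coeff_add, add_smul])
    (fun c f v => by
      change (c • f.coeff n) • v = _
      rw [smul_assoc])
    (fun f v w => by simp) (fun c f v => by rw [smul_comm]))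

theorem coeffTensor_tmul (n : ℤ) (f : LaurentSeries ℂ) (v : V) :
    coeffTensor V n (f ⊗ₜ v) = f.coeff n • v := rfl

variable [FiniteDimensional ℂ V]

theorem germToFormal_sig (t : meroGerms ⊗[ℂ] V) :
    germToFormal V (analyticSig q A t) = formalSig q A (germToFormal V t) := by
  induction t using TensorProduct.induction_on with
  | zero => simp only [map_zero]
  | tmul g v => rfl
  | add x y hx hy => simp only [map_add, hx, hy]

theorem coeffTensor_sig (n : ℤ) (t : LaurentSeries ℂ ⊗[ℂ] V) :
    coeffTensor V n (formalSig q A t) = (q : ℂ) ^ n • A (coeffTensor V n t) := by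
  induction t using TensorProduct.induction_on with
  | zero => simp only [map_zero, smul_zero]
  | tmul f v =>
    rw [formalSig_tmul, coeffTensor_tmul, coeffTensor_tmul, sigmaHat_coeff, map_smul, smul_smul]
  | add x y hx hy => simp only [map_add, hx, hy, smul_add]

theorem eq_zero_of_coeffTensor_eq_zero {t : LaurentSeries ℂ ⊗[ℂ] V}
    (h : ∀ n, coeffTensor V n t = 0) : t = 0 := by
  set b := Module.finBasis ℂ V
  set B := b.baseChange (LaurentSeries ℂ)
  refine (B.repr.map_eq_zero_iff).1 (Finsupp.ext fun i => HahnSeries.ext (funext fun n => ?_))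
  have key : ∀ t : LaurentSeries ℂ ⊗[ℂ] V, (B.repr t i).coeff n = b.repr (coeffTensor V n t) i := by
    intro t
    induction t using TensorProduct.induction_on with
    | zero => simp
    | tmul f v => simp [B, Module.Basis.baseChange_repr_tmul, coeffTensor_tmul, mul_comm]
    | add x y hx hy => simp [hx, hy]
  rw [key, h]
  simp

end

/-- The automorphism `GrNil.twist`. -/
def GrNil.twistEquiv {q : ℂˣ} (V : GrNil.{u} q) : V.carrier ≃ₗ[ℂ] V.carrier :=
  LinearEquiv.ofBijective V.twist ((Module.End.isUnit_iff _).1 V.isUnit_twist)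

theorem GrNil.twistEquiv_apply {q : ℂˣ} (V : GrNil.{u} q) (v : V.carrier) :
    V.twistEquiv v = V.twist v := rfl

/-! ## Rigidity -/

section Rigidity

variable {q : ℂˣ} (hroot : ∀ n : ℕ, 0 < n → q ^ n ≠ 1) (V W : GrNil.{u} q)

include hroot

/-- T carries the generalized eigenspace for λ into the one for q^(-n) λ, and by nonresonance q^(-n)
λ is not an eigenvalue of the target. -/
theorem eq_zero_of_intertwines {n : ℤ} (hn : n ≠ 0) {T : V.carrier →ₗ[ℂ] W.carrier}
    (hT : ∀ v, T (V.twist v) = (q : ℂ) ^ n • W.twist (T v)) : T = 0 := by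
  refine linearMap_ext_of_iSup_eq_top V.iSup_comp fun c v hv => ?_
  rw [V.comp_eq_maxGenEigenspace, Module.End.mem_maxGenEigenspace] at hv
  obtain ⟨k, hk⟩ := hv
  have key : ∀ (k : ℕ) (v : V.carrier), T (((V.twist - (rep q c : ℂ) • (1 : Module.End ℂ _)) ^ k : Module.End ℂ _) v) =
      ((q : ℂ) ^ n) ^ k •
        ((W.twist - ((q : ℂ) ^ (-n) * rep q c) • (1 : Module.End ℂ _)) ^ k : Module.End ℂ _) (T v) := by
    intro k
    induction k with
    | zero => simp
    | succ k ih =>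
      intro v
      rw [pow_succ, Module.End.mul_apply, ih, pow_succ (W.twist - _), Module.End.mul_apply,
        pow_succ, mul_smul, ← map_smul]
      simp only [LinearMap.sub_apply, LinearMap.smul_apply, Module.End.one_apply, map_sub, hT,
        map_smul, smul_sub, smul_smul]
      rw [← mul_assoc, mul_assoc _ ((q : ℂ) ^ n), ← zpow_add₀ q.ne_zero, add_neg_cancel, zpow_zero,
        mul_one]
  have h0 := key k v
  rw [hk, map_zero, eq_comm, smul_eq_zero_iff_right (pow_ne_zero _ (zpow_ne_zero _ q.ne_zero))] at h0
  refine eq_zero_of_pow_sub_apply_eq_zero (fun hz => ?_) h0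
  obtain ⟨d, -, hd⟩ := W.exists_rep_eq_of_hasEigenvalue hz
  exact zpow_mul_rep_ne_rep hroot (neg_ne_zero.2 hn) c d hd

/-- Rigidity: comparing coefficients of x^n, the previous lemma kills all n ≠ 0. The constant
coefficient commutes with the twists, so it preserves generalized eigenspaces and commutes with nil
= rep(c)⁻¹ `twist` - 1 on each. No convergence is involved. -/
theorem exists_eq_one_tmul (f : V.carrier →ₗ[ℂ] LaurentSeries ℂ ⊗[ℂ] W.carrier)
    (hf : ∀ v, f (V.twist v) = formalSig q W.twistEquiv (f v)) :
    ∃ g : V ⟶ W, ∀ v, f v = 1 ⊗ₜ[ℂ] g.toLin v := by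
  have hT : ∀ n v, (coeffTensor W.carrier n ∘ₗ f) (V.twist v) =
      (q : ℂ) ^ n • W.twist ((coeffTensor W.carrier n ∘ₗ f) v) := fun n v => by
    rw [LinearMap.comp_apply, hf, coeffTensor_sig]
    rfl
  have h0 : ∀ v, (coeffTensor W.carrier 0 ∘ₗ f) (V.twist v) =
      W.twist ((coeffTensor W.carrier 0 ∘ₗ f) v) := fun v => by
    simpa using hT 0 v
  set T := coeffTensor W.carrier 0 ∘ₗ f with hTdef
  have hcomp : ∀ c, ∀ v ∈ V.comp c, T v ∈ W.comp c := by
    intro c v hv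
    rw [V.comp_eq_maxGenEigenspace, Module.End.mem_maxGenEigenspace] at hv
    obtain ⟨k, hk⟩ := hv
    rw [W.comp_eq_maxGenEigenspace, Module.End.mem_maxGenEigenspace]
    refine ⟨k, ?_⟩
    have key : ∀ (k : ℕ) (v : V.carrier),
        T (((V.twist - (rep q c : ℂ) • (1 : Module.End ℂ _)) ^ k : Module.End ℂ _) v) =
        ((W.twist - (rep q c : ℂ) • (1 : Module.End ℂ _)) ^ k : Module.End ℂ _) (T v) := by
      intro k
      induction k with
      | zero => simp
      | succ k ih =>
        intro v
        rw [pow_succ, Module.End.mul_apply, ih, pow_succ, Module.End.mul_apply]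
        simp [h0]
    rw [← key, hk, map_zero]
  refine ⟨⟨T, hcomp, fun v => ?_⟩, fun v => ?_⟩
  · refine congrArg (fun f : V.carrier →ₗ[ℂ] W.carrier => f v)
      (linearMap_ext_of_iSup_eq_top V.iSup_comp (f := T ∘ₗ V.nil) (g := W.nil ∘ₗ T) ?_)
    intro c v hv
    change T (V.nil v) = W.nil (T v)
    rw [V.nil_apply hv, W.nil_apply (hcomp c v hv), map_sub, map_smul, h0]
  · rw [← sub_eq_zero]
    refine eq_zero_of_coeffTensor_eq_zero fun n => ?_
    rw [map_sub, coeffTensor_tmul, HahnSeries.coeff_one]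
    rcases eq_or_ne n 0 with rfl | hn
    · simp [hTdef]
    · have := eq_zero_of_intertwines hroot V W hn (hT n)
      rw [if_neg hn, zero_smul, sub_zero]
      exact DFunLike.congr_fun this v

end Rigidity

/-! ## Small divisors and convergence of formal solutions -/

theorem converges_const_mul {c : ℕ → ℂ} (hc : Converges c) (a : ℂ) :
    Converges fun n => a * c n := by
  rw [converges_iff_bound] at *
  obtain ⟨A, B, hA, hB, h⟩ := hc
  refine ⟨‖a‖ * A, B, by positivity, hB, fun n => ?_⟩
  rw [norm_mul, mul_assoc]
  exact mul_le_mul_of_nonneg_left (h n) (norm_nonneg a)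

theorem Converges.mul_apply {c d : ℕ → ℂ} (hc : Converges c) (hd : Converges d) :
    Converges fun n => c n * d n := by
  rw [converges_iff_bound] at *
  obtain ⟨A, B, hA, hB, h⟩ := hc
  obtain ⟨A', B', hA', hB', h'⟩ := hd
  refine ⟨A * A', B * B', by positivity, by positivity, fun n => ?_⟩
  rw [norm_mul, mul_pow, mul_mul_mul_comm]
  exact mul_le_mul (h n) (h' n) (norm_nonneg _) (by positivity)

theorem converges_pow (a : ℂ) : Converges fun n => a ^ n :=
  converges_iff_bound.2 ⟨1, ‖a‖ + 1, zero_le_one, by positivity, fun n => by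
    rw [norm_pow, one_mul]
    exact pow_le_pow_left₀ (norm_nonneg a) (by linarith) n⟩

theorem converges_one : Converges fun _ => 1 := by simpa using converges_pow 1

theorem converges_multiset_prod {ι : Type*} (s : Multiset ι) {c : ι → ℕ → ℂ}
    (h : ∀ i ∈ s, Converges (c i)) : Converges fun n => (s.map fun i => c i n).prod := by
  induction s using Multiset.induction_on with
  | empty => simpa using converges_one
  | cons a s ih =>
    simp only [Multiset.map_cons, Multiset.prod_cons]
    exact (h a (Multiset.mem_cons_self a s)).mul_apply
      (ih fun i hi => h i (Multiset.mem_cons_of_mem hi))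

theorem exists_uniform_bound {ι : Type*} [Finite ι] {c : ι → ℕ → ℂ} (h : ∀ i, Converges (c i)) :
    ∃ C r : ℝ, 0 < C ∧ 0 < r ∧ ∀ i n, ‖c i n‖ ≤ C * r ^ n := by
  have := Fintype.ofFinite ι
  simp only [converges_iff_bound] at h
  choose A B hA hB h using h
  refine ⟨1 + ∑ i, A i, 1 + ∑ i, B i, ?_, ?_, fun i n => (h i n).trans ?_⟩
  · have := Finset.sum_nonneg fun i (_ : i ∈ Finset.univ) => hA i
    positivity
  · have := Finset.sum_nonneg fun i (_ : i ∈ Finset.univ) => (hB i).le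
    positivity
  · have h1 := Finset.single_le_sum (fun i _ => hA i) (Finset.mem_univ i)
    have h2 := Finset.single_le_sum (fun i _ => (hB i).le) (Finset.mem_univ i)
    exact mul_le_mul (by linarith) (pow_le_pow_left₀ (hB i).le (by linarith) n)
      (pow_nonneg (hB i).le n) (by linarith [hA i])

/-- Discrete Gronwall estimate. Since every δ is at least 1, the product of all earlier δ dominates
the one attached to each earlier term and factors out. What remains is the geometric sum of C(1 +
C)^l, equal to (1 + C)^n - 1. -/
theorem le_of_convolution_bound {a δ : ℕ → ℝ} {C r : ℝ} (hC : 0 < C) (hr : 0 < r)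
    (hδ : ∀ n, 1 ≤ δ n)
    (h : ∀ n, a n ≤ δ n * (C * (r ^ n + ∑ l ∈ Finset.range n, r ^ (n - l) * a l))) (n : ℕ) :
    a n ≤ C * (1 + C) ^ n * r ^ n * ∏ k ∈ Finset.range (n + 1), δ k := by
  induction n using Nat.strong_induction_on with
  | _ n ih =>
    set D := ∏ k ∈ Finset.range n, δ k with hD
    have hD1 : 1 ≤ D := Finset.one_le_prod fun k _ => hδ k
    have hδ0 : 0 ≤ δ n := zero_le_one.trans (hδ n)
    have hs : ∑ l ∈ Finset.range n, r ^ (n - l) * a l ≤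
        ∑ l ∈ Finset.range n, r ^ n * D * (C * (1 + C) ^ l) := by
      refine Finset.sum_le_sum fun l hl => ?_
      have hl := Finset.mem_range.1 hl
      have hle : ∏ k ∈ Finset.range (l + 1), δ k ≤ D :=
        Finset.prod_le_prod_of_subset_of_one_le
          (Finset.range_subset_range.2 hl) (fun k _ => zero_le_one.trans (hδ k)) (fun k _ _ => hδ k)
      calc r ^ (n - l) * a l ≤ r ^ (n - l) * (C * (1 + C) ^ l * r ^ l * D) := by
            refine mul_le_mul_of_nonneg_left ((ih l hl).trans ?_) (by positivity)
            exact mul_le_mul_of_nonneg_left hle (by positivity)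
        _ = (r ^ (n - l) * r ^ l) * D * (C * (1 + C) ^ l) := by ring
        _ = r ^ n * D * (C * (1 + C) ^ l) := by rw [← pow_add, Nat.sub_add_cancel hl.le]
    have hgeom : ∑ l ∈ Finset.range n, C * (1 + C) ^ l = (1 + C) ^ n - 1 := by
      rw [← Finset.mul_sum, mul_comm]
      simpa using geom_sum_mul (1 + C) n
    rw [← Finset.mul_sum, hgeom] at hs
    calc a n ≤ δ n * (C * (r ^ n * D + r ^ n * D * ((1 + C) ^ n - 1))) := by
          refine (h n).trans (mul_le_mul_of_nonneg_left (mul_le_mul_of_nonneg_left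
            (add_le_add ?_ hs) hC.le) hδ0)
          exact le_mul_of_one_le_right (by positivity) hD1
      _ = _ := by rw [Finset.prod_range_succ, ← hD]; ring

theorem norm_mulVec_le {n : Type*} [Fintype n] {M : Matrix n n ℂ} {b : ℝ} (hb : 0 ≤ b)
    (hM : ∀ i j, ‖M i j‖ ≤ b) (v : n → ℂ) : ‖M.mulVec v‖ ≤ Fintype.card n * b * ‖v‖ := by
  refine (pi_norm_le_iff_of_nonneg (by positivity)).2 fun i => ?_
  calc ‖∑ j, M i j * v j‖ ≤ ∑ _j : n, b * ‖v‖ := by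
        refine (norm_sum_le _ _).trans (Finset.sum_le_sum fun j _ => ?_)
        rw [norm_mul]
        exact mul_le_mul (hM i j) (norm_le_pi_norm v j) (norm_nonneg _) hb
    _ = _ := by simp [mul_assoc]

/-- The quotients `α / z`-small divisors of `z` relative to `α` are nonzero, and the product of
the first `n` inverses grows at most geometrically. -/
def SmallDivisors (q : ℂˣ) (z α : ℂ) : Prop :=
  (∀ k : ℕ, (q : ℂ) ^ (k + 1) * z ≠ α) ∧
    Converges fun n => (∏ k ∈ Finset.range n, (α - (q : ℂ) ^ (k + 1) * z))⁻¹

section Regularity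

variable {n : Type*} [Fintype n] [DecidableEq n] {q : ℂˣ}

/-- The matrix is -q^k times α/q^k - A, and |q| = 1, so its determinant has the modulus of the
characteristic polynomial at α/q^k. -/
theorem norm_det_smul_sub (hq : ‖(q : ℂ)‖ = 1) (A : Matrix n n ℂ) (α : ℂ) (k : ℕ) :
    ‖((q : ℂ) ^ k • A - Matrix.scalar n α).det‖ =
      (A.charpoly.roots.map fun z => ‖α - (q : ℂ) ^ k * z‖).prod := by
  have hk : (q : ℂ) ^ k ≠ 0 := pow_ne_zero _ q.ne_zero
  have hs := IsAlgClosed.splits A.charpoly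
  have e : (q : ℂ) ^ k • A - Matrix.scalar n α =
      (-(q : ℂ) ^ k) • (Matrix.scalar n (α / (q : ℂ) ^ k) - A) := by
    ext i j
    by_cases h : i = j
    · subst h
      simp
      field_simp
      ring
    · simp [h]
  rw [e, Matrix.det_smul, ← Matrix.eval_charpoly, hs.eval_eq_prod_roots_of_monic A.charpoly_monic,
    norm_mul, norm_pow, norm_neg, norm_pow, hq, one_pow, one_pow, one_mul]
  refine (Multiset.prod_hom _ (normHom : ℂ →*₀ ℝ)).symm.trans ?_
  rw [Multiset.map_map]
  refine congrArg _ (Multiset.map_congr rfl fun z _ => ?_)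
  have : α / (q : ℂ) ^ k - z = (α - (q : ℂ) ^ k * z) / (q : ℂ) ^ k := by field_simp
  simp [this, hq]

/-- Cramer's rule turns each step into division by det(q^k B₀ - α). The adjugates are uniformly
bounded because q^k stays on the unit circle, so only the determinants can be small; they factor
into small divisors whose inverse products grow at most geometrically. -/
theorem converges_of_recursion (hq : ‖(q : ℂ)‖ = 1) {B : ℕ → Matrix n n ℂ}
    (hB : ∀ i j, Converges fun k => B k i j) {y g : ℕ → n → ℂ}
    (hg : ∀ i, Converges fun k => g k i) {α : ℂ}
    (hα : ∀ z ∈ (B 0).charpoly.roots, SmallDivisors q z α)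
    (h : ∀ k, ((q : ℂ) ^ k • B 0 - Matrix.scalar n α).mulVec (y k) =
      g k - ∑ l ∈ Finset.range k, (q : ℂ) ^ l • (B (k - l)).mulVec (y l)) (i : n) :
    Converges fun k => y k i := by
  set T : ℕ → Matrix n n ℂ := fun k => (q : ℂ) ^ k • B 0 - Matrix.scalar n α with hT
  -- Index 0 is left out: α may be an eigenvalue of B₀, and y₀ enters only as a fixed initial
  -- vector.
  have hdet : ∀ k, (T (k + 1)).det ≠ 0 := fun k => by
    rw [← norm_ne_zero_iff, norm_det_smul_sub hq]
    refine Multiset.prod_ne_zero fun h0 => ?_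
    obtain ⟨z, hz, h0⟩ := Multiset.mem_map.1 h0
    exact (hα z hz).1 k (sub_eq_zero.1 (norm_eq_zero.1 h0)).symm
  obtain ⟨a, ha0, ha⟩ : ∃ a, 0 ≤ a ∧ ∀ k i j, ‖(T k).adjugate i j‖ ≤ a := by
    have hc : Continuous fun w : ℂ => (w • B 0 - Matrix.scalar n α).adjugate := by
      fun_prop
    have hb : ∀ p : n × n, ∃ a, ∀ w ∈ Metric.sphere (0 : ℂ) 1,
        ‖(w • B 0 - Matrix.scalar n α).adjugate p.1 p.2‖ ≤ a := fun p =>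
      (isCompact_sphere (0 : ℂ) 1).exists_bound_of_continuousOn
        ((hc.matrix_elem p.1 p.2).continuousOn)
    choose a ha using hb
    refine ⟨∑ p, |a p|, Finset.sum_nonneg fun p _ => abs_nonneg _, fun k i j => ?_⟩
    refine (ha (i, j) ((q : ℂ) ^ k) (by simp [hq])).trans ((le_abs_self _).trans ?_)
    exact Finset.single_le_sum (f := fun p => |a p|) (fun p _ => abs_nonneg _) (Finset.mem_univ _)
  obtain ⟨d, hd⟩ : ∃ d, ∀ k, ‖(T k).det‖ ≤ d := by
    have hc : Continuous fun w : ℂ => (w • B 0 - Matrix.scalar n α).det := by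
      fun_prop
    obtain ⟨d, hd⟩ := (isCompact_sphere (0 : ℂ) 1).exists_bound_of_continuousOn hc.continuousOn
    exact ⟨d, fun k => hd _ (by simp [hq])⟩
  have hd0 : 0 ≤ d := (norm_nonneg _).trans (hd 0)
  obtain ⟨C, r, hC, hr, hbound⟩ := exists_uniform_bound
    (c := fun p : (n × n) ⊕ n => Sum.elim (fun p k => B k p.1 p.2) (fun i k => g k i) p)
    (by rintro (p | i); exacts [hB p.1 p.2, hg i])
  set N : ℝ := (Fintype.card n : ℝ) with hN
  have hN0 : 0 ≤ N := Nat.cast_nonneg _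
  -- The factor 1 + d, with d bounding all the determinants, makes δ ≥ 1 as the Gronwall estimate
  -- requires; the value at 0 avoids inverting a possibly zero determinant.
  set δ : ℕ → ℝ := fun k => if k = 0 then 1 else (1 + d) * ‖(T k).det‖⁻¹ with hδ
  have hδ1 : ∀ k, 1 ≤ δ k := by
    rintro (_ | k)
    · simp [hδ]
    · have hpos : 0 < ‖(T (k + 1)).det‖ := norm_pos_iff.2 (hdet k)
      simp only [hδ, Nat.succ_ne_zero, if_false]
      rw [← div_eq_mul_inv, one_le_div hpos]
      linarith [hd (k + 1)]
  -- One constant serves both the initial vector and the recursion step; the summand 1 makes it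
  -- positive.
  set E : ℝ := ‖y 0‖ + N * a * (C * (1 + N)) + 1 with hE
  have hEpos : 0 < E := by positivity
  have hrec : ∀ k, ‖y k‖ ≤ δ k * (E * (r ^ k + ∑ l ∈ Finset.range k, r ^ (k - l) * ‖y l‖)) := by
    rintro (_ | k)
    · have : 0 ≤ N * a * (C * (1 + N)) := by positivity
      simp [hδ, hE]
      linarith
    · have hpos : 0 < ‖(T (k + 1)).det‖ := norm_pos_iff.2 (hdet k)
      set w := g (k + 1) - ∑ l ∈ Finset.range (k + 1), (q : ℂ) ^ l • (B (k + 1 - l)).mulVec (y l)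
        with hw
      set s := r ^ (k + 1) + ∑ l ∈ Finset.range (k + 1), r ^ (k + 1 - l) * ‖y l‖ with hs
      have hs0 : 0 ≤ ∑ l ∈ Finset.range (k + 1), r ^ (k + 1 - l) * ‖y l‖ :=
        Finset.sum_nonneg fun l _ => by positivity
      have hspos : 0 ≤ s := by positivity
      have e1 : (T (k + 1)).det • y (k + 1) = (T (k + 1)).adjugate.mulVec w := by
        rw [hw, ← h (k + 1), Matrix.mulVec_mulVec, Matrix.adjugate_mul, Matrix.smul_mulVec,
          Matrix.one_mulVec]
      have e2 : ‖w‖ ≤ C * (1 + N) * s := by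
        have h1 : ‖g (k + 1)‖ ≤ C * r ^ (k + 1) :=
          (pi_norm_le_iff_of_nonneg (by positivity)).2 fun i => hbound (Sum.inr i) (k + 1)
        have h2 : ‖∑ l ∈ Finset.range (k + 1), (q : ℂ) ^ l • (B (k + 1 - l)).mulVec (y l)‖ ≤
            ∑ l ∈ Finset.range (k + 1), (C * N) * (r ^ (k + 1 - l) * ‖y l‖) := by
          refine (norm_sum_le _ _).trans (Finset.sum_le_sum fun l _ => ?_)
          rw [norm_smul, norm_pow, hq, one_pow, one_mul]
          refine (norm_mulVec_le (b := C * r ^ (k + 1 - l)) (by positivity)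
            (fun i j => hbound (Sum.inl (i, j)) _) _).trans (le_of_eq ?_)
          ring
        rw [← Finset.mul_sum] at h2
        have h3 : 0 ≤ C * N * r ^ (k + 1) := by positivity
        have h4 := mul_nonneg hC.le hs0
        calc ‖w‖ ≤ C * r ^ (k + 1) + C * N * ∑ l ∈ Finset.range (k + 1), r ^ (k + 1 - l) * ‖y l‖ :=
              (norm_sub_le _ _).trans (add_le_add h1 h2)
          _ ≤ C * (1 + N) * s := by rw [hs]; linarith
      have e3 : ‖(T (k + 1)).det‖ * ‖y (k + 1)‖ ≤ N * a * (C * (1 + N) * s) := by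
        rw [← norm_smul, e1]
        exact (norm_mulVec_le ha0 (ha (k + 1)) w).trans
          (mul_le_mul_of_nonneg_left e2 (by positivity))
      have e4 : δ (k + 1) = (1 + d) * ‖(T (k + 1)).det‖⁻¹ := by simp [hδ]
      rw [e4]
      calc ‖y (k + 1)‖ = ‖(T (k + 1)).det‖⁻¹ * (‖(T (k + 1)).det‖ * ‖y (k + 1)‖) := by
            rw [inv_mul_cancel_left₀ hpos.ne']
        _ ≤ ‖(T (k + 1)).det‖⁻¹ * (N * a * (C * (1 + N) * s)) :=
            mul_le_mul_of_nonneg_left e3 (by positivity)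
        _ ≤ ‖(T (k + 1)).det‖⁻¹ * (E * s) := by
            refine mul_le_mul_of_nonneg_left ?_ (by positivity)
            rw [← mul_assoc]
            exact mul_le_mul_of_nonneg_right (by rw [hE]; linarith [norm_nonneg (y 0)]) hspos
        _ ≤ (1 + d) * ‖(T (k + 1)).det‖⁻¹ * (E * s) := by
            rw [mul_assoc]
            exact le_mul_of_one_le_left (by positivity) (by linarith)
  obtain ⟨A', B', hA', hB', hprod⟩ := converges_iff_bound.1
    (converges_multiset_prod (B 0).charpoly.roots fun z hz => (hα z hz).2)
  refine converges_iff_bound.2 ⟨E * A', (1 + E) * r * (1 + d) * B', by positivity,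
    by positivity, fun m => ?_⟩
  -- Exchanging the products over indices and over eigenvalues reduces this to the hypothesis on
  -- each eigenvalue.
  have hδprod : ∏ k ∈ Finset.range (m + 1), δ k ≤ (1 + d) ^ m * (A' * B' ^ m) := by
    rw [Finset.prod_range_succ']
    have e0 : δ 0 = 1 := by simp [hδ]
    have e1 : ∀ k, δ (k + 1) = (1 + d) * ‖(T (k + 1)).det‖⁻¹ := fun k => by simp [hδ]
    rw [e0, mul_one, Finset.prod_congr rfl fun k _ => e1 k, Finset.prod_mul_distrib,
      Finset.prod_const, Finset.card_range]
    refine mul_le_mul_of_nonneg_left ((le_of_eq ?_).trans (hprod m)) (by positivity)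
    simp_rw [hT, norm_det_smul_sub hq]
    rw [Finset.prod_inv_distrib, Multiset.prod_map_inv, norm_inv]
    congr 1
    rw [Multiset.prod_map_prod, norm_prod]
    refine Finset.prod_congr rfl fun k _ => ?_
    refine Eq.trans ?_ (Multiset.prod_hom _ (normHom : ℂ →*₀ ℝ))
    rw [Multiset.map_map]
    rfl
  calc ‖y m i‖ ≤ ‖y m‖ := norm_le_pi_norm _ _
    _ ≤ E * (1 + E) ^ m * r ^ m * ∏ k ∈ Finset.range (m + 1), δ k :=
        le_of_convolution_bound hEpos hr hδ1 hrec m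
    _ ≤ E * (1 + E) ^ m * r ^ m * ((1 + d) ^ m * (A' * B' ^ m)) :=
        mul_le_mul_of_nonneg_left hδprod (by positivity)
    _ = _ := by rw [mul_pow, mul_pow, mul_pow]; ring

end Regularity

/-! ## Power series inside Laurent series -/

/-- The inclusion `ℂ⟦x⟧ → ℂ((x))`. -/
abbrev toLaurent : PowerSeries ℂ →+* LaurentSeries ℂ := HahnSeries.ofPowerSeries ℤ ℂ

theorem toLaurent_injective : Function.Injective toLaurent := HahnSeries.ofPowerSeries_injective

theorem toLaurent_coeff_natCast (p : PowerSeries ℂ) (n : ℕ) :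
    (toLaurent p).coeff n = PowerSeries.coeff n p :=
  LaurentSeries.coeff_coe_powerSeries p n

theorem toLaurent_coeff_of_neg (p : PowerSeries ℂ) {n : ℤ} (hn : n < 0) :
    (toLaurent p).coeff n = 0 :=
  (PowerSeries.coeff_coe p n).trans (if_pos hn)

theorem exists_toLaurent_eq {f : LaurentSeries ℂ} (h : ∀ n : ℤ, n < 0 → f.coeff n = 0) :
    ∃ p, toLaurent p = f := by
  refine ⟨PowerSeries.mk fun n => f.coeff n, ?_⟩
  ext n
  rcases lt_or_ge n 0 with hn | hn
  · rw [toLaurent_coeff_of_neg _ hn, h n hn]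
  · lift n to ℕ using hn
    rw [toLaurent_coeff_natCast, PowerSeries.coeff_mk]

theorem toLaurent_mem_meroGerms_iff {p : PowerSeries ℂ} :
    toLaurent p ∈ meroGerms ↔ Converges fun n => PowerSeries.coeff n p := by
  change Converges _ ↔ _
  simp only [toLaurent_coeff_natCast]

theorem sigmaHat_toLaurent (q : ℂˣ) (p : PowerSeries ℂ) :
    sigmaHat q (toLaurent p) = toLaurent (PowerSeries.rescale (q : ℂ) p) := by
  ext n
  rw [sigmaHat_coeff]
  rcases lt_or_ge n 0 with hn | hn
  · rw [toLaurent_coeff_of_neg _ hn, toLaurent_coeff_of_neg _ hn, mul_zero]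
  · lift n to ℕ using hn
    rw [toLaurent_coeff_natCast, toLaurent_coeff_natCast, PowerSeries.coeff_rescale, zpow_natCast]

theorem rescale_C (a c : ℂ) : PowerSeries.rescale a (PowerSeries.C c) = PowerSeries.C c := by
  ext n
  rw [PowerSeries.coeff_rescale, PowerSeries.coeff_C]
  split_ifs with h <;> simp [h]

theorem toLaurent_C (c : ℂ) : toLaurent (PowerSeries.C c) = algebraMap ℂ (LaurentSeries ℂ) c :=
  HahnSeries.ofPowerSeries_C c

theorem single_mem_meroGerms (k : ℤ) : HahnSeries.single k (1 : ℂ) ∈ meroGerms := by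
  have := (converges_single_mul k 1).2 (one_mem meroGerms)
  rwa [mul_one] at this

theorem toLaurent_X_pow (k : ℕ) :
    toLaurent (PowerSeries.X ^ k) = HahnSeries.single (k : ℤ) (1 : ℂ) :=
  HahnSeries.ofPowerSeries_X_pow k

theorem exists_toLaurent_eq_single_mul (f : LaurentSeries ℂ) :
    ∃ N₀ : ℕ, ∀ N : ℕ, N₀ ≤ N → ∃ p, toLaurent p = HahnSeries.single (N : ℤ) (1 : ℂ) * f := by
  refine ⟨f.order.natAbs, fun N hN => exists_toLaurent_eq fun n hn => ?_⟩
  rw [coeff_single_one_mul]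
  exact HahnSeries.coeff_eq_zero_of_lt_order (by omega)

theorem toLaurent_polynomial_mem (p : Polynomial ℂ) : toLaurent (p : PowerSeries ℂ) ∈ meroGerms := by
  rw [toLaurent_mem_meroGerms_iff]
  refine ⟨1, one_pos, summable_of_ne_finset_zero (s := p.support) fun n hn => ?_⟩
  simp [Polynomial.notMem_support_iff.1 hn]

/-! ## Formal equivalences with a constant system converge -/

section Matrix

variable {n : Type*} [Fintype n] [DecidableEq n] {q : ℂˣ}

/-- The x^k-coefficient of B y(qx) - α y = g is exactly the recursion of `converges_of_recursion`.
-/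
theorem mem_meroGerms_of_regular_system (hq : ‖(q : ℂ)‖ = 1) {B : Matrix n n (PowerSeries ℂ)}
    (hB : ∀ i j, toLaurent (B i j) ∈ meroGerms) {y : n → PowerSeries ℂ} {α : ℂ}
    (hα : ∀ z ∈ (B.map PowerSeries.constantCoeff).charpoly.roots, SmallDivisors q z α)
    (hg : ∀ i, toLaurent (B.mulVec (fun j => PowerSeries.rescale (q : ℂ) (y j)) i -
      PowerSeries.C α * y i) ∈ meroGerms) (i : n) :
    toLaurent (y i) ∈ meroGerms := by
  simp only [toLaurent_mem_meroGerms_iff] at *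
  set Bc : ℕ → Matrix n n ℂ := fun k => B.map (PowerSeries.coeff k) with hBc
  have hB0 : B.map PowerSeries.constantCoeff = Bc 0 := by
    ext i j
    simp [hBc]
  rw [hB0] at hα
  refine converges_of_recursion (B := Bc) (y := fun k i => PowerSeries.coeff k (y i)) hq hB hg hα
    (fun k => funext fun i => ?_) i
  have e : PowerSeries.coeff k (B.mulVec (fun j => PowerSeries.rescale (q : ℂ) (y j)) i) =
      ∑ l ∈ Finset.range (k + 1), (q : ℂ) ^ l *
        (Bc (k - l)).mulVec (fun i => PowerSeries.coeff l (y i)) i := by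
    rw [← Finset.sum_range_reflect]
    simp only [Matrix.mulVec, dotProduct, map_sum, PowerSeries.coeff_mul]
    rw [Finset.sum_comm, Finset.Nat.sum_antidiagonal_eq_sum_range_succ_mk]
    refine Finset.sum_congr rfl fun l hl => ?_
    have hl := Finset.mem_range_succ_iff.1 hl
    rw [show k + 1 - 1 - l = k - l by omega, Finset.mul_sum, show k - (k - l) = l by omega]
    refine Finset.sum_congr rfl fun j _ => ?_
    simp [hBc, PowerSeries.coeff_rescale]
    ring
  rw [Pi.sub_apply, map_sub, e, Finset.sum_range_succ, Nat.sub_self, Matrix.sub_mulVec,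
    Finset.sum_apply]
  simp [Matrix.smul_mulVec, Matrix.scalar_apply]
  ring

/-- For a constant vector c, the vector Hc satisfies B (Hc)(qx) - α Hc = H(A - α)c. Convergence of
H(A - α)c therefore implies that of Hc. Peeling off the factors of the characteristic polynomial one
at a time ends at zero by Cayley–Hamilton, so no Jordan form is needed. -/
theorem mem_meroGerms_of_gauge (hq : ‖(q : ℂ)‖ = 1) {A : Matrix n n ℂ}
    (hA : ∀ z ∈ A.charpoly.roots, ∀ α ∈ A.charpoly.roots, SmallDivisors q z α)
    {B H : Matrix n n (PowerSeries ℂ)} (hB : ∀ i j, toLaurent (B i j) ∈ meroGerms)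
    (hB0 : B.map PowerSeries.constantCoeff = A)
    (h : B * H.map (PowerSeries.rescale (q : ℂ)) = H * A.map PowerSeries.C) (i j : n) :
    toLaurent (H i j) ∈ meroGerms := by
  have key : ∀ s : Multiset ℂ, (∀ α ∈ s, α ∈ A.charpoly.roots) → ∀ c : n → ℂ,
      (Polynomial.aeval A (s.map fun α => Polynomial.X - Polynomial.C α).prod).mulVec c = 0 →
      ∀ i, toLaurent (H.mulVec (fun j => PowerSeries.C (c j)) i) ∈ meroGerms := by
    intro s
    induction s using Multiset.induction_on with
    | empty =>
      intro _ c hc i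
      have : c = 0 := by simpa using hc
      simp [this, Matrix.mulVec, dotProduct, zero_mem]
    | cons α s ih =>
      intro hs c hc
      have ih' := ih (fun β hβ => hs β (Multiset.mem_cons_of_mem hβ))
        ((A - Matrix.scalar n α).mulVec c) (by
          rw [Multiset.map_cons, Multiset.prod_cons, mul_comm, map_mul,
            ← Matrix.mulVec_mulVec] at hc
          simpa [Matrix.algebraMap_eq_diagonal, Pi.algebraMap_def] using hc)
      refine mem_meroGerms_of_regular_system hq hB (α := α) ?_ fun i => ?_
      · rw [hB0]
        exact fun z hz => hA z hz α (hs α (Multiset.mem_cons_self α s))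
      · convert ih' i using 2
        have e1 : (fun j => PowerSeries.rescale (q : ℂ)
            (H.mulVec (fun j => PowerSeries.C (c j)) j)) =
            (H.map (PowerSeries.rescale (q : ℂ))).mulVec (fun j => PowerSeries.C (c j)) := by
          funext j
          simp [Matrix.mulVec, dotProduct, rescale_C]
        have e2 : (fun j => PowerSeries.C ((A - Matrix.scalar n α).mulVec c j)) =
            (A.map PowerSeries.C).mulVec (fun j => PowerSeries.C (c j)) -
              fun j => PowerSeries.C α * PowerSeries.C (c j) := by
          funext j
          rw [Matrix.sub_mulVec]
          simp [Matrix.mulVec, dotProduct]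
        rw [e1, Matrix.mulVec_mulVec, h, e2, Matrix.mulVec_sub, Matrix.mulVec_mulVec, Pi.sub_apply]
        congr 1
        simp only [Matrix.mulVec, dotProduct, Finset.mul_sum]
        exact Finset.sum_congr rfl fun j _ => by ring
  have hch : (Polynomial.aeval A (A.charpoly.roots.map fun α =>
      Polynomial.X - Polynomial.C α).prod) = 0 := by
    rw [← (IsAlgClosed.splits A.charpoly).eq_prod_roots_of_monic A.charpoly_monic]
    exact A.aeval_self_charpoly
  have := key A.charpoly.roots (fun _ h => h) (Pi.single j 1) (by rw [hch, Matrix.zero_mulVec]) i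
  convert this using 2
  simp only [Matrix.mulVec, dotProduct]
  rw [Finset.sum_eq_single j]
  · simp
  · intro b _ hb
    simp [hb]
  · simp

/-! ### Splitting a formal gauge into a meromorphic factor and a factor tangent to the identity -/

omit [DecidableEq n] in
theorem exists_toLaurent_eq_single_mul_matrix (F : Matrix n n (LaurentSeries ℂ)) :
    ∃ N₀ : ℕ, ∀ N : ℕ, N₀ ≤ N → ∃ M : Matrix n n (PowerSeries ℂ),
      ∀ i j, toLaurent (M i j) = HahnSeries.single (N : ℤ) (1 : ℂ) * F i j := by
  choose N₀ h using fun p : n × n => exists_toLaurent_eq_single_mul (F p.1 p.2)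
  refine ⟨∑ p, N₀ p, fun N hN => ?_⟩
  choose M hM using fun i j => h (i, j) N
    ((Finset.single_le_sum (fun _ _ => Nat.zero_le _) (Finset.mem_univ _)).trans hN)
  exact ⟨Matrix.of M, hM⟩

/-- A matrix of power series that is invertible over the Laurent series is a matrix of polynomials
up to a matrix of power series that is the identity at `0`. -/
theorem exists_polynomial_matrix_eq_mul {F G : Matrix n n (PowerSeries ℂ)} {N : ℕ}
    (h : F * G = (PowerSeries.X ^ N : PowerSeries ℂ) • 1)
    (h' : G * F = (PowerSeries.X ^ N : PowerSeries ℂ) • 1) :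
    ∃ (P : Matrix n n (Polynomial ℂ)) (J : Matrix n n (PowerSeries ℂ)),
      J.map PowerSeries.constantCoeff = 1 ∧ IsUnit J.det ∧
        P.map (fun p => (p : PowerSeries ℂ)) = F * J := by
  -- Truncating one order past N leaves F - P = x^(N+1) R, whence GP = x^N(1 - xGR): the second
  -- factor is a unit with value 1 at 0.
  have hdvd : ∀ i j, ∃ r, F i j - ((PowerSeries.trunc (N + 1) (F i j) : Polynomial ℂ) : PowerSeries ℂ) =
      PowerSeries.X ^ (N + 1) * r := fun i j => by
    refine PowerSeries.X_pow_dvd_iff.2 fun m hm => ?_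
    rw [map_sub, PowerSeries.coeff_coe_trunc_of_lt hm, sub_self]
  choose R hR using hdvd
  set P : Matrix n n (Polynomial ℂ) := Matrix.of fun i j => PowerSeries.trunc (N + 1) (F i j)
    with hP
  have hR' : P.map (fun p => (p : PowerSeries ℂ)) =
      F - (PowerSeries.X ^ (N + 1) : PowerSeries ℂ) • Matrix.of R := by
    ext i j : 1
    simp [← hR, hP]
  set J : Matrix n n (PowerSeries ℂ) := 1 - (PowerSeries.X : PowerSeries ℂ) • (G * Matrix.of R)
    with hJ
  have hGP : G * P.map (fun p => (p : PowerSeries ℂ)) =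
      (PowerSeries.X ^ N : PowerSeries ℂ) • J := by
    rw [hR', Matrix.mul_sub, h', Matrix.mul_smul, hJ, smul_sub, smul_smul, pow_succ]
  have hJ0 : J.map PowerSeries.constantCoeff = 1 := by
    ext i j
    simp [hJ, Matrix.one_apply]
  refine ⟨P, J, hJ0, ?_, ?_⟩
  · rw [PowerSeries.isUnit_iff_constantCoeff, RingHom.map_det, RingHom.mapMatrix_apply, hJ0]
    simp
  · have e : (PowerSeries.X ^ N : PowerSeries ℂ) • P.map (fun p => (p : PowerSeries ℂ)) =
        (PowerSeries.X ^ N : PowerSeries ℂ) • (F * J) := by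
      rw [← Matrix.mul_smul, ← hGP, ← Matrix.mul_assoc, h, Matrix.smul_mul, Matrix.one_mul]
    ext i j : 1
    exact mul_left_cancel₀ (pow_ne_zero _ PowerSeries.X_ne_zero) (congrFun (congrFun e i) j)

theorem mul_eq_X_pow_smul_one {F G : Matrix n n (LaurentSeries ℂ)} (hFG : F * G = 1) {N : ℕ}
    {F' G' : Matrix n n (PowerSeries ℂ)}
    (hF : ∀ i j, toLaurent (F' i j) = HahnSeries.single (N : ℤ) (1 : ℂ) * F i j)
    (hG : ∀ i j, toLaurent (G' i j) = HahnSeries.single (N : ℤ) (1 : ℂ) * G i j) :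
    F' * G' = (PowerSeries.X ^ (2 * N) : PowerSeries ℂ) • 1 := by
  have hX : toLaurent (PowerSeries.X ^ (2 * N)) =
      HahnSeries.single (N : ℤ) (1 : ℂ) * HahnSeries.single (N : ℤ) (1 : ℂ) := by
    rw [two_mul, pow_add, map_mul, toLaurent_X_pow]
  ext i j : 1
  refine toLaurent_injective ?_
  have e : ∀ k, toLaurent (F' i k * G' k j) = HahnSeries.single (N : ℤ) (1 : ℂ) *
      HahnSeries.single (N : ℤ) (1 : ℂ) * (F i k * G k j) := fun k => by
    rw [map_mul, hF, hG, mul_mul_mul_comm]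
  rw [Matrix.smul_apply, smul_eq_mul, map_mul, hX, Matrix.mul_apply, map_sum,
    Finset.sum_congr rfl fun k _ => e k, ← Finset.mul_sum, ← Matrix.mul_apply, hFG,
    Matrix.one_apply, Matrix.one_apply, apply_ite toLaurent, map_one toLaurent, map_zero toLaurent]

/-- A formally invertible matrix is a meromorphic matrix times a matrix of power series that is
the identity at `0`. -/
theorem exists_eq_mul_of_isUnit {F G : Matrix n n (LaurentSeries ℂ)} (hFG : F * G = 1) :
    ∃ (P : Matrix n n meroGerms) (J H : Matrix n n (PowerSeries ℂ)), P.det ≠ 0 ∧ H * J = 1 ∧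
      J.map PowerSeries.constantCoeff = 1 ∧ F = P.map meroGerms.subtype * H.map toLaurent := by
  obtain ⟨N₁, h₁⟩ := exists_toLaurent_eq_single_mul_matrix F
  obtain ⟨N₂, h₂⟩ := exists_toLaurent_eq_single_mul_matrix G
  obtain ⟨Ft, hFt⟩ := h₁ (N₁ + N₂) (Nat.le_add_right _ _)
  obtain ⟨Gt, hGt⟩ := h₂ (N₁ + N₂) (Nat.le_add_left _ _)
  obtain ⟨Pt, J, hJ0, hJdet, hPJ⟩ := exists_polynomial_matrix_eq_mul
    (mul_eq_X_pow_smul_one hFG hFt hGt) (mul_eq_X_pow_smul_one (mul_eq_one_comm.1 hFG) hGt hFt)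
  set t : LaurentSeries ℂ := HahnSeries.single ((N₁ + N₂ : ℕ) : ℤ) (1 : ℂ) with ht
  have ht0 : t ≠ 0 := by simp [ht]
  have hPK : ∀ i j, t⁻¹ * toLaurent (Pt i j : PowerSeries ℂ) ∈ meroGerms := fun i j =>
    mul_mem (inv_mem (single_mem_meroGerms _)) (toLaurent_polynomial_mem _)
  -- Undoing the power of x that cleared denominators makes the polynomial factor meromorphic.
  set P : Matrix n n meroGerms := Matrix.of fun i j => ⟨_, hPK i j⟩ with hP
  have hF : F = P.map meroGerms.subtype * J⁻¹.map toLaurent := by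
    ext i j : 1
    have e : Pt.map (fun p => (p : PowerSeries ℂ)) * J⁻¹ = Ft := by
      rw [hPJ, Matrix.mul_nonsing_inv_cancel_right _ _ hJdet]
    rw [eq_inv_mul_iff_mul_eq₀ ht0 |>.2 (hFt i j).symm, ← e, Matrix.mul_apply, Matrix.mul_apply,
      map_sum, Finset.mul_sum]
    refine Finset.sum_congr rfl fun k _ => ?_
    rw [map_mul, ← mul_assoc]
    rfl
  refine ⟨P, J, J⁻¹, fun h0 => ?_, Matrix.nonsing_inv_mul _ hJdet, hJ0, hF⟩
  have h1 : F.det = 0 := by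
    rw [hF, Matrix.det_mul, ← RingHom.mapMatrix_apply, ← RingHom.map_det, h0, map_zero, zero_mul]
  have h2 := congrArg Matrix.det hFG
  rw [Matrix.det_mul, h1, zero_mul, Matrix.det_one] at h2
  exact zero_ne_one h2

/-- Write F = PH with P meromorphic and H(0) = 1. The conjugated matrix P⁻¹ B σ_q(P) is meromorphic,
yet it equals H A σ_q(H)⁻¹, a power series with constant term A. Hence it is holomorphic and the
gauge lemma applies to H. -/
theorem mem_meroGerms_of_formal_equivalence (hq : ‖(q : ℂ)‖ = 1) {A : Matrix n n ℂ}
    (hA : ∀ z ∈ A.charpoly.roots, ∀ α ∈ A.charpoly.roots, SmallDivisors q z α)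
    {B : Matrix n n meroGerms} {F G : Matrix n n (LaurentSeries ℂ)} (hFG : F * G = 1)
    (h : B.map (meroGerms.subtype) * F.map (sigmaHat q) =
      F * A.map (algebraMap ℂ (LaurentSeries ℂ))) (i j : n) :
    F i j ∈ meroGerms := by
  obtain ⟨P, J, H, hP, hHJ, hJ0, rfl⟩ := exists_eq_mul_of_isUnit hFG
  have hσ : ∀ M N : Matrix n n (LaurentSeries ℂ),
      (M * N).map (sigmaHat q) = M.map (sigmaHat q) * N.map (sigmaHat q) := fun M N =>
    Matrix.map_mul (f := (sigmaHat q : LaurentSeries ℂ →+* LaurentSeries ℂ))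
  have hσP : (P.map meroGerms.subtype).map (sigmaHat q) = (P.map (sigma q)).map meroGerms.subtype :=
    rfl
  have hσL : ∀ M : Matrix n n (PowerSeries ℂ), (M.map toLaurent).map (sigmaHat q) =
      (M.map (PowerSeries.rescale (q : ℂ))).map toLaurent := fun M => by
    ext i j : 1
    exact sigmaHat_toLaurent q _
  have hHJσ : H.map (PowerSeries.rescale (q : ℂ)) * J.map (PowerSeries.rescale (q : ℂ)) = 1 := by
    rw [← Matrix.map_mul, hHJ]
    simp
  have hAC : A.map (algebraMap ℂ (LaurentSeries ℂ)) = (A.map PowerSeries.C).map toLaurent := by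
    ext i j : 1
    exact (toLaurent_C _).symm
  set Bp := H * A.map PowerSeries.C * J.map (PowerSeries.rescale (q : ℂ)) with hBp
  have hBp' : Bp.map toLaurent = (P⁻¹ * B * P.map (sigma q)).map meroGerms.subtype := by
    have hPinv : (P⁻¹).map meroGerms.subtype * P.map meroGerms.subtype = 1 := by
      rw [← Matrix.map_mul, Matrix.nonsing_inv_mul _ hP.isUnit]
      simp
    rw [hσ, hσP, hσL, hAC] at h
    have h' := congrArg (fun M => (P⁻¹).map meroGerms.subtype * M *
      (J.map (PowerSeries.rescale (q : ℂ))).map toLaurent) h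
    simp only [Matrix.mul_assoc] at h'
    rw [← Matrix.map_mul (f := toLaurent) (L := H.map _), hHJσ, ← Matrix.mul_assoc _ (P.map _),
      hPinv, Matrix.one_mul] at h'
    rw [hBp, Matrix.map_mul, Matrix.map_mul, Matrix.map_mul, Matrix.map_mul, Matrix.mul_assoc,
      ← h', Matrix.mul_assoc]
    simp
  have hH0 : H.map PowerSeries.constantCoeff = 1 := by
    have := congrArg (fun M => M.map PowerSeries.constantCoeff) hHJ
    rw [Matrix.map_mul, hJ0, Matrix.mul_one] at this
    rw [this, Matrix.map_one _ (map_zero _) (map_one _)]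
  have hHmem := mem_meroGerms_of_gauge hq hA (B := Bp) (H := H)
    (fun i j => by
      have := congrFun (congrFun hBp' i) j
      rw [Matrix.map_apply, Matrix.map_apply] at this
      rw [this]
      exact Subtype.property _)
    (by
      have e1 : (J.map (PowerSeries.rescale (q : ℂ))).map PowerSeries.constantCoeff = 1 := by
        rw [← hJ0]
        ext i j
        rw [Matrix.map_apply, Matrix.map_apply, Matrix.map_apply,
          ← PowerSeries.coeff_zero_eq_constantCoeff_apply, PowerSeries.coeff_rescale, pow_zero,
          one_mul, PowerSeries.coeff_zero_eq_constantCoeff_apply]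
      have e2 : (A.map PowerSeries.C).map PowerSeries.constantCoeff = A := by
        ext i j
        simp
      rw [hBp, Matrix.map_mul, Matrix.map_mul, hH0, e1, e2, Matrix.one_mul, Matrix.mul_one])
    (by rw [hBp, Matrix.mul_assoc, mul_eq_one_comm.1 hHJσ, Matrix.mul_one])
  rw [Matrix.mul_apply]
  exact sum_mem fun k _ => mul_mem (Subtype.property (P i k)) (hHmem k j)

end Matrix

/-! ## Matrices of difference modules -/

namespace DiffModule

variable {F : Type} [Field F] {σ : F ≃+* F} {n : Type*}

/-- The matrix of the operator of a difference module in a basis. -/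
def sigMatrix {M : DiffModule.{u} F σ} (b : Module.Basis n F M.carrier) : Matrix n n F :=
  Matrix.of fun i j => b.repr (M.Sig (b j)) i

variable [Fintype n]

theorem sig_basis {M : DiffModule.{u} F σ} (b : Module.Basis n F M.carrier) (j : n) :
    M.Sig (b j) = ∑ i, sigMatrix b i j • b i :=
  (b.sum_repr _).symm

theorem sig_sum {M : DiffModule.{u} F σ} (f : n → F) (m : n → M.carrier) :
    M.Sig (∑ i, f i • m i) = ∑ i, σ (f i) • M.Sig (m i) := by
  simp only [map_sum, M.Sig_smul]

theorem comm_of_basis {M N : DiffModule.{u} F σ} (b : Module.Basis n F M.carrier)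
    (φ : M.carrier →ₗ[F] N.carrier) (h : ∀ j, φ (M.Sig (b j)) = N.Sig (φ (b j))) (m : M.carrier) :
    φ (M.Sig m) = N.Sig (φ m) := by
  rw [← b.sum_repr m, sig_sum]
  simp only [map_sum, map_smul, h, N.Sig_smul]

variable [DecidableEq n]

theorem toLin_sig_basis {M N : DiffModule.{u} F σ} (b : Module.Basis n F M.carrier)
    (b' : Module.Basis n F N.carrier) (T : Matrix n n F) (j : n) :
    Matrix.toLin b b' T (M.Sig (b j)) = ∑ k, (T * sigMatrix b) k j • b' k := by
  simp only [sig_basis b j, map_sum, map_smul, Matrix.toLin_self, Finset.smul_sum, smul_smul]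
  rw [Finset.sum_comm]
  refine Finset.sum_congr rfl fun k _ => ?_
  rw [Matrix.mul_apply, Finset.sum_smul]
  exact Finset.sum_congr rfl fun i _ => by rw [mul_comm]

theorem sig_toLin_basis {M N : DiffModule.{u} F σ} (b : Module.Basis n F M.carrier)
    (b' : Module.Basis n F N.carrier) (T : Matrix n n F) (j : n) :
    N.Sig (Matrix.toLin b b' T (b j)) = ∑ k, (sigMatrix b' * T.map σ) k j • b' k := by
  simp only [Matrix.toLin_self, sig_sum, sig_basis b', Finset.smul_sum, smul_smul]
  rw [Finset.sum_comm]
  refine Finset.sum_congr rfl fun k _ => ?_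
  rw [Matrix.mul_apply, Finset.sum_smul]
  exact Finset.sum_congr rfl fun i _ => by rw [mul_comm, Matrix.map_apply]

theorem sigMatrix_mul_map {M N : DiffModule.{u} F σ} (b : Module.Basis n F M.carrier)
    (b' : Module.Basis n F N.carrier) (φ : M.carrier →ₗ[F] N.carrier)
    (h : ∀ m, φ (M.Sig m) = N.Sig (φ m)) :
    sigMatrix b' * (LinearMap.toMatrix b b' φ).map σ = LinearMap.toMatrix b b' φ * sigMatrix b := by
  ext k j
  have h1 := toLin_sig_basis b b' (LinearMap.toMatrix b b' φ) j
  have h2 := sig_toLin_basis b b' (LinearMap.toMatrix b b' φ) j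
  rw [Matrix.toLin_toMatrix] at h1 h2
  rw [h, h2] at h1
  have := congrArg (fun v => b'.repr v k) h1
  simpa [Finsupp.single_apply] using this

theorem exists_matrix_of_iso {M N : DiffModule.{u} F σ} (e : M ≅ N)
    (b : Module.Basis n F M.carrier) (b' : Module.Basis n F N.carrier) :
    ∃ T T' : Matrix n n F, T * T' = 1 ∧ sigMatrix b' * T.map σ = T * sigMatrix b := by
  refine ⟨_, LinearMap.toMatrix b' b (linearEquivOfIso e).symm.toLinearMap, ?_,
    sigMatrix_mul_map b b' (linearEquivOfIso e).toLinearMap (linearEquivOfIso_comm e)⟩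
  rw [← LinearMap.toMatrix_comp]
  simp

theorem nonempty_iso_of_matrix {M N : DiffModule.{u} F σ} (b : Module.Basis n F M.carrier)
    (b' : Module.Basis n F N.carrier) {T T' : Matrix n n F} (hT : T * T' = 1)
    (h : sigMatrix b' * T.map σ = T * sigMatrix b) : Nonempty (M ≅ N) :=
  ⟨isoOfLinearEquiv (Matrix.toLinOfInv b b' hT (mul_eq_one_comm.1 hT))
    (comm_of_basis b (Matrix.toLin b b' T) fun j => by
      rw [toLin_sig_basis, sig_toLin_basis, h])⟩

variable {G : Type} [Field G] [Algebra F G] {τ : G ≃+* G}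

/-- The basis of an extension of scalars. -/
def baseChangeBasis (h : ∀ f, τ (algebraMap F G f) = algebraMap F G (σ f)) {M : DiffModule.{u} F σ}
    (b : Module.Basis n F M.carrier) : Module.Basis n G (M.baseChange h).carrier :=
  b.baseChange G

omit [Fintype n] [DecidableEq n] in
theorem sigMatrix_baseChangeBasis (h : ∀ f, τ (algebraMap F G f) = algebraMap F G (σ f))
    {M : DiffModule.{u} F σ} (b : Module.Basis n F M.carrier) :
    sigMatrix (baseChangeBasis h b) = (sigMatrix b).map (algebraMap F G) := by
  ext i j
  have e : (M.baseChange h).Sig (baseChangeBasis h b j) = (1 : G) ⊗ₜ[F] M.Sig (b j) := by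
    have : (baseChangeBasis h b j : G ⊗[F] M.carrier) = (1 : G) ⊗ₜ[F] b j :=
      Module.Basis.baseChange_apply _ _ _
    rw [this]
    change τ 1 ⊗ₜ[F] M.Sig (b j) = _
    rw [map_one]
  change (b.baseChange G).repr ((M.baseChange h).Sig (baseChangeBasis h b j)) i = _
  rw [e, Module.Basis.baseChange_repr_tmul, Algebra.smul_def, mul_one]
  rfl

end DiffModule

/-- The basis of the formalization of a module. -/
def formalizationBasis {q : ℂˣ} {n : Type*} {M : Bq.{u} q}
    (b : Module.Basis n meroGerms M.carrier) :
    Module.Basis n (LaurentSeries ℂ) (formalization M).carrier :=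
  DiffModule.baseChangeBasis _ b

theorem sigMatrix_formalizationBasis {q : ℂˣ} {n : Type*} {M : Bq.{u} q}
    (b : Module.Basis n meroGerms M.carrier) :
    DiffModule.sigMatrix (formalizationBasis b) = (DiffModule.sigMatrix b).map meroGerms.subtype :=
  DiffModule.sigMatrix_baseChangeBasis _ b

/-! ## Condition `(D)` implies that formal isomorphisms converge -/

section ConditionD

variable {q : ℂˣ} (hq : ‖(q : ℂ)‖ = 1) (hroot : ∀ n : ℕ, 0 < n → q ^ n ≠ 1)

theorem qPoch_ne_zero {l : ℂ} (h : ∀ k : ℕ, (q : ℂ) ^ k * l ≠ 1) (n : ℕ) : qPoch l q n ≠ 0 :=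
  Finset.prod_ne_zero_iff.2 fun k _ => sub_ne_zero.2 (h k).symm

-- Each factor has modulus at most 1 + |l|. Unwanted Pochhammer symbols can therefore be multiplied
-- back in without losing convergence.
include hq in
theorem converges_qPoch (l : ℂ) : Converges (qPoch l q) :=
  converges_iff_bound.2 ⟨1, 1 + ‖l‖, zero_le_one, by positivity, fun n => by
    rw [qPoch, norm_prod, one_mul]
    refine (Finset.prod_le_prod (fun k _ => norm_nonneg _) (g := fun _ => 1 + ‖l‖) fun k _ => ?_).trans
      (by simp)
    refine (norm_sub_le _ _).trans ?_
    rw [norm_mul, norm_pow, hq, one_pow, one_mul, norm_one]⟩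

theorem mem_ratios_iff {S : Finset ℂˣ} {l : ℂˣ} :
    l ∈ ratios q S ↔ (∃ a ∈ S, ∃ b ∈ S, a * b⁻¹ = l) ∧ ∀ k : ℤ, k ≤ 0 → l ≠ q ^ k := by
  classical
  simp only [ratios, Finset.mem_filter, Finset.mem_image, Finset.mem_product, Prod.exists]
  refine and_congr_left fun _ => ⟨?_, ?_⟩
  · rintro ⟨a, b, ⟨ha, hb⟩, h⟩
    exact ⟨a, ha, b, hb, h⟩
  · rintro ⟨a, ha, b, hb, h⟩
    exact ⟨a, b, ⟨ha, hb⟩, h⟩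

theorem pow_mul_ne_one_of_mem_ratios {S : Finset ℂˣ} {l : ℂˣ} (hl : l ∈ ratios q S) (k : ℕ) :
    (q : ℂ) ^ k * l ≠ 1 := fun h =>
  (mem_ratios_iff.1 hl).2 (-k) (by simp) (by
    have : q ^ k * l = 1 := Units.ext (by simpa using h)
    rw [zpow_neg, zpow_natCast]
    exact eq_inv_of_mul_eq_one_right this)

-- Multiplying the coefficients of φ by the remaining, nonvanishing Pochhammer symbols isolates a
-- single ratio, at geometric cost.
include hq in
theorem converges_inv_qPoch_of_mem_ratios {S : Finset ℂˣ} (h : Converges (phiCoeff q (ratios q S)))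
    {l : ℂˣ} (hl : l ∈ ratios q S) : Converges fun n => (qPoch l q n)⁻¹ := by
  classical
  have h' := h.mul_apply (converges_multiset_prod ((ratios q S).erase l).val
    (c := fun l n => qPoch l q n) fun l _ => converges_qPoch hq l)
  convert h' using 2 with n
  rw [phiCoeff, ← Finset.mul_prod_erase _ _ hl, mul_inv, mul_assoc]
  change _ = _ * (_ * ∏ x ∈ (ratios q S).erase l, qPoch x q n)
  rw [inv_mul_cancel₀, mul_one]
  exact Finset.prod_ne_zero_iff.2 fun m hm =>
    qPoch_ne_zero (pow_mul_ne_one_of_mem_ratios (Finset.mem_of_mem_erase hm)) n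

theorem converges_inv_prod_sub {z α : ℂ} (hα : α ≠ 0)
    (h : Converges fun n => (qPoch ((q : ℂ) * (z / α)) q n)⁻¹) :
    Converges fun n => (∏ k ∈ Finset.range n, (α - (q : ℂ) ^ (k + 1) * z))⁻¹ := by
  convert h.mul_apply (converges_pow α⁻¹) using 2 with n
  rw [inv_pow, ← mul_inv, qPoch, ← Finset.card_range n, ← Finset.prod_const, Finset.card_range,
    ← Finset.prod_mul_distrib]
  refine congrArg _ (Finset.prod_congr rfl fun k _ => ?_)
  field_simp
  ring

theorem qPoch_succ' (l : ℂ) (n : ℕ) : qPoch l q (n + 1) = (1 - l) * qPoch (q * l) q n := by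
  rw [qPoch, Finset.prod_range_succ', pow_zero, one_mul, mul_comm, qPoch]
  simp only [pow_succ, mul_assoc]

-- The relevant symbol is (qz/α; q)_n. For z = α the ratio 1 is absent from `ratios`, and the
-- convergence of Σ x^n/(q;q)_n takes over. For distinct classes l = z/α is an admissible ratio, and
-- (l;q)_(n+1) = (1 - l)(ql;q)_n.
include hroot hq in
theorem smallDivisors_of_conditionD (hconv : Converges fun n => (qPoch q q n)⁻¹)
    {V : GrNil.{u} q} (hV : ConditionD q V) {c d : CModQ q} (hc : V.comp c ≠ ⊥)
    (hd : V.comp d ≠ ⊥) : SmallDivisors q (rep q c) (rep q d) := by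
  classical
  refine ⟨fun k h => zpow_mul_rep_ne_rep hroot (n := k + 1) (by omega) c d (by exact_mod_cast h),
    converges_inv_prod_sub (rep q d).ne_zero ?_⟩
  rcases eq_or_ne c d with rfl | hcd
  · rw [div_self (rep q c).ne_zero, mul_one]
    exact hconv
  have hinj : Function.Injective (rep q) := fun a b h => rep_val_injective q (congrArg Units.val h)
  -- Condition (D) is used only for the representatives chosen by `rep`.
  set S : Finset ℂˣ := V.finite_comp_ne_bot.toFinset.image (rep q) with hS
  have hmemS : ∀ a, V.comp a ≠ ⊥ → rep q a ∈ S := fun a ha =>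
    Finset.mem_image_of_mem _ ((Set.Finite.mem_toFinset _).2 ha)
  have hbij : Set.BijOn (fun l : ℂˣ => (l : CModQ q)) S {c | V.comp c ≠ ⊥} := by
    refine ⟨?_, ?_, fun a ha => ⟨rep q a, hmemS a ha, coe_rep q a⟩⟩
    · intro l hl
      obtain ⟨a, ha, rfl⟩ := Finset.mem_image.1 hl
      simpa [coe_rep] using ha
    · intro l hl m hm h
      obtain ⟨a, ha, rfl⟩ := Finset.mem_image.1 hl
      obtain ⟨b, hb, rfl⟩ := Finset.mem_image.1 hm
      simp only [coe_rep] at h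
      rw [h]
  have hl : rep q c * (rep q d)⁻¹ ∈ ratios q S := by
    refine mem_ratios_iff.2 ⟨⟨_, hmemS c hc, _, hmemS d hd, rfl⟩, fun k _ h => hcd ?_⟩
    rw [← coe_rep q c, ← coe_rep q d, eq_comm]
    exact coe_eq_coe_iff.2 ⟨k, mul_inv_eq_iff_eq_mul.1 h⟩
  have h := converges_succ.2 (converges_inv_qPoch_of_mem_ratios hq (hV S hbij) hl)
  have hl1 : (1 : ℂ) - (rep q c * (rep q d)⁻¹ : ℂˣ) ≠ 0 := fun h0 => by
    refine pow_mul_ne_one_of_mem_ratios hl 0 ?_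
    rw [pow_zero, one_mul]
    exact (sub_eq_zero.1 h0).symm
  convert converges_const_mul h (1 - (rep q c * (rep q d)⁻¹ : ℂˣ)) using 2 with n
  rw [qPoch_succ', mul_inv, mul_inv_cancel_left₀ hl1, Units.val_mul, Units.val_inv_eq_inv_val,
    div_eq_mul_inv]

-- In bases, a formal isomorphism is a formal gauge to a constant system whose eigenvalues are
-- representatives of nonzero components. It converges by the small divisor estimates and is then an
-- analytic isomorphism.
include hroot hq in
theorem inIso_of_conditionD (hconv : Converges fun n => (qPoch q q n)⁻¹)
    {V : GrNil.{u} q} (hV : ConditionD q V) : InIso q (analyticModule q V.twistEquiv) := by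
  classical
  rintro N ⟨e⟩
  set g := DiffModule.linearEquivOfIso e.symm with hg
  have hfr : Module.finrank ℂ V.carrier = Module.finrank meroGerms N.carrier := by
    have h1 := g.finrank_eq
    have h2 : Module.finrank (LaurentSeries ℂ) (formalization N).carrier =
      Module.finrank meroGerms N.carrier := Module.finrank_baseChange
    have h3 : Module.finrank (LaurentSeries ℂ) (formalization (analyticModule q V.twistEquiv)).carrier =
      Module.finrank meroGerms (meroGerms ⊗[ℂ] V.carrier) := Module.finrank_baseChange
    have h4 : Module.finrank meroGerms (meroGerms ⊗[ℂ] V.carrier) =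
      Module.finrank ℂ V.carrier := Module.finrank_baseChange
    rw [← h4, ← h3, h1, h2]
  let v : Module.Basis (Fin (Module.finrank meroGerms N.carrier)) ℂ
    (DiffModule.ofAut V.carrier V.twistEquiv).carrier := Module.finBasisOfFinrankEq _ _ hfr
  let b := Module.finBasis meroGerms N.carrier
  let vK := DiffModule.baseChangeBasis (τ := sigma q) (sigma_algebraMap q) v
  let vhat := formalizationBasis vK
  let bhat := formalizationBasis b
  obtain ⟨F, G, hFG, h⟩ := DiffModule.exists_matrix_of_iso e.symm vhat bhat
  have hv : (DiffModule.sigMatrix v) = LinearMap.toMatrix v v V.twist := by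
    ext i j
    rw [LinearMap.toMatrix_apply]
    rfl
  set A := LinearMap.toMatrix v v V.twist with hA
  have hvK : DiffModule.sigMatrix vK = A.map (algebraMap ℂ meroGerms) :=
    (DiffModule.sigMatrix_baseChangeBasis _ v).trans (by rw [hv])
  have hvhat : DiffModule.sigMatrix vhat = A.map (algebraMap ℂ (LaurentSeries ℂ)) :=
    (sigMatrix_formalizationBasis vK).trans (by rw [hvK]; rfl)
  have hbhat : DiffModule.sigMatrix bhat = (DiffModule.sigMatrix b).map meroGerms.subtype :=
    sigMatrix_formalizationBasis b
  rw [hbhat, hvhat] at h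
  have hroots : ∀ z ∈ A.charpoly.roots, ∃ c, V.comp c ≠ ⊥ ∧ z = rep q c := fun z hz => by
    refine V.exists_rep_eq_of_hasEigenvalue ?_
    rw [hA, LinearMap.charpoly_toMatrix] at hz
    exact Module.End.hasEigenvalue_iff_isRoot_charpoly _ _ |>.2 (Polynomial.isRoot_of_mem_roots hz)
  have hmem := mem_meroGerms_of_formal_equivalence hq (A := A) (B := DiffModule.sigMatrix b)
    (F := F) (fun z hz α hα => by
      obtain ⟨c, hc, rfl⟩ := hroots z hz
      obtain ⟨d, hd, rfl⟩ := hroots α hα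
      exact smallDivisors_of_conditionD hq hroot hconv hV hc hd) hFG h
  set FK : Matrix _ _ meroGerms := Matrix.of fun i j => ⟨F i j, hmem i j⟩ with hFK
  have hFKF : FK.map meroGerms.subtype = F := rfl
  -- Invertibility descends from Laurent series to K because the determinant is the same element.
  have hdet : FK.det ≠ 0 := fun h0 => by
    have h1 : F.det = 0 := by
      rw [← hFKF, ← RingHom.mapMatrix_apply, ← RingHom.map_det, h0, map_zero]
    have h2 := congrArg Matrix.det hFG
    rw [Matrix.det_mul, h1, zero_mul, Matrix.det_one] at h2
    exact zero_ne_one h2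
  obtain ⟨i⟩ := DiffModule.nonempty_iso_of_matrix vK b (Matrix.mul_nonsing_inv FK hdet.isUnit) (by
    refine Matrix.map_injective (f := meroGerms.subtype) Subtype.val_injective ?_
    change (DiffModule.sigMatrix b * FK.map (sigma q)).map meroGerms.subtype =
      (FK * DiffModule.sigMatrix vK).map meroGerms.subtype
    rw [Matrix.map_mul, Matrix.map_mul, hvK]
    exact h)
  exact ⟨i.symm⟩

end ConditionD

/-! ## Single small divisors control products of small divisors -/

section SingleDivisor

variable {q : ℂˣ}

theorem qPoch_succ (l : ℂ) (n : ℕ) : qPoch l q (n + 1) = qPoch l q n * (1 - (q : ℂ) ^ n * l) :=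
  Finset.prod_range_succ _ _

theorem Converges.rescale (hq : ‖(q : ℂ)‖ = 1) {f : PowerSeries ℂ}
    (hf : Converges fun n => PowerSeries.coeff n f) :
    Converges fun n => PowerSeries.coeff n (PowerSeries.rescale (q : ℂ) f) := by
  obtain ⟨r, hr, hs⟩ := hf
  exact ⟨r, hr, by simpa [PowerSeries.coeff_rescale, hq] using hs⟩

/-- The series y = Σ x^n/(qm;q)_n solves (1 - x)y = m y(qx) + 1 - m, and e = Σ x^n/(q;q)_n solves (1
- x)e = e(qx). Hence y = eψ with ψ = m ψ(qx) + (1 - m)/e(qx). This equation is diagonal in the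
coefficients and divides each only once, by 1 - q^n m: the products of divisors are absorbed by e.
-/
theorem converges_inv_qPoch_of_converges_inv (hq : ‖(q : ℂ)‖ = 1)
    (hroot : ∀ n : ℕ, 0 < n → q ^ n ≠ 1) (hconv : Converges fun n => (qPoch q q n)⁻¹) {m : ℂ}
    (hm : ∀ n : ℕ, (q : ℂ) ^ n * m ≠ 1) (h : Converges fun n => (1 - (q : ℂ) ^ n * m)⁻¹) :
    Converges fun n => (qPoch (q * m) q n)⁻¹ := by
  have hqn : ∀ n : ℕ, 1 - (q : ℂ) ^ n * q ≠ 0 := fun n h0 => by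
    refine hroot (n + 1) n.succ_pos (Units.ext ?_)
    rw [Units.val_pow_eq_pow_val, pow_succ, Units.val_one]
    exact (sub_eq_zero.1 h0).symm
  have hmn : ∀ n : ℕ, 1 - (q : ℂ) ^ n * m ≠ 0 := fun n => sub_ne_zero.2 (hm n).symm
  set e : PowerSeries ℂ := PowerSeries.mk fun n => (qPoch q q n)⁻¹ with he
  have heconv : Converges fun n => PowerSeries.coeff n e := by simpa [he] using hconv
  have he1 : (1 - PowerSeries.X) * e = PowerSeries.rescale (q : ℂ) e := by
    ext n
    rw [sub_mul, one_mul, map_sub, PowerSeries.coeff_rescale]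
    rcases n with _ | n
    · simp
    · rw [PowerSeries.coeff_succ_X_mul, he, PowerSeries.coeff_mk, PowerSeries.coeff_mk, qPoch_succ,
        mul_inv, pow_succ]
      have := hqn n
      field_simp
      ring
  have hσe : PowerSeries.constantCoeff (PowerSeries.rescale (q : ℂ) e) ≠ 0 := by
    rw [← PowerSeries.coeff_zero_eq_constantCoeff_apply, PowerSeries.coeff_rescale, he]
    simp [qPoch]
  set w : PowerSeries ℂ := (PowerSeries.rescale (q : ℂ) e)⁻¹ with hw
  have hwconv : Converges fun n => PowerSeries.coeff n w := (heconv.rescale hq).inv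
  set ψ : PowerSeries ℂ := PowerSeries.mk fun n =>
    (1 - m) * (PowerSeries.coeff n w * (1 - (q : ℂ) ^ n * m)⁻¹) with hψ
  have hψconv : Converges fun n => PowerSeries.coeff n ψ := by
    simpa [hψ] using converges_const_mul (hwconv.mul_apply h) (1 - m)
  have hψeq : ψ = PowerSeries.C m * PowerSeries.rescale (q : ℂ) ψ + PowerSeries.C (1 - m) * w := by
    ext n
    rw [map_add, PowerSeries.coeff_C_mul, PowerSeries.coeff_C_mul, PowerSeries.coeff_rescale, hψ,
      PowerSeries.coeff_mk]
    linear_combination (1 - m) * PowerSeries.coeff n w * inv_mul_cancel₀ (hmn n)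
  set y := e * ψ with hy
  have hyeq : (1 - PowerSeries.X) * y =
      PowerSeries.C m * PowerSeries.rescale (q : ℂ) y + PowerSeries.C (1 - m) := by
    rw [hy, ← mul_assoc, he1, map_mul]
    conv_lhs => rw [hψeq]
    rw [mul_add, mul_left_comm _ (PowerSeries.C (1 - m)), hw, PowerSeries.mul_inv_cancel _ hσe,
      mul_one]
    ring
  -- The functional equation determines y, since its x^n-coefficient has leading factor 1 - q^n m ≠
  -- 0.
  have hcoeff : ∀ n, PowerSeries.coeff n y = (qPoch (q * m) q n)⁻¹ := by
    intro n
    have hn := congrArg (PowerSeries.coeff n) hyeq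
    rw [sub_mul, one_mul, map_sub, map_add, PowerSeries.coeff_C_mul, PowerSeries.coeff_rescale]
      at hn
    induction n with
    | zero =>
      have h0 := hmn 0
      simp only [PowerSeries.coeff_zero_X_mul, PowerSeries.coeff_zero_C, pow_zero, one_mul,
        sub_zero] at hn h0
      rw [qPoch, Finset.prod_range_zero, inv_one]
      exact mul_left_cancel₀ h0 (by linear_combination hn)
    | succ n ih =>
      rw [PowerSeries.coeff_succ_X_mul, ih ?_, PowerSeries.coeff_C, if_neg n.succ_ne_zero] at hn
      · rw [qPoch_succ, mul_inv]
        have h1 := hmn (n + 1)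
        rw [pow_succ, mul_assoc] at h1
        rw [← div_eq_mul_inv, eq_div_iff h1]
        linear_combination hn
      · have := congrArg (PowerSeries.coeff n) hyeq
        rwa [sub_mul, one_mul, map_sub, map_add, PowerSeries.coeff_C_mul,
          PowerSeries.coeff_rescale] at this
  simpa only [← hy, hcoeff] using heconv.mul hψconv

end SingleDivisor

/-! ## Formal isomorphisms that diverge -/

section Diverge

variable {q : ℂˣ} (hroot : ∀ n : ℕ, 0 < n → q ^ n ≠ 1)

theorem GrNil.hasEigenvalue_twist {V : GrNil.{u} q} {c : CModQ q} (hc : V.comp c ≠ ⊥) :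
    V.twist.HasEigenvalue (rep q c) := by
  by_contra h
  refine hc ((Submodule.eq_bot_iff _).2 fun v hv => ?_)
  rw [V.comp_eq_maxGenEigenspace, Module.End.mem_maxGenEigenspace] at hv
  obtain ⟨k, hk⟩ := hv
  exact eq_zero_of_pow_sub_apply_eq_zero h hk

/-- Take E = ξ(·)v with v an eigenvector for z and ξ a left eigenvector for w, found as a functional
killing the range of A - w. Since z ≠ w, ξ(v) = 0, so E² = 0. -/
theorem exists_rank_one_intertwiner {V : Type*} [AddCommGroup V] [Module ℂ V]
    [FiniteDimensional ℂ V] {A : Module.End ℂ V} {z w : ℂ} (hzw : z ≠ w) (hz : A.HasEigenvalue z)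
    (hw : A.HasEigenvalue w) : ∃ E : Module.End ℂ V, E ≠ 0 ∧ E * E = 0 ∧ A * E = z • E ∧
      E * A = w • E := by
  obtain ⟨v, hv⟩ := hz.exists_hasEigenvector
  have hlt : LinearMap.range (A - w • (1 : Module.End ℂ V)) < ⊤ := by
    rw [lt_top_iff_ne_top]
    intro h
    have hinj := LinearMap.injective_iff_surjective.2 (LinearMap.range_eq_top.1 h)
    obtain ⟨u, hu⟩ := hw.exists_hasEigenvector
    refine hu.2 (hinj ?_)
    rw [map_zero, LinearMap.sub_apply, hu.apply_eq_smul]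
    simp
  obtain ⟨ξ, hξ0, hξ⟩ := Submodule.exists_le_ker_of_lt_top _ hlt
  have hξA : ∀ x, ξ (A x) = w * ξ x := fun x => by
    have h0 : ξ ((A - w • (1 : Module.End ℂ V)) x) = 0 := hξ ⟨x, rfl⟩
    rw [LinearMap.sub_apply, map_sub, sub_eq_zero] at h0
    simpa using h0
  have hξv : ξ v = 0 := by
    have h0 := hξA v
    rw [hv.apply_eq_smul, map_smul, smul_eq_mul] at h0
    exact (mul_eq_mul_right_iff.1 h0).resolve_left hzw
  refine ⟨ξ.smulRight v, fun h0 => ?_, ?_, ?_, ?_⟩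
  · refine hξ0 (LinearMap.ext fun x => ?_)
    have := congrArg (fun f : Module.End ℂ V => f x) h0
    simpa [hv.2] using this
  · ext x
    simp [hξv]
  · ext x
    simp [hv.apply_eq_smul, smul_smul, mul_comm]
  · ext x
    simp [hξA, smul_smul]

theorem coeff_algebraMap_mul (c : ℂ) (f : LaurentSeries ℂ) (n : ℤ) :
    (algebraMap ℂ (LaurentSeries ℂ) c * f).coeff n = c * f.coeff n := by
  rw [← Algebra.smul_def]
  rfl

-- The matrix form of rigidity: every coefficient of nonzero degree of an endomorphism of the
-- constant formal system vanishes by nonresonance.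
include hroot in
theorem exists_const_of_intertwines {V : GrNil.{u} q} {n : Type*} [Fintype n] [DecidableEq n]
    (v : Module.Basis n ℂ V.carrier) {θ : Matrix n n (LaurentSeries ℂ)}
    (h : (LinearMap.toMatrix v v V.twist).map (algebraMap ℂ (LaurentSeries ℂ)) *
      θ.map (sigmaHat q) =
      θ * (LinearMap.toMatrix v v V.twist).map (algebraMap ℂ (LaurentSeries ℂ))) :
    ∃ Θ : Matrix n n ℂ, θ = Θ.map (algebraMap ℂ (LaurentSeries ℂ)) := by
  set A := LinearMap.toMatrix v v V.twist with hA
  have hk : ∀ k : ℤ, k ≠ 0 → θ.map (fun f => f.coeff k) = 0 := fun k hk => by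
    have e : θ.map (fun f => f.coeff k) * A = (q : ℂ) ^ k • (A * θ.map (fun f => f.coeff k)) := by
      ext i j
      have := congrArg (fun f : LaurentSeries ℂ => f.coeff k) (congrFun (congrFun h i) j)
      simp only [Matrix.mul_apply, HahnSeries.coeff_sum, Matrix.map_apply] at this
      simp only [Matrix.smul_apply, Matrix.mul_apply, Matrix.map_apply, smul_eq_mul, Finset.mul_sum]
      simp only [coeff_algebraMap_mul, mul_comm _ (algebraMap ℂ (LaurentSeries ℂ) _),
        sigmaHat_coeff] at this
      rw [Finset.sum_congr rfl fun x _ => mul_comm _ _, ← this]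
      exact Finset.sum_congr rfl fun x _ => by ring
    have h0 := eq_zero_of_intertwines hroot V V hk
      (T := Matrix.toLin v v (θ.map fun f => f.coeff k)) fun x => by
        have e' := congrArg (fun M => Matrix.toLin v v M x) e
        simp only [Matrix.toLin_mul v v v, map_smul, hA, Matrix.toLin_toMatrix] at e'
        exact e'
    simpa using h0
  refine ⟨θ.map fun f => f.coeff 0, ?_⟩
  ext i j k
  rw [Matrix.map_apply, Matrix.map_apply, coeff_algebraMap]
  split_ifs with h0
  · rw [h0]
  · exact congrFun (congrFun (hk k h0) i) j

/-! ### Rank-one perturbations of a constant system -/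

/-- The operator `Σ ∘ u` for an automorphism `u`. -/
abbrev DiffModule.precomp {F : Type} [Field F] {σ : F ≃+* F} (M : DiffModule.{u} F σ)
    (e : M.carrier ≃ₗ[F] M.carrier) : DiffModule.{u} F σ where
  carrier := M.carrier
  Sig := e.toAddEquiv.trans M.Sig
  Sig_smul f m := by
    change M.Sig (e (f • m)) = σ f • M.Sig (e m)
    rw [map_smul, M.Sig_smul]

theorem DiffModule.sigMatrix_precomp {F : Type} [Field F] {σ : F ≃+* F} {n : Type*} [Fintype n]
    [DecidableEq n] (M : DiffModule.{u} F σ) (b : Module.Basis n F M.carrier) {T T' : Matrix n n F}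
    (hT : T * T' = 1) :
    DiffModule.sigMatrix (M := M.precomp (Matrix.toLinOfInv b b hT (mul_eq_one_comm.1 hT))) b =
      DiffModule.sigMatrix b * T.map σ := by
  ext i j
  change b.repr (M.Sig (Matrix.toLin b b T (b j))) i = _
  rw [DiffModule.sig_toLin_basis]
  simp [Finsupp.single_apply]

/-- The sum of the geometric series. -/
def geomGerm : meroGerms :=
  ⟨toLaurent (PowerSeries.mk fun _ => 1), toLaurent_mem_meroGerms_iff.2 (by simpa using converges_one)⟩

theorem one_add_smul_mul_one_sub_smul {R n : Type*} [CommRing R] [Fintype n] [DecidableEq n]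
    {E : Matrix n n R} (hE : E * E = 0) (a : R) : (1 + a • E) * (1 - a • E) = 1 := by
  rw [add_mul, one_mul, mul_sub, mul_one, smul_mul_smul_comm, hE, smul_zero]
  abel

/-- Because E² = 0 and E is an eigenvector for both multiplications by A, the matrix gauge equation
collapses to the scalar equation za = zb + wh. -/
theorem mul_one_add_smul_of_rank_one {R n : Type*} [CommRing R] [Fintype n] [DecidableEq n]
    {A E : Matrix n n R} {z w a b h : R} (hEE : E * E = 0) (hAE : A * E = z • E)
    (hEA : E * A = w • E) (hz : z * a = z * b + w * h) :
    A * (1 + a • E) = (1 + h • E) * (A * (1 + b • E)) := by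
  have e : a • z • E = b • z • E + h • w • E := by
    rw [smul_smul, smul_smul, smul_smul, ← add_smul]
    congr 1
    linear_combination hz
  simp only [mul_add, add_mul, one_mul, mul_one, Matrix.mul_smul, Matrix.smul_mul, hAE,
    hEA, hEE, smul_zero, add_zero, e]
  abel

theorem map_one_add_smul {R S n : Type*} [CommRing R] [CommRing S] [Fintype n] [DecidableEq n]
    (f : R →+* S) (a : R) (E : Matrix n n R) :
    (1 + a • E).map f = 1 + f a • E.map f := by
  ext i j
  simp [Matrix.one_apply, apply_ite f]

-- The system A(1 + σ_q(g)E), with g the geometric series, is formally gauge equivalent to A by 1 +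
-- fE. Membership in B_q^iso provides an analytic equivalence, which differs from the formal one by
-- an endomorphism of the constant system, hence by a constant matrix. So f converges, and its
-- coefficients carry the small divisors.
include hroot in
theorem converges_inv_of_inIso {V : GrNil.{u} q} (hV : InIso q (analyticModule q V.twistEquiv))
    {c d : CModQ q} (hcd : c ≠ d) (hc : V.comp c ≠ ⊥) (hd : V.comp d ≠ ⊥) :
    Converges fun n => (1 - (q : ℂ) ^ n * ((rep q c : ℂ) / rep q d))⁻¹ := by
  classical
  obtain ⟨E₀, hE0, hEE, hAE, hEA⟩ := exists_rank_one_intertwiner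
    (z := (rep q c : ℂ)) (w := (rep q d : ℂ)) (fun h => hcd (rep_val_injective q h)) (GrNil.hasEigenvalue_twist hc)
    (GrNil.hasEigenvalue_twist hd)
  have hzw : ∀ n : ℕ, (rep q c : ℂ) * (q : ℂ) ^ n - rep q d ≠ 0 := fun n h => by
    rcases Nat.eq_zero_or_pos n with rfl | hn
    · rw [pow_zero, mul_one] at h
      exact hcd (rep_val_injective q (sub_eq_zero.1 h))
    · refine zpow_mul_rep_ne_rep hroot (n := n) (by omega) c d ?_
      rw [zpow_natCast, mul_comm]
      exact sub_eq_zero.1 h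
  have hw0 : (rep q d : ℂ) ≠ 0 := (rep q d).ne_zero
  generalize (rep q c : ℂ) = z at *
  generalize (rep q d : ℂ) = w at *
  let v : Module.Basis (Fin (Module.finrank ℂ V.carrier)) ℂ
    (DiffModule.ofAut V.carrier V.twistEquiv).carrier := Module.finBasis ℂ V.carrier
  set A := LinearMap.toMatrix v v V.twist with hA
  set E := LinearMap.toMatrix v v E₀ with hE
  have hEne : E ≠ 0 := fun h => hE0 ((LinearMap.toMatrix v v).map_eq_zero_iff.1 h)
  have hEE' : E * E = 0 := by
    rw [hE, ← LinearMap.toMatrix_mul, hEE, map_zero]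
  have hAE' : A * E = z • E := by
    rw [hA, hE, ← LinearMap.toMatrix_mul, hAE, map_smul]
  have hEA' : E * A = w • E := by
    rw [hA, hE, ← LinearMap.toMatrix_mul, hEA, map_smul]
  have hv : DiffModule.sigMatrix v = A := by
    ext i j
    rw [hA, LinearMap.toMatrix_apply]
    rfl
  let vK := DiffModule.baseChangeBasis (τ := sigma q) (sigma_algebraMap q) v
  have hvK : DiffModule.sigMatrix vK = A.map (algebraMap ℂ meroGerms) :=
    (DiffModule.sigMatrix_baseChangeBasis _ v).trans (by rw [hv])
  have hmapEE : ∀ {R : Type} [CommRing R] (f : ℂ →+* R), E.map f * E.map f = 0 := fun f => by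
    rw [← Matrix.map_mul, hEE', Matrix.map_zero _ (map_zero f)]
  set EK := E.map (algebraMap ℂ meroGerms) with hEK
  set Eh := E.map (algebraMap ℂ (LaurentSeries ℂ)) with hEh
  set Ah := A.map (algebraMap ℂ (LaurentSeries ℂ)) with hAh
  have hU : (1 + geomGerm • EK) * (1 - geomGerm • EK) = 1 :=
    one_add_smul_mul_one_sub_smul (hmapEE _) _
  let N : Bq.{u} q := (analyticModule q V.twistEquiv).precomp
    (Matrix.toLinOfInv vK vK hU (mul_eq_one_comm.1 hU))
  let b : Module.Basis _ meroGerms N.carrier := vK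
  have hb : DiffModule.sigMatrix b =
      A.map (algebraMap ℂ meroGerms) * (1 + geomGerm • EK).map (sigma q) :=
    (DiffModule.sigMatrix_precomp (analyticModule q V.twistEquiv) vK hU).trans (by rw [hvK])
  -- The unique power series solution of z f(qx) = z g(qx) + w f, where every coefficient of g is 1.
  set f : LaurentSeries ℂ :=
    toLaurent (PowerSeries.mk fun n => z * (q : ℂ) ^ n * (z * (q : ℂ) ^ n - w)⁻¹) with hf
  have hT : (1 + f • Eh) * (1 - f • Eh) = 1 := one_add_smul_mul_one_sub_smul (hmapEE _) _
  have hsE : Eh.map (sigmaHat q) = Eh := by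
    ext1 i j
    exact sigmaHat_algebraMap q _
  have hfeq : algebraMap ℂ (LaurentSeries ℂ) z * sigmaHat q f =
      algebraMap ℂ (LaurentSeries ℂ) z * sigmaHat q geomGerm +
        algebraMap ℂ (LaurentSeries ℂ) w * f := by
    ext k
    rw [HahnSeries.coeff_add, coeff_algebraMap_mul, coeff_algebraMap_mul, coeff_algebraMap_mul,
      sigmaHat_coeff, sigmaHat_coeff]
    change _ = z * (_ * (toLaurent (PowerSeries.mk fun _ => 1)).coeff k) + _
    rcases lt_or_ge k 0 with hk | hk
    · rw [hf, toLaurent_coeff_of_neg _ hk, toLaurent_coeff_of_neg _ hk]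
      ring
    · lift k to ℕ using hk
      rw [hf, toLaurent_coeff_natCast, toLaurent_coeff_natCast, PowerSeries.coeff_mk,
        PowerSeries.coeff_mk, zpow_natCast]
      linear_combination z * (q : ℂ) ^ k * mul_inv_cancel₀ (hzw k)
  have hThat : Ah * (1 + f • Eh).map (sigmaHat q) =
      (1 + f • Eh) * (DiffModule.sigMatrix b).map meroGerms.subtype := by
    rw [hb, Matrix.map_mul]
    have e1 : ((1 + geomGerm • EK).map (sigma q)).map meroGerms.subtype =
        1 + sigmaHat q geomGerm • Eh := by
      rw [← hsE]
      exact (congrArg (fun M => Matrix.map M meroGerms.subtype)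
        (map_one_add_smul (sigma q).toRingHom _ _)).trans (map_one_add_smul _ _ _)
    have e2 : (1 + f • Eh).map (sigmaHat q) = 1 + sigmaHat q f • Eh :=
      (map_one_add_smul (sigmaHat q).toRingHom _ _).trans (congrArg (fun M => 1 + _ • M) hsE)
    rw [e1, e2]
    refine mul_one_add_smul_of_rank_one (z := algebraMap ℂ (LaurentSeries ℂ) z)
      (w := algebraMap ℂ (LaurentSeries ℂ) w) (hmapEE _) ?_ ?_ hfeq
    · change Ah * Eh = _
      rw [hAh, hEh, ← Matrix.map_mul, hAE']
      ext1 i j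
      exact map_mul (algebraMap ℂ (LaurentSeries ℂ)) _ _
    · change Eh * Ah = _
      rw [hAh, hEh, ← Matrix.map_mul, hEA']
      ext1 i j
      exact map_mul (algebraMap ℂ (LaurentSeries ℂ)) _ _
  have hNM : Nonempty (formalization N ≅ formalization (analyticModule q V.twistEquiv)) := by
    refine DiffModule.nonempty_iso_of_matrix (formalizationBasis b) (formalizationBasis vK) hT ?_
    rw [sigMatrix_formalizationBasis, sigMatrix_formalizationBasis, hvK]
    exact hThat
  obtain ⟨e⟩ := hV N hNM
  obtain ⟨T₀, T₁, hT₀, hTN⟩ := DiffModule.exists_matrix_of_iso e b vK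
  rw [hvK] at hTN
  have hTN' : DiffModule.sigMatrix b * T₁.map (sigma q) = T₁ * A.map (algebraMap ℂ meroGerms) := by
    have h1 : T₁ * T₀ = 1 := mul_eq_one_comm.1 hT₀
    have h2 : T₀.map (sigma q) * T₁.map (sigma q) = 1 := by
      rw [← Matrix.map_mul (f := sigma q), hT₀, Matrix.map_one _ (map_zero _) (map_one _)]
    calc _ = T₁ * (T₀ * DiffModule.sigMatrix b) * T₁.map (sigma q) := by
          rw [← mul_assoc T₁, h1, one_mul]
      _ = _ := by rw [← hTN, mul_assoc, mul_assoc, h2, mul_one]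
  -- The formal gauge followed by the inverse of the analytic one is an endomorphism of the constant
  -- system, so rigidity applies.
  have hθ : Ah * ((1 + f • Eh) * T₁.map meroGerms.subtype).map (sigmaHat q) =
      ((1 + f • Eh) * T₁.map meroGerms.subtype) * Ah := by
    have e1 : (T₁.map meroGerms.subtype).map (sigmaHat q) =
      (T₁.map (sigma q)).map meroGerms.subtype := rfl
    have e2 : (A.map (algebraMap ℂ meroGerms)).map meroGerms.subtype = Ah := rfl
    rw [Matrix.map_mul (f := sigmaHat q), e1, ← mul_assoc, hThat, mul_assoc, mul_assoc,
      ← Matrix.map_mul, hTN', Matrix.map_mul, e2]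
  obtain ⟨Θ, hΘ⟩ := exists_const_of_intertwines hroot v hθ
  have hmem : ∀ i j, (1 + f • Eh) i j ∈ meroGerms := fun i j => by
    have e1 : (1 + f • Eh) =
        (Θ.map (algebraMap ℂ meroGerms) * T₀).map meroGerms.subtype := by
      have e2 : (Θ.map (algebraMap ℂ meroGerms)).map meroGerms.subtype =
        Θ.map (algebraMap ℂ (LaurentSeries ℂ)) := rfl
      rw [Matrix.map_mul, e2, ← hΘ, mul_assoc, ← Matrix.map_mul, mul_eq_one_comm.1 hT₀,
        Matrix.map_one _ (map_zero _) (map_one _), mul_one]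
    rw [e1]
    exact Subtype.prop ((Θ.map (algebraMap ℂ meroGerms) * T₀) i j)
  obtain ⟨i, j, hij⟩ : ∃ i j, E i j ≠ 0 := by
    by_contra! h
    exact hEne (Matrix.ext h)
  have hfK : f ∈ meroGerms := by
    have h1 : f * algebraMap ℂ (LaurentSeries ℂ) (E i j) ∈ meroGerms := by
      have h2 : (1 : Matrix _ _ (LaurentSeries ℂ)) i j ∈ meroGerms := by
        rw [Matrix.one_apply]
        split_ifs
        exacts [one_mem _, zero_mem _]
      have h3 := sub_mem (hmem i j) h2
      rwa [Matrix.add_apply, add_sub_cancel_left] at h3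
    have h2 : algebraMap ℂ (LaurentSeries ℂ) (E i j)⁻¹ ∈ meroGerms :=
      (algebraMap ℂ meroGerms (E i j)⁻¹).2
    have h3 := mul_mem h1 h2
    rwa [mul_assoc, ← map_mul, mul_inv_cancel₀ hij, map_one, mul_one] at h3
  rw [hf, toLaurent_mem_meroGerms_iff] at hfK
  -- Here 1/(1 - q^n z/w) = 1 - z q^n/(z q^n - w).
  convert converges_one.add (converges_const_mul hfK (-1)) using 2 with n
  rw [PowerSeries.coeff_mk]
  have h1 := hzw n
  have h2 : w - q ^ n * z ≠ 0 := fun h => h1 (by linear_combination -h)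
  have h3 : 1 - (q : ℂ) ^ n * (z / w) = (w - q ^ n * z) / w := by field_simp
  have h4 : (z * (q : ℂ) ^ n - w)⁻¹ = -(w - (q : ℂ) ^ n * z)⁻¹ := by
    rw [← inv_neg]
    congr 1
    ring
  rw [h3, h4]
  field_simp
  ring

-- It is enough to treat each factor of φ separately. A ratio l surviving in `ratios` comes from two
-- distinct classes, and the single-divisor bound, with m = l/q, yields the bound for (l;q)_n.
include hroot in
theorem conditionD_of_inIso (hq : ‖(q : ℂ)‖ = 1) (hconv : Converges fun n => (qPoch q q n)⁻¹)
    {V : GrNil.{u} q} (hV : InIso q (analyticModule q V.twistEquiv)) : ConditionD q V := by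
  intro S hS
  have key : ∀ l ∈ ratios q S, Converges fun n => (qPoch l q n)⁻¹ := fun l hl => by
    obtain ⟨⟨a, ha, b, hb, hab⟩, hl'⟩ := mem_ratios_iff.1 hl
    have hne : (a : CModQ q) ≠ b := fun h => by
      refine hl' 0 le_rfl ?_
      rw [← hab, hS.injOn ha hb h]
      simp
    obtain ⟨i, hi⟩ := exists_rep_eq_zpow_mul q a
    obtain ⟨j, hj⟩ := exists_rep_eq_zpow_mul q b
    have h := converges_inv_of_inIso hroot hV hne (hS.mapsTo ha) (hS.mapsTo hb)
    have hlm : ∀ n : ℕ, (q : ℂ) ^ n * ((q : ℂ)⁻¹ * l) ≠ 1 := fun n h0 => by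
      have h1 : q ^ (n : ℤ) * (q⁻¹ * (a * b⁻¹)) = 1 := Units.ext (by simpa [← hab] using h0)
      refine hne (coe_eq_coe_iff.2 ⟨(n : ℤ) - 1, ?_⟩)
      rw [zpow_sub_one, mul_assoc]
      rwa [← mul_assoc q⁻¹, ← mul_assoc, mul_inv_eq_one, eq_comm] at h1
    have h2 : Converges fun n : ℕ => (1 - (q : ℂ) ^ n * ((q : ℂ)⁻¹ * l))⁻¹ := by
      -- With rep(a) = q^i a and rep(b) = q^j b, shifting by j - i - 1 replaces rep(a)/rep(b) by q⁻¹
      -- a/b. Arbitrary representatives are thus covered.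
      have h3 := (converges_shift (fun n : ℤ => (1 - (q : ℂ) ^ n * ((rep q a : ℂ) / rep q b))⁻¹)
        (j - i - 1)).2 (by simpa using h)
      convert h3 using 4 with n
      rw [hi, hj, ← hab]
      push_cast
      rw [zpow_add₀ q.ne_zero, zpow_sub₀ q.ne_zero, zpow_sub₀ q.ne_zero, zpow_natCast, zpow_one]
      field_simp
    have h3 := converges_inv_qPoch_of_converges_inv hq hroot hconv hlm h2
    rwa [mul_inv_cancel_left₀ q.ne_zero] at h3
  have h := converges_multiset_prod (ratios q S).val (c := fun l n => (qPoch l q n)⁻¹) key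
  convert h using 2 with n
  rw [phiCoeff, ← Finset.prod_inv_distrib]
  rfl

end Diverge

/-! ## Cyclic vectors of constant systems -/

section Cyclic

open Polynomial

/-- This is the structure theorem for V as a torsion ℂ[X]-module through A: the v i generate its
cyclic summands and the P i are their annihilators. -/
theorem exists_cyclic_decomposition {V : Type u} [AddCommGroup V] [Module ℂ V]
    [FiniteDimensional ℂ V] (A : Module.End ℂ V) :
    ∃ (ι : Type) (_ : Fintype ι) (P : ι → ℂ[X]) (v : ι → V), (∀ i, P i ≠ 0) ∧
      (∀ i, P i ∣ A.charpoly) ∧ (∀ i, aeval A (P i) (v i) = 0) ∧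
      (∀ W : Submodule ℂ V, (∀ i (p : ℂ[X]), aeval A p (v i) ∈ W) → W = ⊤) ∧
      ∑ i, (P i).natDegree = Module.finrank ℂ V := by
  classical
  obtain ⟨ι, hι, p, hp, k, ⟨e⟩⟩ := Module.equiv_directSum_of_isTorsion
    (Module.AEval.isTorsion_of_finiteDimensional ℂ V A)
  let of := Module.AEval'.of A
  let g : ι → Module.AEval' A := fun i =>
    e.symm (DirectSum.lof ℂ[X] ι (fun i => ℂ[X] ⧸ Submodule.span ℂ[X] {p i ^ k i}) i
      (Submodule.Quotient.mk 1))
  have hg : ∀ i (r : ℂ[X]), r • g i =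
      e.symm (DirectSum.lof ℂ[X] ι (fun i => ℂ[X] ⧸ Submodule.span ℂ[X] {p i ^ k i}) i
      (Submodule.Quotient.mk r)) := fun i r => by
    rw [← map_smul, ← map_smul, ← Submodule.Quotient.mk_smul, smul_eq_mul, mul_one]
  have hof : ∀ (r : ℂ[X]) i, of (aeval A r (of.symm (g i))) = r • g i := fun r i => by
    have := Module.AEval.of_aeval_smul A r (of.symm (g i))
    rw [LinearEquiv.apply_symm_apply] at this
    exact this
  have hzero : ∀ i r, aeval A r (of.symm (g i)) = 0 ↔ p i ^ k i ∣ r := fun i r => by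
    rw [← of.map_eq_zero_iff, hof, hg, e.symm.map_eq_zero_iff,
      map_eq_zero_iff (DirectSum.lof ℂ[X] ι (fun i => ℂ[X] ⧸ Submodule.span ℂ[X] {p i ^ k i}) i)
        (DirectSum.of_injective i), Submodule.Quotient.mk_eq_zero, Submodule.mem_span_singleton]
    simp only [smul_eq_mul, dvd_iff_exists_eq_mul_left, eq_comm]
  refine ⟨ι, hι, fun i => p i ^ k i, fun i => of.symm (g i), fun i => pow_ne_zero _ (hp i).ne_zero,
    fun i => (hzero i _).1 ?_, fun i => (hzero i _).2 dvd_rfl, fun W hW => ?_, ?_⟩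
  · rw [LinearMap.aeval_self_charpoly, LinearMap.zero_apply]
  · rw [eq_top_iff]
    rintro x -
    have key : ∀ y, of.symm (e.symm y) ∈ W := fun y => by
      induction y using DirectSum.induction_on with
      | zero => simp
      | of i y =>
        obtain ⟨r, rfl⟩ := Submodule.Quotient.mk_surjective _ y
        have := hW i r
        rwa [← of.symm_apply_apply (aeval A r (of.symm (g i))), hof, hg] at this
      | add y z hy hz => rw [map_add, map_add]; exact W.add_mem hy hz
    simpa using key (e (of x))
  · have h1 := ((of.trans (e.restrictScalars ℂ))).finrank_eq
    have : ∀ i, Module.Finite ℂ (ℂ[X] ⧸ Submodule.span ℂ[X] {p i ^ k i}) := fun i =>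
      Module.Finite.of_surjective ((DirectSum.component ℂ[X] ι
        (fun i => ℂ[X] ⧸ Submodule.span ℂ[X] {p i ^ k i}) i).restrictScalars ℂ ∘ₗ
          (of.trans (e.restrictScalars ℂ)).toLinearMap) (by
        rw [LinearMap.coe_comp]
        refine Function.Surjective.comp (fun y => ⟨DirectSum.lof ℂ[X] ι _ i y, ?_⟩)
          (LinearEquiv.surjective _)
        exact DirectSum.component.lof_self ℂ[X] (M := fun i => ℂ[X] ⧸ Submodule.span ℂ[X] {p i ^ k i}) i y)
    rw [h1, Module.finrank_directSum]
    exact Finset.sum_congr rfl fun i _ => finrank_quotient_span_eq_natDegree.symm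

theorem aeval_apply_of_intertwines {V W : Type*} [AddCommGroup V] [Module ℂ V] [AddCommGroup W]
    [Module ℂ W] {A : Module.End ℂ V} {B : Module.End ℂ W} {f : V →ₗ[ℂ] W}
    (h : ∀ v, f (A v) = B (f v)) (p : ℂ[X]) (v : V) : f (aeval A p v) = aeval B p (f v) := by
  have hn : ∀ n : ℕ, ∀ v, f ((A ^ n) v) = (B ^ n) (f v) := fun n => by
    induction n with
    | zero => intro v; rfl
    | succ n ih => intro v; rw [pow_succ, pow_succ, Module.End.mul_apply, Module.End.mul_apply, ih, h]
  induction p using Polynomial.induction_on' with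
  | add p r hp hr => simp only [map_add, LinearMap.add_apply, hp, hr]
  | monomial n a => simp only [aeval_monomial, Module.End.mul_apply, Module.algebraMap_end_apply,
      map_smul, hn]

theorem aeval_smul_comp {V : Type*} [AddCommGroup V] [Module ℂ V] (A : Module.End ℂ V) {c : ℂ}
    (hc : c ≠ 0) (p : ℂ[X]) : aeval (c • A) (p.comp (C c⁻¹ * X)) = aeval A p := by
  rw [aeval_comp]
  congr 2
  rw [map_mul, aeval_C, aeval_X, ← Algebra.smul_def, smul_smul, inv_mul_cancel₀ hc, one_smul]

variable {q : ℂˣ} (hroot : ∀ n : ℕ, 0 < n → q ^ n ≠ 1)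

/-- The operator `σ_q ⊗ A` on `K ⊗ V` as a `ℂ`-linear map. -/
def analyticEnd (q : ℂˣ) {V : Type u} [AddCommGroup V] [Module ℂ V] [FiniteDimensional ℂ V]
    (A : V ≃ₗ[ℂ] V) : Module.End ℂ (meroGerms ⊗[ℂ] V) where
  toFun := analyticSig q A
  map_add' := map_add _
  map_smul' c t := by
    rw [← algebraMap_smul meroGerms c t, analyticSig_smul, sigma_algebraMap, algebraMap_smul]
    rfl

/-- The power `x ^ k`. -/
def monomialGerm (k : ℤ) : meroGerms := ⟨HahnSeries.single k 1, single_mem_meroGerms k⟩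

theorem monomialGerm_ne_zero (k : ℤ) : monomialGerm k ≠ 0 := fun h =>
  HahnSeries.single_ne_zero (Γ := ℤ) (a := k) (one_ne_zero (α := ℂ)) (congrArg Subtype.val h)

theorem sigma_monomialGerm (k : ℤ) : sigma q (monomialGerm k) = (q : ℂ) ^ k • monomialGerm k := by
  refine Subtype.ext ?_
  rw [Algebra.smul_def]
  change sigmaHat q (HahnSeries.single k 1) =
    algebraMap ℂ (LaurentSeries ℂ) ((q : ℂ) ^ k) * HahnSeries.single k 1
  ext n
  rw [sigmaHat_coeff, coeff_algebraMap_mul, HahnSeries.coeff_single]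
  split_ifs with h
  · rw [h]
  · simp

/-- On x^k ⊗ V the operator acts as q^k A, so multiplication by monomials moves the spectrum by
powers of q. -/
theorem monomial_tmul_analyticEnd {V : Type u} [AddCommGroup V] [Module ℂ V] [FiniteDimensional ℂ V]
    (A : V ≃ₗ[ℂ] V) (k : ℤ) (p : ℂ[X]) (v : V) :
    aeval (analyticEnd q A) p (monomialGerm k ⊗ₜ[ℂ] v) =
      monomialGerm k ⊗ₜ[ℂ] aeval ((q : ℂ) ^ k • A.toLinearMap) p v := by
  refine (aeval_apply_of_intertwines (f := TensorProduct.mk ℂ meroGerms V (monomialGerm k))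
    (fun v => ?_) p v).symm
  change monomialGerm k ⊗ₜ[ℂ] ((q : ℂ) ^ k • A v) = sigma q (monomialGerm k) ⊗ₜ[ℂ] A v
  rw [sigma_monomialGerm, TensorProduct.smul_tmul]

/-- Generators v i of the cyclic summands are weighted by distinct powers of x. The annihilator of
x^(k i) ⊗ v i then has roots q^(k i) times eigenvalues of A, and nonresonance makes these
annihilators pairwise coprime. Their product L kills the sum m, and Bézout identities recover each
summand from m. Invertibility of A gives L(0) ≠ 0. -/
theorem exists_cyclic_vector {V : Type u} [AddCommGroup V] [Module ℂ V] [FiniteDimensional ℂ V]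
    (A : V ≃ₗ[ℂ] V) (hA : ∀ z w : ℂ, Module.End.HasEigenvalue A.toLinearMap z → Module.End.HasEigenvalue A.toLinearMap w →
      ∀ n : ℤ, n ≠ 0 → (q : ℂ) ^ n * z ≠ w) :
    ∃ (L : ℂ[X]) (m : meroGerms ⊗[ℂ] V), L.coeff 0 ≠ 0 ∧ L.natDegree = Module.finrank ℂ V ∧
      aeval (analyticEnd q A) L m = 0 ∧
      ∀ W : Submodule meroGerms (meroGerms ⊗[ℂ] V),
        (∀ p : ℂ[X], aeval (analyticEnd q A) p m ∈ W) → W = ⊤ := by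
  classical
  obtain ⟨ι, _, P, v, hP0, hPA, hPv, hspan, hdeg⟩ := exists_cyclic_decomposition A.toLinearMap
  let k : ι → ℤ := fun i => (Fintype.equivFin ι i : ℕ)
  have hk : ∀ i j, i ≠ j → k i - k j ≠ 0 := fun i j hij h => hij <| by
    refine (Fintype.equivFin ι).injective (Fin.ext ?_)
    simpa [k] using sub_eq_zero.1 h
  have hqk : ∀ n : ℤ, (q : ℂ) ^ n ≠ 0 := fun n => zpow_ne_zero _ q.ne_zero
  let Q : ι → ℂ[X] := fun i => (P i).comp (C ((q : ℂ) ^ k i)⁻¹ * X)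
  have hroots : ∀ i z, (Q i).eval z = 0 → Module.End.HasEigenvalue A.toLinearMap (((q : ℂ) ^ k i)⁻¹ * z) :=
    fun i z hz => by
      rw [Module.End.hasEigenvalue_iff_isRoot_charpoly]
      refine IsRoot.dvd ?_ (hPA i)
      simpa [Q, eval_comp] using hz
  have hcop : ∀ i j, i ≠ j → IsCoprime (Q i) (Q j) := fun i j hij => by
    rw [isCoprime_iff_aeval_ne_zero_of_isAlgClosed ℂ ℂ]
    intro z
    by_contra! h
    refine hA _ _ (hroots i z (by simpa using h.1)) (hroots j z (by simpa using h.2))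
      (k i - k j) (hk i j hij) ?_
    rw [zpow_sub₀ q.ne_zero]
    have := hqk (k i)
    field_simp
  have hQv : ∀ i, aeval (analyticEnd q A) (Q i) (monomialGerm (k i) ⊗ₜ[ℂ] v i) = 0 := fun i => by
    rw [monomial_tmul_analyticEnd, aeval_smul_comp _ (hqk _), hPv, TensorProduct.tmul_zero]
  have hkill : ∀ i r, Q i ∣ r →
      aeval (analyticEnd q A) r (monomialGerm (k i) ⊗ₜ[ℂ] v i) = 0 := by
    rintro i _ ⟨r, rfl⟩
    rw [mul_comm, map_mul, Module.End.mul_apply, hQv, map_zero]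
  refine ⟨∏ i, Q i, ∑ i, monomialGerm (k i) ⊗ₜ[ℂ] v i, ?_, ?_, ?_, fun W hW => ?_⟩
  · rw [coeff_zero_eq_eval_zero, eval_prod]
    refine Finset.prod_ne_zero_iff.2 fun i _ h => ?_
    have h0 := hroots i 0 h
    rw [mul_zero] at h0
    obtain ⟨x, hx⟩ := h0.exists_hasEigenvector
    have h1 := hx.apply_eq_smul
    rw [zero_smul] at h1
    exact hx.2 (A.map_eq_zero_iff.1 h1)
  · rw [natDegree_prod _ _ fun i _ => ?_, ← hdeg]
    · refine Finset.sum_congr rfl fun i _ => ?_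
      rw [natDegree_comp, natDegree_C_mul_X _ (inv_ne_zero (hqk _)), mul_one]
    · intro h
      rw [comp_eq_zero_iff] at h
      rcases h with h | h
      · exact hP0 i h
      · have := congrArg natDegree h.2
        rw [natDegree_C_mul_X _ (inv_ne_zero (hqk _)), natDegree_C] at this
        exact one_ne_zero this
  · rw [map_sum]
    exact Finset.sum_eq_zero fun i _ => hkill i _ (Finset.dvd_prod_of_mem _ (Finset.mem_univ i))
  · have h1 : ∀ i p, (1 : meroGerms) ⊗ₜ[ℂ] aeval A.toLinearMap p (v i) ∈ W := fun i p => by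
      obtain ⟨a, b, hab⟩ := IsCoprime.prod_right (t := Finset.univ.erase i) (s := Q)
        fun j hj => hcop i j (Finset.ne_of_mem_erase hj).symm
      -- The factor b ∏ Q j kills all other summands and is the identity on the i-th; the rescaled p
      -- then acts on v i as p(A).
      have h := hW (p.comp (C ((q : ℂ) ^ k i)⁻¹ * X) * (b * ∏ j ∈ Finset.univ.erase i, Q j))
      rw [map_sum, Finset.sum_eq_single i, map_mul, Module.End.mul_apply] at h
      · rw [eq_sub_of_add_eq' hab, map_sub, LinearMap.sub_apply, hkill i _ (dvd_mul_left _ _),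
          sub_zero, map_one, Module.End.one_apply, monomial_tmul_analyticEnd,
          aeval_smul_comp _ (hqk _)] at h
        have h2 := W.smul_mem (monomialGerm (k i))⁻¹ h
        rwa [TensorProduct.smul_tmul', smul_eq_mul, inv_mul_cancel₀ (monomialGerm_ne_zero _)] at h2
      · intro j _ hj
        refine hkill j _ (Dvd.dvd.mul_left (Dvd.dvd.mul_left ?_ _) _)
        exact Finset.dvd_prod_of_mem _ (Finset.mem_erase.2 ⟨hj, Finset.mem_univ j⟩)
      · exact fun h => (h (Finset.mem_univ i)).elim
    have h2 := hspan ((W.restrictScalars ℂ).comap (TensorProduct.mk ℂ meroGerms V 1)) h1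
    rw [eq_top_iff]
    rintro t -
    induction t using TensorProduct.induction_on with
    | zero => exact W.zero_mem
    | tmul f x =>
      have h3 : x ∈ (W.restrictScalars ℂ).comap (TensorProduct.mk ℂ meroGerms V 1) := by
        rw [h2]; trivial
      have h4 := W.smul_mem f (show (1 : meroGerms) ⊗ₜ[ℂ] x ∈ W from h3)
      rwa [TensorProduct.smul_tmul', smul_eq_mul, mul_one] at h4
    | add x y hx hy => exact W.add_mem hx hy

/-! ### Slopes of operators with constant coefficients -/

/-- The operator with constant coefficients given by a polynomial. -/
def DiffOperator.ofPolynomial (L : ℂ[X]) (hL : L ≠ 0) : DiffOperator where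
  ν := L.natDegree
  coeff i := algebraMap ℂ meroGerms (L.coeff i)
  holomorphic i n hn := by
    refine (coeff_algebraMap (L.coeff i) n).trans (if_neg hn.ne)
  lead_ne_zero h := by
    rw [map_eq_zero] at h
    exact hL (leadingCoeff_eq_zero.1 h)

/-- The polygon lies in the upper half strip over [0, ν] and contains both lower corners. A
supporting line is thus nonpositive over [0, ν], so it meets the polygon only at height 0. Nonzero
slope would leave one contact point. -/
theorem DiffOperator.ofPolynomial_isPure {L : ℂ[X]} (h0 : L.coeff 0 ≠ 0) (hL : L ≠ 0) :
    (DiffOperator.ofPolynomial L hL).IsPure 0 := by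
  rintro μ ⟨c, hc, p, hp, p', hp', hne, hpc, hpc'⟩
  have hord : ∀ a : ℂ, a ≠ 0 → ((algebraMap ℂ meroGerms a : meroGerms) : LaurentSeries ℂ).order = 0 :=
    fun a _ => HahnSeries.order_C
  have hsub : (DiffOperator.ofPolynomial L hL).newtonPolygon ⊆
      {p | 0 ≤ p.1 ∧ p.1 ≤ (L.natDegree : ℝ) ∧ 0 ≤ p.2} := by
    refine convexHull_min ?_ ?_
    · rintro x ⟨i, hi, hx, hx'⟩
      have hi' : L.coeff i ≠ 0 := fun h => hi (by
        change algebraMap ℂ meroGerms (L.coeff i) = 0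
        rw [h, map_zero])
      have e := hord _ hi'
      change ((HahnSeries.order ((algebraMap ℂ meroGerms (L.coeff i) : meroGerms) : LaurentSeries ℂ) : ℤ) : ℝ)
        ≤ x.2 at hx'
      rw [e] at hx'
      refine ⟨by rw [hx]; positivity, ?_, by simpa using hx'⟩
      rw [hx]
      exact_mod_cast Nat.lt_succ_iff.1 i.2
    · rintro x ⟨h1, h2, h3⟩ y ⟨h4, h5, h6⟩ a b ha hb hab
      refine ⟨?_, ?_, ?_⟩
      · simp only [Prod.fst_add, Prod.smul_fst, smul_eq_mul]
        positivity
      · simp only [Prod.fst_add, Prod.smul_fst, smul_eq_mul]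
        calc _ ≤ a * (L.natDegree : ℝ) + b * L.natDegree := by gcongr
          _ = _ := by rw [← add_mul, hab, one_mul]
      · simp only [Prod.snd_add, Prod.smul_snd, smul_eq_mul]
        positivity
  have hmem : ∀ i : Fin (L.natDegree + 1), L.coeff i ≠ 0 →
      (((i : ℕ) : ℝ), (0 : ℝ)) ∈ (DiffOperator.ofPolynomial L hL).newtonPolygon := fun i hi => by
    refine subset_convexHull ℝ _ ⟨i, fun h => hi ((map_eq_zero (algebraMap ℂ meroGerms)).1 h), rfl, ?_⟩
    exact (congrArg (fun k : ℤ => (k : ℝ)) (hord _ hi)).le.trans (by simp)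
  have h1 := hc _ (hmem 0 (by simpa using h0))
  have h2 := hc _ (hmem (Fin.last _) (by simpa using hL))
  simp only [Fin.val_zero, Fin.val_last, Nat.cast_zero, mul_zero, zero_add] at h1 h2
  -- The second alternative is order 0, where the polygon degenerates to a vertical ray.
  have hz : ∀ y ∈ (DiffOperator.ofPolynomial L hL).newtonPolygon, y.2 = μ * y.1 + c →
      μ * y.1 + c = 0 ∨ (L.natDegree : ℝ) = 0 ∧ y.1 = 0 := fun y hy hyc => by
    obtain ⟨a1, a2, a3⟩ := hsub hy
    rcases eq_or_lt_of_le (Nat.cast_nonneg (α := ℝ) L.natDegree) with hn | hn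
    · exact Or.inr ⟨hn.symm, le_antisymm (hn ▸ a2) a1⟩
    · refine Or.inl (le_antisymm ?_ (hyc ▸ a3))
      have : (L.natDegree : ℝ) * (μ * y.1 + c) =
        (L.natDegree - y.1) * c + y.1 * (μ * L.natDegree + c) := by ring
      nlinarith [mul_nonneg (sub_nonneg.2 a2) (neg_nonneg.2 h1),
        mul_nonneg a1 (neg_nonneg.2 h2)]
  have e1 := hz p hp hpc
  have e2 := hz p' hp' hpc'
  by_contra hμ
  refine hne (Prod.ext ?_ ?_)
  · rcases e1 with e1 | ⟨hn, e1⟩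
    · rcases e2 with e2 | ⟨hn, e2⟩
      · exact mul_left_cancel₀ hμ (by linarith)
      · have := hsub hp
        rw [e2]
        exact le_antisymm (hn ▸ this.2.1) this.1
    · have := hsub hp'
      rw [e1]
      exact (le_antisymm (hn ▸ this.2.1) this.1).symm
  · rcases e1 with e1 | ⟨hn, e1⟩
    · rcases e2 with e2 | ⟨hn, e2⟩
      · rw [hpc, hpc', e1, e2]
      · have := hsub hp
        rw [hpc, hpc', e2, le_antisymm (hn ▸ this.2.1) this.1]
    · have := hsub hp'
      rw [hpc, hpc', e1, le_antisymm (hn ▸ this.2.1) this.1]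

-- Division with remainder by L reduces the span of all iterates of the cyclic vector to the first
-- deg L of them; as deg L is the dimension, these form a basis.
include hroot in
theorem isPureOfSlope_zero_analyticModule (V : GrNil.{u} q) :
    IsPureOfSlope q 0 (analyticModule q V.twistEquiv) := by
  obtain ⟨L, m, hL0, hdeg, hLm, hspan⟩ := exists_cyclic_vector (q := q) V.twistEquiv
    fun z w hz hw n hn => by
      obtain ⟨c, -, rfl⟩ := V.exists_rep_eq_of_hasEigenvalue hz
      obtain ⟨d, -, rfl⟩ := V.exists_rep_eq_of_hasEigenvalue hw
      exact zpow_mul_rep_ne_rep hroot hn c d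
  have hL : L ≠ 0 := fun h => hL0 (by simp [h])
  have hpow : ∀ n : ℕ, (analyticEnd q V.twistEquiv ^ n) m = (analyticSig q V.twistEquiv)^[n] m :=
    fun n => Module.End.pow_apply _ _ _
  set W : Submodule meroGerms (meroGerms ⊗[ℂ] V.carrier) :=
    Submodule.span meroGerms (Set.range fun i : Fin L.natDegree => (analyticSig q V.twistEquiv)^[i] m)
    with hW
  have hWtop : W = ⊤ := hspan W fun p => by
    rw [← EuclideanDomain.div_add_mod p L, map_add, LinearMap.add_apply, mul_comm, map_mul,
      Module.End.mul_apply, hLm, map_zero, zero_add]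
    rcases eq_or_ne (p % L) 0 with h | h
    · rw [h, map_zero]
      exact W.zero_mem
    have hlt := natDegree_lt_natDegree h (EuclideanDomain.mod_lt p hL)
    rw [aeval_eq_sum_range' hlt, LinearMap.sum_apply]
    refine W.sum_mem fun i hi => ?_
    rw [LinearMap.smul_apply, hpow, ← algebraMap_smul meroGerms]
    exact W.smul_mem _ (Submodule.subset_span ⟨⟨i, Finset.mem_range.1 hi⟩, rfl⟩)
  refine ⟨DiffOperator.ofPolynomial L hL, ⟨m, ?_, hWtop, ?_⟩, DiffOperator.ofPolynomial_isPure hL0 hL⟩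
  · refine linearIndependent_of_top_le_span_of_card_eq_finrank hWtop.ge ?_
    have h4 : Module.finrank meroGerms (meroGerms ⊗[ℂ] V.carrier) =
      Module.finrank ℂ V.carrier := Module.finrank_baseChange
    rw [Fintype.card_fin]
    exact hdeg.trans h4.symm
  · rw [aeval_eq_sum_range, LinearMap.sum_apply,
      Finset.sum_range fun i => (L.coeff i • analyticEnd q V.twistEquiv ^ i) m] at hLm
    refine Eq.trans (Finset.sum_congr rfl fun i _ => ?_) hLm
    rw [LinearMap.smul_apply, hpow]
    exact algebraMap_smul meroGerms (L.coeff i) ((analyticSig q V.twistEquiv)^[i] m)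

end Cyclic

/-! ## Formal reduction of regular singular systems -/

section FormalReduction

variable {q : ℂˣ} {n : Type*} [Fintype n] [DecidableEq n]

theorem exists_strong_rec {α : Type*} (F : ∀ k : ℕ, (Fin k → α) → α) :
    ∃ y : ℕ → α, ∀ k, y k = F k fun j => y j := by
  refine ⟨fun k => Nat.strongRec (motive := fun _ => α) (fun k ih => F k fun j => ih j j.2) k,
    fun k => ?_⟩
  beta_reduce
  conv_lhs => rw [Nat.strongRec]

/-- The points z q^(-k) are distinct, so only finitely many are roots; the last root among them
works. -/
theorem exists_root_maximal (hroot : ∀ n : ℕ, 0 < n → q ^ n ≠ 1) {p : Polynomial ℂ}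
    (hp : p.degree ≠ 0) (hp0 : p.eval 0 ≠ 0) :
    ∃ μ : ℂ, μ ≠ 0 ∧ p.IsRoot μ ∧ ∀ k : ℕ, k ≠ 0 → ¬ p.IsRoot (μ * (q : ℂ)⁻¹ ^ k) := by
  obtain ⟨z, hz⟩ := IsAlgClosed.exists_root p hp
  have hz0 : z ≠ 0 := by rintro rfl; exact hp0 hz
  have hpne : p ≠ 0 := by rintro rfl; simp at hp0
  have hinj : Function.Injective fun k : ℕ => z * (q : ℂ)⁻¹ ^ k := by
    intro i j hij
    have h1 : (q⁻¹ : ℂˣ) ^ i = q⁻¹ ^ j := Units.ext (by simpa [hz0] using hij)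
    have h2 : ¬ IsOfFinOrder q⁻¹ := by
      rw [isOfFinOrder_inv_iff, isOfFinOrder_iff_pow_eq_one]
      rintro ⟨n, hn, h⟩
      exact hroot n hn h
    exact injective_pow_iff_not_isOfFinOrder.2 h2 h1
  have hfin : {k : ℕ | p.IsRoot (z * (q : ℂ)⁻¹ ^ k)}.Finite :=
    (Polynomial.finite_setOfPred_isRoot hpne).preimage hinj.injOn
  obtain ⟨k, hk, hmax⟩ := hfin.exists_maximal ⟨0, by simpa using hz⟩
  refine ⟨z * (q : ℂ)⁻¹ ^ k, mul_ne_zero hz0 (pow_ne_zero _ (inv_ne_zero q.ne_zero)), hk,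
    fun j hj h => ?_⟩
  rw [mul_assoc, ← pow_add] at h
  have := hmax (y := k + j) h (by omega)
  omega

/-- The x^k-coefficient of B y(qx) = μ y reads (μ q^(-k) - B₀) y_k = q^(-k) times earlier terms.
Choosing μ last along its q-orbit of eigenvalues makes the matrix invertible for every k > 0, while
y₀ is an eigenvector of B₀. -/
theorem exists_eigenvector_powerSeries (hroot : ∀ n : ℕ, 0 < n → q ^ n ≠ 1) [Nonempty n]
    {B : Matrix n n (PowerSeries ℂ)} (hB : IsUnit B.det) :
    ∃ (μ : ℂ) (y : n → PowerSeries ℂ), μ ≠ 0 ∧ (fun i => PowerSeries.constantCoeff (y i)) ≠ 0 ∧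
      ∀ i, ∑ k, B i k * PowerSeries.rescale (q : ℂ) (y k) = PowerSeries.C μ * y i := by
  set B₀ : Matrix n n ℂ := B.map PowerSeries.constantCoeff with hB₀
  have hB₀det : B₀.det ≠ 0 := by
    have := PowerSeries.isUnit_iff_constantCoeff.1 hB
    rw [RingHom.map_det] at this
    exact this.ne_zero
  have hev : ∀ z, B₀.charpoly.IsRoot z ↔ (Matrix.scalar n z - B₀).det = 0 := fun z => by
    rw [Polynomial.IsRoot, Matrix.eval_charpoly]
  obtain ⟨μ, hμ, hroot₀, hmax⟩ := exists_root_maximal hroot (p := B₀.charpoly)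
    (by rw [Matrix.charpoly_degree_eq_dim]; exact_mod_cast Fintype.card_ne_zero)
    (fun h => by
      have := (hev 0).1 h
      rw [map_zero, zero_sub, Matrix.det_neg] at this
      exact mul_ne_zero (pow_ne_zero _ (by norm_num)) hB₀det this)
  obtain ⟨y₀, hy₀, hy₀'⟩ := Matrix.exists_mulVec_eq_zero_iff.2 ((hev μ).1 hroot₀)
  obtain ⟨y, hy⟩ := exists_strong_rec (α := n → ℂ) fun k prev =>
    if k = 0 then y₀ else
      (Matrix.scalar n (μ * (q : ℂ)⁻¹ ^ k) - B₀)⁻¹.mulVec fun i => (q : ℂ)⁻¹ ^ k *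
        ∑ j : Fin k, ∑ l, (q : ℂ) ^ (j : ℕ) * prev j l * PowerSeries.coeff (k - j) (B i l)
  have hrec : ∀ k i, (μ * (q : ℂ)⁻¹ ^ k) * y k i - ∑ l, B₀ i l * y k l = (q : ℂ)⁻¹ ^ k *
        ∑ j ∈ Finset.range k, ∑ l, (q : ℂ) ^ j * y j l * PowerSeries.coeff (k - j) (B i l) := by
    intro k i
    have e : (Matrix.scalar n (μ * (q : ℂ)⁻¹ ^ k) - B₀).mulVec (y k) i =
        (μ * (q : ℂ)⁻¹ ^ k) * y k i - ∑ l, B₀ i l * y k l := by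
      rw [Matrix.sub_mulVec, Pi.sub_apply, Matrix.scalar_apply, Matrix.mulVec_diagonal]
      rfl
    rw [← e]
    rcases eq_or_ne k 0 with rfl | hk
    · rw [hy 0, if_pos rfl, pow_zero, mul_one, hy₀']
      simp
    · have hu : IsUnit (Matrix.scalar n (μ * (q : ℂ)⁻¹ ^ k) - B₀).det :=
        isUnit_iff_ne_zero.2 fun h => hmax k hk ((hev _).2 h)
      rw [hy k, if_neg hk, Matrix.mulVec_mulVec, Matrix.mul_nonsing_inv _ hu, Matrix.one_mulVec,
        Finset.sum_range fun j => ∑ l, (q : ℂ) ^ j * y j l * PowerSeries.coeff (k - j) (B i l)]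
  refine ⟨μ, fun i => PowerSeries.mk fun k => y k i, hμ, ?_, fun i => ?_⟩
  · have : (fun i => PowerSeries.constantCoeff (PowerSeries.mk fun k => y k i)) = y₀ := by
      ext i
      rw [← PowerSeries.coeff_zero_eq_constantCoeff_apply, PowerSeries.coeff_mk, hy 0, if_pos rfl]
    rw [this]
    exact hy₀
  · ext k
    rw [map_sum, PowerSeries.coeff_C_mul, PowerSeries.coeff_mk]
    have h1 : ∀ l, PowerSeries.coeff k (B i l * PowerSeries.rescale (q : ℂ)
        (PowerSeries.mk fun k => y k l)) =
        (∑ j ∈ Finset.range k, (q : ℂ) ^ j * y j l * PowerSeries.coeff (k - j) (B i l)) +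
          (q : ℂ) ^ k * (B₀ i l * y k l) := fun l => by
      rw [mul_comm, PowerSeries.coeff_mul, Finset.Nat.sum_antidiagonal_eq_sum_range_succ_mk,
        Finset.sum_range_succ]
      simp only [PowerSeries.coeff_rescale, PowerSeries.coeff_mk, Nat.sub_self]
      rw [PowerSeries.coeff_zero_eq_constantCoeff_apply, hB₀, Matrix.map_apply]
      ring
    simp only [h1, Finset.sum_add_distrib]
    rw [← Finset.mul_sum, Finset.sum_comm]
    have h2 := hrec k i
    have h3 : (q : ℂ) ^ k * (q : ℂ)⁻¹ ^ k = 1 := by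
      rw [← mul_pow, mul_inv_cancel₀ q.ne_zero, one_pow]
    linear_combination -(q : ℂ) ^ k * h2 - (∑ j ∈ Finset.range k, ∑ l, (q : ℂ) ^ j * y j l * PowerSeries.coeff (k - j) (B i l)) * h3 + μ * y k i * h3

/-- Two formal systems are equivalent if they are related by a gauge transformation. -/
def GaugeEquiv (q : ℂˣ) (B C : Matrix n n (LaurentSeries ℂ)) : Prop :=
  ∃ T T' : Matrix n n (LaurentSeries ℂ), T * T' = 1 ∧ B * T.map (sigmaHat q) = T * C

theorem GaugeEquiv.trans {B C D : Matrix n n (LaurentSeries ℂ)} (h : GaugeEquiv q B C)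
    (h' : GaugeEquiv q C D) : GaugeEquiv q B D := by
  obtain ⟨T, T', hT, e⟩ := h
  obtain ⟨S, S', hS, e'⟩ := h'
  refine ⟨T * S, S' * T', ?_, ?_⟩
  · rw [mul_assoc, ← mul_assoc S, hS, one_mul, hT]
  · rw [Matrix.map_mul (f := sigmaHat q), ← mul_assoc, e, mul_assoc, e', mul_assoc]

theorem GaugeEquiv.submatrix {m : Type*} [Fintype m] [DecidableEq m] (e : m ≃ n)
    {B C : Matrix n n (LaurentSeries ℂ)} (h : GaugeEquiv q B C) :
    GaugeEquiv q (B.submatrix e e) (C.submatrix e e) := by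
  obtain ⟨T, T', hT, h⟩ := h
  refine ⟨T.submatrix e e, T'.submatrix e e, ?_, ?_⟩
  · rw [Matrix.submatrix_mul_equiv, hT, Matrix.submatrix_one_equiv]
  · rw [Matrix.submatrix_mul_equiv, ← h, ← Matrix.submatrix_mul_equiv _ _ e e e]
    rfl

/-- Since y(0) ≠ 0, the power series eigenvector y is the first column of a matrix invertible at 0,
hence over power series. In this frame the first column of the system is (μ, 0). -/
theorem exists_gaugeEquiv_triangular (hroot : ∀ n : ℕ, 0 < n → q ^ n ≠ 1)
    {B : Matrix (Unit ⊕ n) (Unit ⊕ n) (PowerSeries ℂ)} (hB : IsUnit B.det) :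
    ∃ (μ : ℂ) (u : Matrix Unit n (PowerSeries ℂ)) (B₁ : Matrix n n (PowerSeries ℂ)), μ ≠ 0 ∧
      IsUnit B₁.det ∧ GaugeEquiv q (B.map toLaurent)
        ((Matrix.fromBlocks (Matrix.diagonal fun _ => PowerSeries.C μ) u 0 B₁).map toLaurent) := by
  classical
  obtain ⟨μ, y, hμ, hy, h⟩ := exists_eigenvector_powerSeries hroot hB
  obtain ⟨C, hC⟩ := SeparatingDual.exists_continuousLinearEquiv_apply_eq (R := ℂ)
    (x := (Pi.single (Sum.inl ()) 1 : Unit ⊕ n → ℂ)) (y := fun i => PowerSeries.constantCoeff (y i))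
    (by simp) hy
  set C₀ := LinearMap.toMatrix' C.toLinearEquiv.toLinearMap with hC₀
  have hC₀det : IsUnit C₀.det := by
    rw [hC₀, LinearMap.det_toMatrix']
    exact LinearEquiv.isUnit_det' C.toLinearEquiv
  have hC₀y : ∀ i, C₀ i (Sum.inl ()) = PowerSeries.constantCoeff (y i) := fun i => by
    rw [hC₀, LinearMap.toMatrix'_apply, ← congrFun hC i]
    congr 2
  set P : Matrix (Unit ⊕ n) (Unit ⊕ n) (PowerSeries ℂ) :=
    (C₀.map PowerSeries.C).updateCol (Sum.inl ()) y with hP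
  have hP₀ : P.map PowerSeries.constantCoeff = C₀ := by
    ext i j
    rw [Matrix.map_apply, hP, Matrix.updateCol_apply]
    split_ifs with hj
    · rw [hj, hC₀y]
    · simp
  have hPdet : IsUnit P.det := by
    rw [PowerSeries.isUnit_iff_constantCoeff, RingHom.map_det]
    change IsUnit (P.map PowerSeries.constantCoeff).det
    rwa [hP₀]
  set D := P⁻¹ * (B * P.map (PowerSeries.rescale (q : ℂ))) with hD
  have hPD : P * D = B * P.map (PowerSeries.rescale (q : ℂ)) := by
    rw [hD, ← mul_assoc, Matrix.mul_nonsing_inv _ hPdet, one_mul]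
  have hDcol : ∀ i, D i (Sum.inl ()) = if i = Sum.inl () then PowerSeries.C μ else 0 := by
    intro i
    have e : ∀ j, (B * P.map (PowerSeries.rescale (q : ℂ))) j (Sum.inl ()) =
        (P.mulVec (Pi.single (Sum.inl ()) (PowerSeries.C μ))) j := fun j => by
      rw [Matrix.mulVec_single, Matrix.mul_apply]
      simp only [hP, Matrix.map_apply, Matrix.updateCol_self, h, MulOpposite.smul_eq_mul_unop,
        Pi.smul_apply, Matrix.col_apply, MulOpposite.unop_op]
      ring
    have e2 : D i (Sum.inl ()) = (P⁻¹.mulVec (P.mulVec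
        (Pi.single (Sum.inl ()) (PowerSeries.C μ)))) i := by
      rw [hD, Matrix.mul_apply]
      simp only [e]
      rfl
    rw [e2, Matrix.mulVec_mulVec, Matrix.nonsing_inv_mul _ hPdet, Matrix.one_mulVec,
      Pi.single_apply]
  have hDblocks : D = Matrix.fromBlocks (Matrix.diagonal fun _ => PowerSeries.C μ) D.toBlocks₁₂ 0
      D.toBlocks₂₂ := by
    conv_lhs => rw [← Matrix.fromBlocks_toBlocks D]
    congr 1
    · ext1 i j
      rw [Matrix.toBlocks₁₁, Matrix.of_apply, Subsingleton.elim i (), Subsingleton.elim j (), hDcol]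
      simp
    · ext1 i j
      rw [Matrix.toBlocks₂₁, Matrix.of_apply, Subsingleton.elim j (), hDcol]
      simp
  have hDdet : IsUnit D.det := by
    rw [hD, Matrix.det_mul, Matrix.det_mul]
    refine (Matrix.isUnit_nonsing_inv_det _ hPdet).mul (hB.mul ?_)
    rw [← RingHom.mapMatrix_apply, ← RingHom.map_det]
    exact hPdet.map _
  refine ⟨μ, D.toBlocks₁₂, D.toBlocks₂₂, hμ, ?_, P.map toLaurent, P⁻¹.map toLaurent, ?_, ?_⟩
  · rw [hDblocks, Matrix.det_fromBlocks_zero₂₁] at hDdet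
    exact isUnit_of_mul_isUnit_right hDdet
  · rw [← Matrix.map_mul, Matrix.mul_nonsing_inv _ hPdet,
      Matrix.map_one _ (map_zero _) (map_one _)]
  · rw [← hDblocks, ← Matrix.map_mul, hPD, Matrix.map_mul]
    congr 1
    ext1 i j
    exact sigmaHat_toLaurent q (P i j)

/-- Shearing: the gauge x^k on the first coordinate multiplies μ by q^k, at the price of poles in
the off-diagonal block. -/
theorem exists_gaugeEquiv_of_block {μ : ℂ} (k : ℤ) (u : Matrix Unit n (LaurentSeries ℂ))
    {B₁ A : Matrix n n (LaurentSeries ℂ)} (h : GaugeEquiv q B₁ A) :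
    ∃ u' : Matrix Unit n (LaurentSeries ℂ), GaugeEquiv q
      (Matrix.fromBlocks (Matrix.diagonal fun _ => algebraMap ℂ (LaurentSeries ℂ) μ) u 0 B₁)
      (Matrix.fromBlocks (Matrix.diagonal fun _ =>
        algebraMap ℂ (LaurentSeries ℂ) ((q : ℂ) ^ k * μ)) u' 0 A) := by
  obtain ⟨T, T', hT, h⟩ := h
  set s : ℤ → LaurentSeries ℂ := fun k => HahnSeries.single k 1 with hs
  have hss : s k * s (-k) = 1 := by
    rw [hs]
    simp
  have hσ : sigmaHat q (s k) = algebraMap ℂ (LaurentSeries ℂ) ((q : ℂ) ^ k) * s k := by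
    ext j
    rw [sigmaHat_coeff, coeff_algebraMap_mul, HahnSeries.coeff_single]
    split_ifs with hj
    · rw [hj]
    · simp
  refine ⟨(Matrix.diagonal (fun _ => s (-k)) : Matrix Unit Unit (LaurentSeries ℂ)) * (u * T.map (sigmaHat q)),
    Matrix.fromBlocks (Matrix.diagonal fun _ => s k) 0 0 T,
    Matrix.fromBlocks (Matrix.diagonal fun _ => s (-k)) 0 0 T', ?_, ?_⟩
  · rw [Matrix.fromBlocks_multiply]
    simp [hT, hss]
  · rw [Matrix.fromBlocks_map, Matrix.fromBlocks_multiply, Matrix.fromBlocks_multiply]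
    congr 1
    · rw [Matrix.diagonal_map (map_zero _), Matrix.map_zero _ (map_zero _), Matrix.mul_zero,
        Matrix.zero_mul, Matrix.diagonal_mul_diagonal, Matrix.diagonal_mul_diagonal, add_zero,
        add_zero]
      congr 1
      funext _
      rw [hσ, map_mul]
      ring
    · rw [Matrix.map_zero _ (map_zero _), Matrix.mul_zero, Matrix.zero_mul, zero_add, add_zero,
        ← Matrix.mul_assoc, Matrix.diagonal_mul_diagonal]
      simp [hss]
    · simp
    · simp [h]

/-- A unipotent gauge with block h must satisfy h_k(A - c q^k) = u_k. This is solvable for every k ≠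
0 by hypothesis, and the coefficient at k = 0 is kept as the constant block. -/
theorem exists_constant_of_block {c : ℂ} {A : Matrix n n ℂ}
    (hA : ∀ k : ℤ, k ≠ 0 → (A - Matrix.scalar n (c * (q : ℂ) ^ k)).det ≠ 0)
    (u : Matrix Unit n (LaurentSeries ℂ)) : ∃ u₀ : Matrix Unit n ℂ, GaugeEquiv q
      (Matrix.fromBlocks (Matrix.diagonal fun _ => algebraMap ℂ (LaurentSeries ℂ) c) u 0
        (A.map (algebraMap ℂ (LaurentSeries ℂ))))
      ((Matrix.fromBlocks (Matrix.diagonal fun _ => c) u₀ 0 A).map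
        (algebraMap ℂ (LaurentSeries ℂ))) := by
  set hc : ℤ → Matrix Unit n ℂ := fun k =>
    if k = 0 then 0 else u.map (fun f => f.coeff k) * (A - Matrix.scalar n (c * (q : ℂ) ^ k))⁻¹
    with hhc
  -- Each h_k depends only on u_k, so no new exponents appear and h has a finite polar part.
  have hpwo : ∀ j, (Function.support fun k => hc k () j).IsPWO := fun j => by
    refine (Set.IsPWO.mono (t := ⋃ l ∈ (Finset.univ : Finset n), (u () l).support)
      ((Finset.isPWO_bUnion _).2 fun l _ => (u () l).isPWO_support) fun k hk => ?_)
    by_contra hk'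
    simp only [Finset.mem_univ, Set.iUnion_true, Set.mem_iUnion, HahnSeries.mem_support, not_exists,
      not_not] at hk'
    refine hk ?_
    simp only [hhc]
    split_ifs
    · rfl
    · simp [Matrix.mul_apply, hk']
  let h : Matrix Unit n (LaurentSeries ℂ) := Matrix.of fun _ j => ⟨fun k => hc k () j, hpwo j⟩
  have hh : ∀ i j k, (h i j).coeff k = hc k i j := fun i j k => rfl
  have key : Matrix.diagonal (fun _ : Unit => algebraMap ℂ (LaurentSeries ℂ) c) * h.map (sigmaHat q) +
      u = (u.map fun f => f.coeff 0).map (algebraMap ℂ (LaurentSeries ℂ)) +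
        h * A.map (algebraMap ℂ (LaurentSeries ℂ)) := by
    ext i j k
    rw [Matrix.add_apply, Matrix.add_apply, HahnSeries.coeff_add, HahnSeries.coeff_add,
      Matrix.diagonal_mul, coeff_algebraMap_mul, Matrix.map_apply, sigmaHat_coeff, hh,
      Matrix.map_apply, coeff_algebraMap, Matrix.mul_apply, HahnSeries.coeff_sum]
    have e : ∀ l, (h i l * (A.map (algebraMap ℂ (LaurentSeries ℂ))) l j).coeff k =
        hc k i l * A l j := fun l => by
      rw [mul_comm, Matrix.map_apply, coeff_algebraMap_mul, hh, mul_comm]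
    simp only [e]
    rcases eq_or_ne k 0 with rfl | hk
    · simp [hhc]
    · have e1 : hc k * (A - Matrix.scalar n (c * (q : ℂ) ^ k)) = u.map (fun f => f.coeff k) := by
        simp only [hhc, if_neg hk]
        rw [Matrix.mul_assoc, Matrix.nonsing_inv_mul _ (isUnit_iff_ne_zero.2 (hA k hk)),
          Matrix.mul_one]
      have e2 := congrFun (congrFun e1 i) j
      rw [Matrix.mul_sub, Matrix.sub_apply, Matrix.scalar_apply, Matrix.mul_diagonal,
        Matrix.mul_apply, Matrix.map_apply] at e2
      rw [if_neg hk]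
      linear_combination -e2
  refine ⟨u.map fun f => f.coeff 0, Matrix.fromBlocks 1 h 0 1, Matrix.fromBlocks 1 (-h) 0 1, ?_, ?_⟩
  · rw [Matrix.fromBlocks_multiply]
    simp
  · rw [Matrix.fromBlocks_map, Matrix.fromBlocks_map, Matrix.fromBlocks_multiply,
      Matrix.fromBlocks_multiply, Matrix.map_one _ (map_zero _) (map_one _),
      Matrix.map_one _ (map_zero _) (map_one _), Matrix.map_zero _ (map_zero _),
      Matrix.map_zero _ (map_zero _), Matrix.diagonal_map (map_zero _)]
    simp only [Matrix.mul_one, Matrix.one_mul, Matrix.mul_zero, Matrix.zero_mul, add_zero, zero_add]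
    congr 1

/-- By induction on the size: split off an eigenvector, make the remaining block constant, shear the
new eigenvalue onto its class representative, and clear the off-diagonal block. Keeping all
eigenvalues among the representatives provides the nonresonance needed for the last operation. -/
theorem exists_gaugeEquiv_constant (hroot : ∀ n : ℕ, 0 < n → q ^ n ≠ 1) (ι : Type) [Fintype ι] :
    ∀ [DecidableEq ι] (B : Matrix ι ι (PowerSeries ℂ)), IsUnit B.det →
      ∃ A : Matrix ι ι ℂ, GaugeEquiv q (B.map toLaurent) (A.map (algebraMap ℂ (LaurentSeries ℂ))) ∧
        ∀ z, A.charpoly.IsRoot z → ∃ c, z = rep q c := by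
  classical
  have transport : ∀ (α β : Type) [Fintype α] [Fintype β] [DecidableEq α] [DecidableEq β]
      (e : α ≃ β), (∀ B : Matrix α α (PowerSeries ℂ), IsUnit B.det →
      ∃ A : Matrix α α ℂ, GaugeEquiv q (B.map toLaurent) (A.map (algebraMap ℂ (LaurentSeries ℂ))) ∧
        ∀ z, A.charpoly.IsRoot z → ∃ c, z = rep q c) → ∀ B : Matrix β β (PowerSeries ℂ), IsUnit B.det →
      ∃ A : Matrix β β ℂ, GaugeEquiv q (B.map toLaurent) (A.map (algebraMap ℂ (LaurentSeries ℂ))) ∧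
        ∀ z, A.charpoly.IsRoot z → ∃ c, z = rep q c := by
    intro α β _ _ _ _ e h B hB
    obtain ⟨A, hA, hroots⟩ := h (B.submatrix e e) (by rwa [Matrix.det_submatrix_equiv_self])
    refine ⟨Matrix.reindex e e A, ?_, fun z hz => hroots z (by rwa [Matrix.charpoly_reindex] at hz)⟩
    convert hA.submatrix e.symm using 1
    · ext1 i j
      simp
    · rfl
  intro inst
  refine Fintype.induction_empty_option (P := fun (ι : Type) _ => ∀ (_ : DecidableEq ι)
    (B : Matrix ι ι (PowerSeries ℂ)), IsUnit B.det →
      ∃ A : Matrix ι ι ℂ, GaugeEquiv q (B.map toLaurent) (A.map (algebraMap ℂ (LaurentSeries ℂ))) ∧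
        ∀ z, A.charpoly.IsRoot z → ∃ c, z = rep q c) ?_ ?_ ?_ ι inst
  · intro α β _ e h _
    let _ := Fintype.ofEquiv β e.symm
    exact transport α β e (h inferInstance)
  · intro _ B _
    refine ⟨0, ⟨1, 1, mul_one _, Subsingleton.elim _ _⟩, fun z hz => ?_⟩
    rw [Polynomial.IsRoot, Matrix.eval_charpoly, Matrix.det_isEmpty] at hz
    exact absurd hz one_ne_zero
  · intro α _ h _
    refine transport (Unit ⊕ α) (Option α)
      ((Equiv.optionEquivSumPUnit α).trans (Equiv.sumComm _ _)).symm fun B hB => ?_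
    obtain ⟨μ, u, B₁, hμ, hB₁, h₁⟩ := exists_gaugeEquiv_triangular hroot hB
    obtain ⟨A, hA, hroots⟩ := h inferInstance B₁ hB₁
    obtain ⟨k, hk⟩ := exists_rep_eq_zpow_mul q (Units.mk0 μ hμ)
    obtain ⟨u', h₂⟩ := exists_gaugeEquiv_of_block (μ := μ) k (u.map toLaurent) hA
    have hk' : (rep q (Units.mk0 μ hμ : ℂˣ) : ℂ) = (q : ℂ) ^ k * μ := by
      rw [hk]
      simp
    obtain ⟨u₀, h₃⟩ := exists_constant_of_block (q := q) (c := (q : ℂ) ^ k * μ) (A := A)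
      (fun j hj h0 => by
        obtain ⟨d, hd⟩ := hroots ((q : ℂ) ^ k * μ * (q : ℂ) ^ j) (by
          rw [Polynomial.IsRoot, Matrix.eval_charpoly, ← neg_sub, Matrix.det_neg, h0, mul_zero])
        rw [← hk', mul_comm] at hd
        exact zpow_mul_rep_ne_rep hroot hj _ _ hd) u'
    refine ⟨_, h₁.trans (GaugeEquiv.trans ?_ h₃), fun z hz => ?_⟩
    · rw [Matrix.fromBlocks_map, Matrix.diagonal_map (map_zero _), Matrix.map_zero _ (map_zero _)]
      simp only [toLaurent_C]
      exact h₂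
    · rw [Matrix.charpoly_fromBlocks_zero₂₁, Polynomial.IsRoot, Polynomial.eval_mul,
        mul_eq_zero] at hz
      rcases hz with hz | hz
      · refine ⟨_, Eq.trans ?_ hk'.symm⟩
        rw [Matrix.eval_charpoly] at hz
        simpa [sub_eq_zero] using hz
      · exact hroots z hz

end FormalReduction

/-! ## Modules that are pure of slope zero have integral structures -/

section Slope

namespace DiffOperator

theorem isSlope_of_line {L : DiffOperator} {μ c : ℝ}
    (h : ∀ i, L.coeff i ≠ 0 →
      μ * (i : ℕ) + c ≤ ((L.coeff i : LaurentSeries ℂ).order : ℤ))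
    {i j : Fin (L.ν + 1)} (hij : i ≠ j) (hi0 : L.coeff i ≠ 0) (hj0 : L.coeff j ≠ 0)
    (hi : ((L.coeff i : LaurentSeries ℂ).order : ℤ) = μ * (i : ℕ) + c)
    (hj : ((L.coeff j : LaurentSeries ℂ).order : ℤ) = μ * (j : ℕ) + c) : L.IsSlope μ := by
  refine ⟨c, ?_, (((i : ℕ) : ℝ), _), subset_convexHull ℝ _ ⟨i, hi0, rfl, le_rfl⟩,
    (((j : ℕ) : ℝ), _), subset_convexHull ℝ _ ⟨j, hj0, rfl, le_rfl⟩, fun e => hij (Fin.ext ?_), hi, hj⟩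
  · have hsub : L.newtonPolygon ⊆ {p | μ * p.1 + c ≤ p.2} := by
      refine convexHull_min ?_ ?_
      · rintro p ⟨k, hk, hp, hp'⟩
        change μ * p.1 + c ≤ p.2
        rw [hp]
        exact (h k hk).trans hp'
      · intro x hx y hy a b ha hb hab
        change μ * x.1 + c ≤ x.2 at hx
        change μ * y.1 + c ≤ y.2 at hy
        change μ * (a * x.1 + b * y.1) + c ≤ a * x.2 + b * y.2
        calc μ * (a * x.1 + b * y.1) + c = a * (μ * x.1 + c) + b * (μ * y.1 + c) := by
              linear_combination -c * hab
          _ ≤ _ := by gcongr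
    exact fun p hp => hsub hp
  · have e1 : ((i : ℕ) : ℝ) = (j : ℕ) := congrArg Prod.fst e
    exact_mod_cast e1

/-- The sign of ε says that b is an endpoint of the index range. The least inclination of a segment
from b, measured along ε, gives a supporting line, hence a slope, which must be 0. So no coefficient
has smaller order than the one at b. -/
theorem order_le_of_isPure {L : DiffOperator} (hL : L.IsPure 0) {b : Fin (L.ν + 1)}
    (hb : L.coeff b ≠ 0) {ε : ℝ} (hε : ∀ i : Fin (L.ν + 1), i ≠ b → 0 < ε * ((i : ℕ) - (b : ℕ) : ℝ))
    {i : Fin (L.ν + 1)} (hi : L.coeff i ≠ 0) :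
    (L.coeff b : LaurentSeries ℂ).order ≤ (L.coeff i : LaurentSeries ℂ).order := by
  classical
  rcases eq_or_ne i b with rfl | hib
  · exact le_rfl
  set o : Fin (L.ν + 1) → ℝ := fun i => ((L.coeff i : LaurentSeries ℂ).order : ℤ) with ho
  set d : Fin (L.ν + 1) → ℝ := fun i => ε * ((i : ℕ) - (b : ℕ) : ℝ) with hd
  obtain ⟨j, hj, hmin⟩ := Finset.exists_min_image
    (Finset.univ.filter fun i => i ≠ b ∧ L.coeff i ≠ 0) (fun i => (o i - o b) / d i)
    ⟨i, by simp [hib, hi]⟩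
  simp only [Finset.mem_filter, Finset.mem_univ, true_and] at hj hmin
  set t := (o j - o b) / d j with ht
  have hslope : L.IsSlope (ε * t) := by
    refine isSlope_of_line (c := o b - ε * t * (b : ℕ)) (fun k hk => ?_) hj.1.symm hb hj.2 ?_ ?_
    · rcases eq_or_ne k b with rfl | hkb
      · exact le_of_eq (by simp only [ho]; ring)
      · have h1 := hmin k ⟨hkb, hk⟩
        rw [le_div_iff₀ (hε k hkb)] at h1
        change t * (ε * ((k : ℕ) - (b : ℕ) : ℝ)) ≤ o k - o b at h1
        change _ ≤ o k
        linarith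
    · change o b = _
      ring
    · change o j = _
      have h1 : t * d j = o j - o b := div_mul_cancel₀ _ (hε j hj.1).ne'
      simp only [hd] at h1
      linarith
  have h0 := hL _ hslope
  have hε0 : ε ≠ 0 := by
    rintro rfl
    simpa using hε i hib
  have ht0 : t = 0 := (mul_eq_zero.1 h0).resolve_left hε0
  have h1 := hmin i ⟨hib, hi⟩
  rw [ht0, le_div_iff₀ (hε i hib), zero_mul, sub_nonneg] at h1
  exact Int.cast_le.1 h1

/-- If the constant coefficient vanished, applying Σ_q⁻¹ to the relation would give a nontrivial
dependence among the first ν iterates. -/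
theorem coeff_zero_ne_zero {q : ℂˣ} {L : DiffOperator} {M : Bq.{u} q} {m : M.carrier}
    (hind : LinearIndependent meroGerms (fun i : Fin L.ν => M.Sig^[i] m))
    (hL : ∑ i : Fin (L.ν + 1), L.coeff i • M.Sig^[i] m = 0) : L.coeff 0 ≠ 0 := by
  intro h0
  rw [Fin.sum_univ_succ, h0, zero_smul, zero_add] at hL
  have h1 : ∑ i : Fin L.ν, (sigma q).symm (L.coeff i.succ) • M.Sig^[i] m = 0 := by
    have := congrArg M.Sig.symm hL
    simp only [map_sum, map_zero, M.symm_smul, Fin.val_succ, Function.iterate_succ_apply',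
      AddEquiv.symm_apply_apply] at this
    exact this
  have h2 := Fintype.linearIndependent_iff.1 hind _ h1
  refine L.lead_ne_zero ?_
  rcases Fin.eq_zero_or_eq_succ (Fin.last L.ν) with h | ⟨j, h⟩
  · rw [h, h0]
  · rw [h]
    exact (map_eq_zero_iff _ (sigma q).symm.injective).1 (h2 j)

end DiffOperator

/-- The ring of germs of holomorphic functions. -/
def holoGerms : Subring meroGerms := toLaurent.range.comap meroGerms.subtype

theorem div_mem_holoGerms {f g : meroGerms} (hg : g ≠ 0)
    (h : f ≠ 0 → (g : LaurentSeries ℂ).order ≤ (f : LaurentSeries ℂ).order) : f / g ∈ holoGerms := by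
  rcases eq_or_ne f 0 with rfl | hf
  · rw [zero_div]
    exact zero_mem _
  have e : (f : LaurentSeries ℂ) = ((f / g : meroGerms) : LaurentSeries ℂ) * g := by
    rw [← Subfield.coe_mul, div_mul_cancel₀ _ hg]
  have h1 := congrArg HahnSeries.order e
  rw [HahnSeries.order_mul (fun h => div_ne_zero hf hg (Subtype.ext h))
    (fun h => hg (Subtype.ext h))] at h1
  have h2 := h hf
  obtain ⟨p, hp⟩ := exists_toLaurent_eq (f := ((f / g : meroGerms) : LaurentSeries ℂ))
    fun n hn => HahnSeries.coeff_eq_zero_of_lt_order (by omega)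
  exact ⟨p, hp⟩

/-- If C is the matrix of Σ_q⁻¹, then σ_q(C) inverts the matrix of Σ_q, so holomorphy of both gives
invertibility over power series. -/
theorem exists_powerSeries_sigMatrix {q : ℂˣ} {n : Type*} [Fintype n] [DecidableEq n]
    {M : Bq.{u} q} (b : Module.Basis n meroGerms M.carrier)
    (h : ∀ i j, b.repr (M.Sig (b j)) i ∈ holoGerms)
    (h' : ∀ i j, b.repr (M.Sig.symm (b j)) i ∈ holoGerms) :
    ∃ P : Matrix n n (PowerSeries ℂ), IsUnit P.det ∧
      (DiffModule.sigMatrix b).map meroGerms.subtype = P.map toLaurent := by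
  choose P hP using h
  choose P' hP' using h'
  set C : Matrix n n meroGerms := Matrix.of fun i j => b.repr (M.Sig.symm (b j)) i with hC
  have hBC : DiffModule.sigMatrix b * C.map (sigma q) = 1 := by
    ext1 i j
    have e := DiffModule.sig_toLin_basis b b C j
    have e2 : Matrix.toLin b b C (b j) = M.Sig.symm (b j) := by
      rw [Matrix.toLin_self]
      exact b.sum_repr _
    rw [e2, AddEquiv.apply_symm_apply] at e
    have e3 := congrArg (fun x => b.repr x i) e
    simp only [Module.Basis.repr_self, map_sum, map_smul, Finsupp.coe_finsetSum, Finset.sum_apply,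
      Finsupp.smul_apply, Finsupp.single_apply, smul_eq_mul, mul_ite, mul_one, mul_zero,
      Finset.sum_ite_eq', Finset.mem_univ, if_true] at e3
    rw [← e3, Matrix.one_apply]
    simp only [eq_comm]
  have hPmap : (DiffModule.sigMatrix b).map meroGerms.subtype = (Matrix.of P).map toLaurent := by
    ext1 i j
    exact (hP i j).symm
  refine ⟨Matrix.of P, ?_, hPmap⟩
  refine Matrix.isUnit_det_of_right_inverse (B := (Matrix.of P').map (PowerSeries.rescale (q : ℂ))) ?_
  refine Matrix.map_injective toLaurent_injective ?_
  beta_reduce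
  rw [Matrix.map_mul, ← hPmap, Matrix.map_one _ (map_zero _) (map_one _)]
  have e : ((Matrix.of P').map (PowerSeries.rescale (q : ℂ))).map toLaurent =
      (C.map (sigma q)).map meroGerms.subtype := by
    ext1 i j
    change toLaurent (PowerSeries.rescale (q : ℂ) (P' i j)) =
      sigmaHat q (b.repr (M.Sig.symm (b j)) i : LaurentSeries ℂ)
    rw [← sigmaHat_toLaurent]
    exact congrArg _ (hP' i j)
  rw [e, ← Matrix.map_mul, hBC, Matrix.map_one _ (map_zero _) (map_one _)]

/-- In the cyclic basis, only Σ_q of the last vector and Σ_q⁻¹ of the first are not basis vectors.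
Their coordinates involve a_k/a_ν and a_k/a_0, holomorphic because a_0 and a_ν have minimal order.
-/
theorem exists_integral_basis {q : ℂˣ} {M : Bq.{u} q} (hM : IsPureOfSlope q 0 M) :
    ∃ (ν : ℕ) (b : Module.Basis (Fin ν) meroGerms M.carrier)
      (P : Matrix (Fin ν) (Fin ν) (PowerSeries ℂ)), IsUnit P.det ∧
      (DiffModule.sigMatrix b).map meroGerms.subtype = P.map toLaurent := by
  obtain ⟨L, ⟨m, hind, hspan, hL⟩, hpure⟩ := hM
  have h0 := DiffOperator.coeff_zero_ne_zero hind hL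
  have hord0 : ∀ {i}, L.coeff i ≠ 0 →
      (L.coeff 0 : LaurentSeries ℂ).order ≤ (L.coeff i : LaurentSeries ℂ).order :=
    DiffOperator.order_le_of_isPure hpure h0 (ε := 1) fun i hi => by
      have : 0 < (i : ℕ) := Nat.pos_of_ne_zero fun h => hi (Fin.ext h)
      simpa using this
  have hordν : ∀ {i}, L.coeff i ≠ 0 →
      (L.coeff (Fin.last _) : LaurentSeries ℂ).order ≤ (L.coeff i : LaurentSeries ℂ).order :=
    DiffOperator.order_le_of_isPure hpure L.lead_ne_zero (ε := -1) fun i hi => by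
      have : (i : ℕ) < L.ν := Fin.val_lt_last hi
      have : ((i : ℕ) : ℝ) < L.ν := by exact_mod_cast this
      rw [Fin.val_last]
      linarith
  let b : Module.Basis (Fin L.ν) meroGerms M.carrier := Module.Basis.mk hind hspan.ge
  have hb : ∀ j, b j = M.Sig^[j] m := fun j => Module.Basis.mk_apply hind hspan.ge j
  have hself : ∀ i j, b.repr (b j) i ∈ holoGerms := fun i j => by
    rw [Module.Basis.repr_self, Finsupp.single_apply]
    split_ifs
    exacts [one_mem _, zero_mem _]
  have hsum : ∀ (c : Fin L.ν → meroGerms) (j : Fin L.ν → Fin L.ν), (∀ i, c i ∈ holoGerms) →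
      ∀ i, b.repr (∑ k, c k • b (j k)) i ∈ holoGerms := fun c j hc i => by
    rw [map_sum, Finsupp.coe_finsetSum, Finset.sum_apply]
    refine sum_mem fun k _ => ?_
    rw [map_smul, Finsupp.smul_apply, smul_eq_mul]
    exact mul_mem (hc k) (hself i (j k))
  refine ⟨L.ν, b, exists_powerSeries_sigMatrix b (fun i j => ?_) fun i j => ?_⟩
  · rw [hb, ← Function.iterate_succ_apply' M.Sig]
    rcases Nat.lt_or_ge ((j : ℕ) + 1) L.ν with hj | hj
    · have := hself i ⟨j + 1, hj⟩
      rwa [hb] at this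
    · have hj' : (j : ℕ) + 1 = L.ν := le_antisymm j.2 hj
      have e : M.Sig^[(j : ℕ) + 1] m =
          ∑ k : Fin L.ν, -(L.coeff k.castSucc / L.coeff (Fin.last _)) • b k := by
        rw [Fin.sum_univ_castSucc, Fin.val_last] at hL
        rw [hj']
        have h2 := congrArg (fun x => (L.coeff (Fin.last _))⁻¹ • x) hL
        simp only [smul_add, Finset.smul_sum, smul_smul, inv_mul_cancel₀ L.lead_ne_zero, one_smul,
          smul_zero, Fin.val_castSucc] at h2
        rw [eq_neg_of_add_eq_zero_right h2, ← Finset.sum_neg_distrib]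
        refine Finset.sum_congr rfl fun k _ => ?_
        rw [hb, neg_smul, div_eq_mul_inv, mul_comm]
      rw [e]
      exact hsum _ id (fun k => neg_mem (div_mem_holoGerms L.lead_ne_zero hordν)) i
  · rcases Nat.eq_zero_or_pos (j : ℕ) with hj | hj
    · have e : M.Sig.symm m =
          ∑ k : Fin L.ν, -(sigma q).symm (L.coeff k.succ / L.coeff 0) • b k := by
        rw [AddEquiv.symm_apply_eq, DiffModule.sig_sum]
        rw [Fin.sum_univ_succ] at hL
        have h2 := congrArg (fun x => (L.coeff 0)⁻¹ • x) hL
        simp only [smul_add, Finset.smul_sum, smul_smul, inv_mul_cancel₀ h0, one_smul,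
          smul_zero, Fin.val_succ, Fin.val_zero, Function.iterate_zero, id] at h2
        rw [eq_neg_of_add_eq_zero_left h2, ← Finset.sum_neg_distrib]
        refine Finset.sum_congr rfl fun k _ => ?_
        rw [hb, map_neg, RingEquiv.apply_symm_apply, neg_smul, div_eq_mul_inv, mul_comm,
          Function.iterate_succ_apply']
      rw [hb, hj, Function.iterate_zero, id, e]
      refine hsum _ id (fun k => neg_mem ?_) i
      obtain ⟨p, hp⟩ := div_mem_holoGerms (f := L.coeff k.succ) h0 hord0
      refine ⟨PowerSeries.rescale ((q⁻¹ : ℂˣ) : ℂ) p, ?_⟩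
      rw [← sigmaHat_toLaurent, hp]
      rfl
    · obtain ⟨l, hl⟩ := Nat.exists_eq_succ_of_ne_zero hj.ne'
      have hlt : l < L.ν := by
        have := j.2
        omega
      have e : M.Sig.symm (b j) = b ⟨l, hlt⟩ := by
        rw [hb, hb, hl, Function.iterate_succ_apply', AddEquiv.symm_apply_apply]
      rw [e]
      exact hself _ _

end Slope

/-! ## Essential surjectivity -/

/-- Formal reduction yields K ⊗ W formally isomorphic to M, and membership of M in B_q^iso makes the
two analytically isomorphic. The property then passes from M to K ⊗ W. -/
theorem exists_analyticModule_iso {q : ℂˣ} (hroot : ∀ n : ℕ, 0 < n → q ^ n ≠ 1) {M : Bq.{u} q}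
    (hM : InIso q M) (hM0 : IsPureOfSlope q 0 M) : ∃ W : GrNil.{u} q,
      Nonempty (analyticModule q W.twistEquiv ≅ M) ∧ InIso q (analyticModule q W.twistEquiv) := by
  obtain ⟨ν, b, P, hP, hbP⟩ := exists_integral_basis hM0
  obtain ⟨A, ⟨T, T', hT, hTA⟩, hroots⟩ := exists_gaugeEquiv_constant hroot (Fin ν) P hP
  -- Lifting the index type places the space in the required universe.
  let v : Module.Basis (Fin ν) ℂ (ULift.{u} (Fin ν) → ℂ) :=
    (Pi.basisFun ℂ (ULift.{u} (Fin ν))).reindex Equiv.ulift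
  obtain ⟨W, e, he⟩ := exists_grNil_twist_eq q (Matrix.toLin v v A) fun z hz => hroots z <| by
    rwa [Module.End.hasEigenvalue_iff_isRoot_charpoly, ← LinearMap.charpoly_toMatrix _ v,
      LinearMap.toMatrix_toLin] at hz
  let w : Module.Basis (Fin ν) ℂ (DiffModule.ofAut W.carrier W.twistEquiv).carrier := v.map e
  have hw : DiffModule.sigMatrix w = A := by
    ext i j
    change v.repr (e.symm (W.twist (e (v j)))) i = A i j
    rw [← he, e.symm_apply_apply, Matrix.toLin_self]
    simp [Finsupp.single_apply]
  let wK := DiffModule.baseChangeBasis (τ := sigma q) (sigma_algebraMap q) w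
  have hwK : DiffModule.sigMatrix wK = A.map (algebraMap ℂ meroGerms) :=
    (DiffModule.sigMatrix_baseChangeBasis _ w).trans (by rw [hw])
  have hwhat : DiffModule.sigMatrix (formalizationBasis wK) =
      A.map (algebraMap ℂ (LaurentSeries ℂ)) :=
    (sigMatrix_formalizationBasis wK).trans (by rw [hwK]; rfl)
  obtain ⟨f⟩ : Nonempty (formalization (analyticModule q W.twistEquiv) ≅ formalization M) := by
    refine DiffModule.nonempty_iso_of_matrix (formalizationBasis wK) (formalizationBasis b) hT ?_
    rw [sigMatrix_formalizationBasis b, hbP, hTA, hwhat]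
  obtain ⟨g⟩ := hM _ ⟨f⟩
  refine ⟨W, ⟨g⟩, fun N ⟨h⟩ => ?_⟩
  obtain ⟨k⟩ := hM N ⟨h ≪≫ f⟩
  exact ⟨k ≪≫ g.symm⟩

/-! ## The equivalence of categories -/

section Functor

variable {q : ℂˣ}

theorem GrNil.Hom.toLin_twist {V W : GrNil.{u} q} (f : V ⟶ W) (v : V.carrier) :
    f.toLin (V.twist v) = W.twist (f.toLin v) := by
  refine congrArg (fun g : V.carrier →ₗ[ℂ] W.carrier => g v)
    (linearMap_ext_of_iSup_eq_top V.iSup_comp (f := f.toLin ∘ₗ V.twist) (g := W.twist ∘ₗ f.toLin) ?_)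
  intro c v hv
  change f.toLin (V.twist v) = W.twist (f.toLin v)
  have h1 := V.nil_apply hv
  have h2 := W.nil_apply (f.map_comp c v hv)
  rw [← f.comm, h1, map_sub, map_smul] at h2
  exact smul_right_injective _ (inv_ne_zero (rep q c).ne_zero) (sub_left_injective h2)

/-- The morphism `1 ⊗ f`. -/
def analyticHom {V W : GrNil.{u} q} (f : V ⟶ W) :
    analyticModule q V.twistEquiv ⟶ analyticModule q W.twistEquiv where
  toLin := f.toLin.baseChange meroGerms
  comm t := by
    have key : ∀ t : meroGerms ⊗[ℂ] V.carrier, f.toLin.baseChange meroGerms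
        (analyticSig q V.twistEquiv t) =
        analyticSig q W.twistEquiv (f.toLin.baseChange meroGerms t) := fun t => by
      induction t using TensorProduct.induction_on with
      | zero => simp only [map_zero]
      | tmul a v =>
        rw [analyticSig_tmul, LinearMap.baseChange_tmul, LinearMap.baseChange_tmul,
          analyticSig_tmul, GrNil.twistEquiv_apply, GrNil.twistEquiv_apply, f.toLin_twist]
      | add x y hx hy => simp only [map_add, hx, hy]
    exact key t

/-- The functor `(V, N) ↦ K ⊗ V`. -/
def analyticFunctor (q : ℂˣ) : GrNil.{u} q ⥤ Bq.{u} q where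
  obj V := analyticModule q V.twistEquiv
  map f := analyticHom f
  map_id _ := DiffModule.hom_ext (LinearMap.baseChange_id (A := meroGerms))
  map_comp f g := DiffModule.hom_ext (LinearMap.baseChange_comp (A := meroGerms) f.toLin g.toLin)

instance : (analyticFunctor.{u} q).Faithful where
  map_injective {V W f g} h := by
    refine GrNil.Hom.ext (LinearMap.ext fun v => ?_)
    have h1 : ((1 : meroGerms) ⊗ₜ[ℂ] f.toLin v : meroGerms ⊗[ℂ] W.carrier) =
        (1 : meroGerms) ⊗ₜ[ℂ] g.toLin v := by
      have h2 := congrArg (fun k : analyticModule q V.twistEquiv ⟶ analyticModule q W.twistEquiv =>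
        k.toLin ((1 : meroGerms) ⊗ₜ[ℂ] v)) h
      exact h2
    have h3 := congrArg (coeffTensor W.carrier 0 ∘ germToFormal W.carrier) h1
    simpa [germToFormal_tmul, coeffTensor_tmul] using h3

/-- Restricting a morphism to 1 ⊗ V and passing to Laurent series, formal rigidity makes it
constant; K ⊗ W embeds in its formalization and 1 ⊗ V generates, so the morphism is 1 ⊗ g. -/
theorem analyticFunctor_full (hroot : ∀ n : ℕ, 0 < n → q ^ n ≠ 1) :
    (analyticFunctor.{u} q).Full where
  map_surjective {V W} φ := by
    let F : meroGerms ⊗[ℂ] V.carrier →ₗ[meroGerms] meroGerms ⊗[ℂ] W.carrier := φ.toLin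
    have hF : ∀ t, F (analyticSig q V.twistEquiv t) = analyticSig q W.twistEquiv (F t) := φ.comm
    obtain ⟨g, hg⟩ := exists_eq_one_tmul hroot V W
      (germToFormal W.carrier ∘ₗ F.restrictScalars ℂ ∘ₗ TensorProduct.mk ℂ meroGerms V.carrier 1)
      fun v => by
        change germToFormal W.carrier (F ((1 : meroGerms) ⊗ₜ[ℂ] V.twist v)) =
          formalSig q W.twistEquiv (germToFormal W.carrier (F ((1 : meroGerms) ⊗ₜ[ℂ] v)))
        rw [← germToFormal_sig, ← hF, analyticSig_tmul, map_one]
        rfl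
    refine ⟨g, DiffModule.hom_ext ?_⟩
    have key : ∀ t, g.toLin.baseChange meroGerms t = F t := fun t => by
      induction t using TensorProduct.induction_on with
      | zero => simp only [map_zero]
      | tmul a v =>
        have h1 : (1 : meroGerms) ⊗ₜ[ℂ] g.toLin v = F ((1 : meroGerms) ⊗ₜ[ℂ] v) :=
          germToFormal_injective ((germToFormal_tmul 1 (g.toLin v)).trans (hg v).symm)
        have h2 : a ⊗ₜ[ℂ] v = a • ((1 : meroGerms) ⊗ₜ[ℂ] v) := by
          rw [TensorProduct.smul_tmul', smul_eq_mul, mul_one]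
        rw [h2, map_smul, map_smul, ← h1, LinearMap.baseChange_tmul]
      | add x y hx hy => rw [map_add, map_add, hx, hy]
    exact LinearMap.ext key

theorem nonempty_equivalence (hq : ‖(q : ℂ)‖ = 1) (hroot : ∀ n : ℕ, 0 < n → q ^ n ≠ 1)
    (hconv : Converges fun n => (qPoch q q n)⁻¹) :
    Nonempty (BqIsoF.{u} q ≌ GrNilD.{u} q) := by
  have := analyticFunctor_full.{u} hroot
  let F : GrNilD.{u} q ⥤ BqIsoF.{u} q :=
    ObjectProperty.lift _ ((ConditionD q).ι ⋙ analyticFunctor q) fun V =>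
      ⟨inIso_of_conditionD hq hroot hconv V.property, isPureOfSlope_zero_analyticModule hroot V.obj⟩
  have hess : F.EssSurj := ⟨fun M => by
    obtain ⟨W, ⟨e⟩, hW⟩ := exists_analyticModule_iso hroot M.property.1 M.property.2
    exact ⟨⟨W, conditionD_of_inIso hroot hq hconv hW⟩, ⟨ObjectProperty.isoMk _ e⟩⟩⟩
  have : F.IsEquivalence := { }
  exact ⟨F.asEquivalence.symm⟩

end Functor

end QDifference

end

theorem mainTheorem2 (q : ℂˣ) (hq : ‖(q : ℂ)‖ = 1) (hroot : ∀ n : ℕ, 0 < n → q ^ n ≠ 1)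
    (hconv : QDifference.Converges fun n => (QDifference.qPoch q q n)⁻¹) :
    Nonempty (QDifference.BqIsoF.{u} q ≌ QDifference.GrNilD.{u} q) := by
  exact QDifference.nonempty_equivalence hq hroot hconv
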